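/- **Setting.** Let $n,B\ge 1$, $d\ge1$, $L\ge 2$, $m\ge 2$ and $C\ge 0$ be integers. A stream is a finite sequence $\mathcal D=\{(x_t,y_t)\}_{t=1}^n$ with $x_t\in\mathbb R^d$, $y_t\in\{\pm1\}$, in arbitrary order, such that $\|x_t\|_2=1$ for all $t$ and $\|x_i-x_j\|_2\ge\lambda$ for $i\ne j$, for some $\lambda>0$. Consider networks $f_{\mathbf W}(x)=\sqrt m\,W_L\sigma(W_{L-1}\sigma(\cdots\sigma(W_1x)\cdots))$, $\mathbf W=(W_1,\dots,W_L)$, with $\sigma$ the ReLU, $W_1\in\mathbb R^{m\times d}$, $W_l\in\mathbb R^{m\times m}$ for $2\le l\le L-1$, $W_L\in\mathbb R^{1\times m}$; gradients in $\mathbf W$ are computed by backpropagation with $\sigma'(z)=\mathbb 1\{z>0\}$. Let $\ell(z)=\log(1+e^{-z})$. The initialization $\mathbf W^{(0)}$ has independent centered Gaussian entries, of variance $2/m$ in layers $1,\dots,L-1$ and of variance $1/m$ in layer $L$. **Training.** A replay buffer of capacity $C$ starts empty. At step $t=1,\dots,n$, draw $B$ independent uniform samples $\mathcal S_t$ from the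 buffer, independently of the initialization (no samples if the buffer is empty), and put $$\mathbf W^{(t)}=\mathbf W^{(t-1)}-\eta\Big(\nabla_{\mathbf W}\,\ell\big(y_tf_{\mathbf W}(x_t+\xi_t)\big)+\sum_{(x_{\rm rep},y_{\rm rep})\in\mathcal S_t}\nabla_{\mathbf W}\,\ell\big(y_{\rm rep}f_{\mathbf W}(x_{\rm rep}+\xi_{\rm rep})\big)\Big)\Big|_{\mathbf W=\mathbf W^{(t-1)}},$$ where only layers $2,\dots,L-1$ are updated (the first and the last layer stay fixed); then store $(x_t,y_t)$ in the buffer and, if it holds more than $C$ entries, evict a uniformly chosen one. The perturbations $\xi_t$ and $\xi_{\rm rep}$ (a separate one for each step and replay slot, which may depend on the replayed example) are arbitrary fixed vectors, and $\Xi$ is the supremum of their squared norms $\|\xi\|_2^2$. Let $L^{0\text{-}1}_{\mathcal D}(\mathbf W)=\frac1n\sum_{s=1}^n\mathbb 1\{y_sf_{\mathbf W}(x_s+\xi_s)<0\}$ be the 0-1 error over the stream, let $\hat{\mathbf W}$ be uniform on the iterates $\{\mathbf W^{(0)},\dots,\mathbf W^{(n)}\}$, with $\mathbb E$ the expectation over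 this choice only, and let $$\mathcal F(\mathbf W^{(0)},r)=\big\{f_{\mathbf W^{(0)}}(\cdot)+\langle\nabla_{\mathbf W}f_{\mathbf W^{(0)}}(\cdot),\mathbf W\rangle:\ \|W_l\|_F\le r\ \text{ for all } l=1,\dots,L\big\}.$$ **Theorem.** For every $\kappa>0$ there are constants $C_1,C_2>0$, depending only on $\kappa$, such that for all data as above, if $$m\ge C_1\,nB\sqrt{1+\Xi}\,L^6\log^3 m\quad\text{and}\quad 0<\eta\le\kappa\, m^{-3/2},$$ then for all $R>0$ and $\delta\in(0,1)$, with probability at least $1-\delta$ over the initialization and the replay sampling, $$\mathbb E\big[L^{0\text{-}1}_{\mathcal D}(\hat{\mathbf W})\big]\le\inf_{f\in\mathcal F(\mathbf W^{(0)},R/m)}\frac4n\sum_{t=1}^n\ell\big(y_tf(x_t+\xi_t)\big)+\sqrt{\frac{2\log(1/\delta)}{n}}+C_2\,\frac{(1+\Xi)^{3/4}B^{1/2}n+R^2}{L^2\log^{3/2}m}.$$ -/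

import Mathlib

open MeasureTheory ProbabilityTheory
open scoped NNReal ENNReal Matrix

noncomputable section

namespace StreamNet

/-! ## The network -/

/-- The weights of a fully connected network with input dimension `d`, width `m` and depth
`L = H + 2`: the first layer `W₁` (`m × d`), the `H = L - 2` square layers `W₂, …, W_{L-1}`
(`m × m`, the entry `k : Fin H` being `W_{k+2}`), and the output row `W_L` (`1 × m`). -/
abbrev Weights (d m H : ℕ) : Type :=
  (Fin m → Fin d → ℝ) × (Fin H → Fin m → Fin m → ℝ) × (Fin m → ℝ)

variable {d m H : ℕ}

/-- The first layer `W₁`. -/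
def Weights.first (W : Weights d m H) : Matrix (Fin m) (Fin d) ℝ := Matrix.of W.1

/-- The square layer `W_{k+2}`. -/
def Weights.hidden (W : Weights d m H) (k : Fin H) : Matrix (Fin m) (Fin m) ℝ :=
  Matrix.of (W.2.1 k)

/-- The output row `W_L`. -/
def Weights.last (W : Weights d m H) : Fin m → ℝ := W.2.2

/-- The entrywise ReLU. -/
def relu (v : Fin m → ℝ) : Fin m → ℝ := fun i => max (v i) 0

/-- The hidden activations: `act W z k` is `h_{k+1}`, where `h₁ = σ(W₁ z)` and
`h_l = σ(W_l h_{l-1})` for `2 ≤ l ≤ L - 1`. -/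
def act (W : Weights d m H) (z : EuclideanSpace ℝ (Fin d)) (k : Fin (H + 1)) : Fin m → ℝ :=
  Fin.induction (motive := fun _ => Fin m → ℝ)
    (relu (W.first *ᵥ fun j => z j)) (fun k h => relu (W.hidden k *ᵥ h)) k

/-- The network output `f_W(z) = √m · W_L σ(W_{L-1} σ(⋯ σ(W₁ z)⋯))`. -/
def net (W : Weights d m H) (z : EuclideanSpace ℝ (Fin d)) : ℝ :=
  √(m : ℝ) * (W.last ⬝ᵥ act W z (Fin.last H))

/-- Multiplication by the activation pattern `D = diag(𝟙{(W_l h_{l-1})_i > 0})` of the layer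
whose output is `h`. (A preactivation is positive exactly when its ReLU is.) -/
def mask (h v : Fin m → ℝ) : Fin m → ℝ := fun i => if 0 < h i then v i else 0

/-- Backward pass: `back W z k` is the row `W_L (D_{L-1} W_{L-1}) ⋯ (D_{l+1} W_{l+1}) D_l` with
`l = k + 1`, that is, the gradient of `W_L h_{L-1}` in the preactivation of layer `l`, with the
usual convention `σ'(0) = 0`. -/
def back (W : Weights d m H) (z : EuclideanSpace ℝ (Fin d)) (k : Fin (H + 1)) : Fin m → ℝ :=
  Fin.reverseInduction (motive := fun _ => Fin m → ℝ)
    (mask (act W z (Fin.last H)) W.last)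
    (fun k b => mask (act W z k.castSucc) ((W.hidden k)ᵀ *ᵥ b)) k

/-- The gradient `∇_W f_W(z)` in all the layers: `√m · (h_{l-1} · back_l)ᵀ` for `l < L` (with
`h₀ = z`) and `√m · h_{L-1}ᵀ` for the last layer. -/
def gradNet (W : Weights d m H) (z : EuclideanSpace ℝ (Fin d)) : Weights d m H :=
  (fun i j => √(m : ℝ) * (back W z 0 i * z j),
   fun k i j => √(m : ℝ) * (back W z k.succ i * act W z k.castSucc j),
   fun i => √(m : ℝ) * act W z (Fin.last H) i)

/-- `⟨W, W'⟩ = ∑_l Tr(W_lᵀ W_l')`. -/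
def innerW (W W' : Weights d m H) : ℝ :=
  (∑ i, ∑ j, W.1 i j * W'.1 i j) + (∑ k, ∑ i, ∑ j, W.2.1 k i j * W'.2.1 k i j) +
    ∑ i, W.2.2 i * W'.2.2 i

/-- The layerwise Frobenius ball `𝓑(W, ω)`. -/
def nbhd (W : Weights d m H) (ω : ℝ) : Set (Weights d m H) :=
  {W' | √(∑ i, ∑ j, (W'.1 i j - W.1 i j) ^ 2) ≤ ω ∧
    (∀ k, √(∑ i, ∑ j, (W'.2.1 k i j - W.2.1 k i j) ^ 2) ≤ ω) ∧
    √(∑ i, (W'.2.2 i - W.2.2 i) ^ 2) ≤ ω}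

/-- The neural tangent random feature class `𝓕(W₀, R)`: the functions
`f_{W₀} + ⟨∇_W f_{W₀}, W⟩` with `W ∈ 𝓑(0, R)`. -/
def ntrf (W₀ : Weights d m H) (R : ℝ) : Set (EuclideanSpace ℝ (Fin d) → ℝ) :=
  {f | ∃ W ∈ nbhd (0 : Weights d m H) R, f = fun z => net W₀ z + innerW (gradNet W₀ z) W}

/-! ## Loss and errors -/

/-- The cross-entropy loss `ℓ(z) = log(1 + e^{-z})`. -/
def loss (z : ℝ) : ℝ := Real.log (1 + Real.exp (-z))

/-- The gradient in `W` of `ℓ(y · f_W(z))`, by the chain rule. -/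
def gradLoss (W : Weights d m H) (z : EuclideanSpace ℝ (Fin d)) (y : ℝ) : Weights d m H :=
  (deriv loss (y * net W z) * y) • gradNet W z

variable {n B : ℕ}

/-- The 0-1 error over the whole stream: the average over the examples `(x_s, y_s)` of
`𝟙{y_s · f_W(x_s + ξ_s) < 0}`. -/
def zeroOneError (x : Fin n → EuclideanSpace ℝ (Fin d)) (y : Fin n → ℝ)
    (ξ : Fin n → EuclideanSpace ℝ (Fin d)) (W : Weights d m H) : ℝ :=
  (∑ s, if y s * net W (x s + ξ s) < 0 then (1 : ℝ) else 0) / n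

/-! ## Replay -/

/-- A replay schedule: the entry at `(t, j)` is the index of the stream example that is
replayed in slot `j` at step `t`, and `none` if the buffer was empty. -/
def Schedule (n B : ℕ) : Type := Fin n → Fin B → Option (Fin n)

instance : MeasurableSpace (Schedule n B) := ⊤

/-- `B` independent uniform samples from the buffer `𝓡` (no sample from an empty buffer). -/
def replaySample (B : ℕ) (𝓡 : Finset (Fin n)) : PMF (Fin B → Option (Fin n)) :=
  if h : 𝓡.Nonempty then
    (PMF.uniformOfFinset (Fintype.piFinset fun _ : Fin B => 𝓡)
      (Fintype.piFinset_nonempty.2 fun _ => h)).map fun s j => some (s j)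
  else PMF.pure fun _ => none

/-- If the buffer holds more than `C` entries, evict one chosen uniformly. -/
def replayEvict (C : ℕ) (𝓡 : Finset (Fin n)) : PMF (Finset (Fin n)) :=
  if h : C < 𝓡.card then
    (PMF.uniformOfFinset 𝓡 (Finset.card_pos.1 (Nat.zero_lt_of_lt h))).map fun i => 𝓡.erase i
  else PMF.pure 𝓡

/-- One step of the buffer process: draw the replay examples of step `t` from the current buffer,
then store example `t` and evict if the capacity `C` is exceeded. -/
def replayStep (B C : ℕ) (s : Finset (Fin n) × Schedule n B) (t : Fin n) :
    PMF (Finset (Fin n) × Schedule n B) :=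
  (replaySample B s.1).bind fun draw =>
    (replayEvict C (insert t s.1)).map fun 𝓡 =>
      (𝓡, (Function.update s.2 t draw : Fin n → Fin B → Option (Fin n)))

/-- The law of the replay schedule over the steps `t = 1, …, n`, started from an empty buffer. -/
def replayLaw (n B C : ℕ) : PMF (Schedule n B) :=
  ((List.finRange n).foldlM (replayStep B C)
    ((∅ : Finset (Fin n)), (fun _ _ => none : Schedule n B))).map Prod.snd

/-! ## Training -/

/-- The first and the last layer are not trained: discard these parts of a gradient. -/
def trained (G : Weights d m H) : Weights d m H := (0, G.2.1, 0)

/-- The iterates `W⁽⁰⁾, …, W⁽ⁿ⁾` of streaming SGD with step size `η`: step `t` uses the new example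
`(x_t + ξ_t, y_t)` and, for each slot `j`, the replayed example `i` of that slot, perturbed by
its own vector `ξrep t j i`. -/
def iterate (x : Fin n → EuclideanSpace ℝ (Fin d)) (y : Fin n → ℝ)
    (ξ : Fin n → EuclideanSpace ℝ (Fin d))
    (ξrep : Fin n → Fin B → Fin n → EuclideanSpace ℝ (Fin d)) (η : ℝ)
    (W₀ : Weights d m H) (S : Schedule n B) (t : Fin (n + 1)) : Weights d m H :=
  Fin.induction (motive := fun _ => Weights d m H) W₀
    (fun t W => W - η • trained (gradLoss W (x t + ξ t) (y t) +
      ∑ j, match S t j with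
        | none => 0
        | some i => gradLoss W (x i + ξrep t j i) (y i))) t

/-- `𝔼[L^{0-1}(Ŵ)]` for `Ŵ` drawn uniformly from the iterates `W⁽⁰⁾, …, W⁽ⁿ⁾`. -/
def expectedError (x : Fin n → EuclideanSpace ℝ (Fin d)) (y : Fin n → ℝ)
    (ξ : Fin n → EuclideanSpace ℝ (Fin d))
    (ξrep : Fin n → Fin B → Fin n → EuclideanSpace ℝ (Fin d)) (η : ℝ)
    (W₀ : Weights d m H) (S : Schedule n B) : ℝ :=
  (∑ t : Fin (n + 1), zeroOneError x y ξ (iterate x y ξ ξrep η W₀ S t)) / (n + 1 : ℕ)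

/-- The Gaussian initialization: independent entries, of variance `2 / m` in the layers
`1, …, L - 1` and of variance `1 / m` in the layer `L`. -/
def initLaw (d m H : ℕ) : Measure (Weights d m H) :=
  (Measure.pi fun _ => Measure.pi fun _ => gaussianReal 0 (2 / (m : ℝ≥0))).prod
    ((Measure.pi fun _ => Measure.pi fun _ => Measure.pi fun _ =>
        gaussianReal 0 (2 / (m : ℝ≥0))).prod
      (Measure.pi fun _ => gaussianReal 0 (1 / (m : ℝ≥0))))

/-- The joint law of the initialization and the (independent) replay schedule. -/
def trainLaw (d m H n B C : ℕ) : Measure (Weights d m H × Schedule n B) :=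
  (initLaw d m H).prod (replayLaw n B C).toMeasure

/-- `Ξ`, the supremum of `‖ξ‖²` over the (finitely many) perturbation vectors of the new and the
replayed examples. -/
def supPert (ξ : Fin n → EuclideanSpace ℝ (Fin d))
    (ξrep : Fin n → Fin B → Fin n → EuclideanSpace ℝ (Fin d)) : ℝ :=
  sSup ({r | ∃ t, r = ‖ξ t‖ ^ 2} ∪ {r | ∃ t j i, r = ‖ξrep t j i‖ ^ 2})

end StreamNet

end

/-! No regret argument for SGD is needed: the bound is either trivial or holds for every replay
schedule once the initialization is regular. The error is at most 1 and the infimum is nonnegative,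
so only the case where the last two terms sum to less than 1 matters. In that case δ ≥ e^{-n/2}, so
an initialization event of failure probability e^{-n/2} suffices. Moreover (1+Ξ)^{3/4}√B n and R²
lie below L² log^{3/2} m, which together with the width hypothesis forces the lazy regime: on every
stream input, each iterate and each function of the random feature class stays within 1/2 of the
initial network. Hence an iterate that errs on an example leaves every feature function with margin
at most 1 there, where the loss is at least 1/4; averaging gives the factor 4 (`indicator_le_loss`,
`expectedError_le_sInf`).

The lazy regime follows from `IsRegular`: products of layers are bounded for all masks that differ
from the activation pattern in at most 2q entries per layer, activations have the order of the
input, and at most q preactivations per layer are small. If the layers move by ω, the change of the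
activations solves an exact linear recursion whose masks are secant slopes of the ReLU
(`actSeq_sub_succ`). An induction over the layers keeps both the activations and the number of sign
flips under control (`IsRegular.act_flips`). This bounds outputs and gradients near the
initialization, and hence confines training to a small ball (`hiddenClose_iterate`).

Regularity holds with high probability (`exists_bad_set`). For a fixed vector and a fixed override
of the patterns, high moments of a masked product barely grow with depth, because by the symmetry w
↦ -w a gate halves the second moment and the variance 2/m compensates. A union bound covers the
overrides and a net of vectors; intermediate masks are reached by convexity. The tail e^{-p/2} with
p of order m/L cannot pay for a net of the ball of ℝ^m, so the coordinates are cut into N = O(L)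
blocks of size about p/64, at the price of a factor √N. -/

noncomputable section

namespace StreamNet

/-! ## The Euclidean norm of a tuple -/

section Euclid

variable {ι κ : Type*} [Fintype ι] [Fintype κ]

/-- The Euclidean norm of a tuple. -/
def l2 (v : ι → ℝ) : ℝ := √(∑ i, v i ^ 2)

lemma l2_eq_norm (v : ι → ℝ) : l2 v = ‖WithLp.toLp 2 v‖ := by
  simp [l2, EuclideanSpace.norm_eq]

lemma l2_coe {d : ℕ} (z : EuclideanSpace ℝ (Fin d)) : l2 (fun j => z j) = ‖z‖ := by
  simp [l2, EuclideanSpace.norm_eq]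

lemma l2_nonneg (v : ι → ℝ) : 0 ≤ l2 v := Real.sqrt_nonneg _

lemma l2_sq (v : ι → ℝ) : l2 v ^ 2 = ∑ i, v i ^ 2 :=
  Real.sq_sqrt (Finset.sum_nonneg fun _ _ => sq_nonneg _)

lemma l2_sq_dot (v : ι → ℝ) : l2 v ^ 2 = v ⬝ᵥ v := by
  rw [l2_sq]; simp [dotProduct, sq]

@[simp] lemma l2_zero : l2 (0 : ι → ℝ) = 0 := by simp [l2]

lemma l2_add_le (v w : ι → ℝ) : l2 (v + w) ≤ l2 v + l2 w := by
  simp only [l2_eq_norm, WithLp.toLp_add]; exact norm_add_le _ _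

lemma l2_smul (c : ℝ) (v : ι → ℝ) : l2 (c • v) = |c| * l2 v := by
  simp only [l2_eq_norm, WithLp.toLp_smul, norm_smul, Real.norm_eq_abs]

lemma l2_sum_le {α : Type*} (s : Finset α) (f : α → ι → ℝ) :
    l2 (∑ a ∈ s, f a) ≤ ∑ a ∈ s, l2 (f a) := by
  classical
  induction s using Finset.induction_on with
  | empty => simp
  | insert a s ha ih =>
    rw [Finset.sum_insert ha, Finset.sum_insert ha]
    exact (l2_add_le _ _).trans (by linarith)

lemma l2_eq_zero {v : ι → ℝ} (h : l2 v = 0) : v = 0 := by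
  rw [l2_eq_norm, norm_eq_zero] at h
  simpa using h

lemma l2_mono {v w : ι → ℝ} (h : ∀ i, |v i| ≤ |w i|) : l2 v ≤ l2 w :=
  Real.sqrt_le_sqrt (Finset.sum_le_sum fun i _ => sq_le_sq.2 (h i))

lemma abs_apply_le_l2 (v : ι → ℝ) (i : ι) : |v i| ≤ l2 v := by
  rw [l2, ← Real.sqrt_sq_eq_abs]
  exact Real.sqrt_le_sqrt
    (Finset.single_le_sum (f := fun i => v i ^ 2) (fun _ _ => sq_nonneg _) (Finset.mem_univ i))

lemma abs_dotProduct_le (v w : ι → ℝ) : |v ⬝ᵥ w| ≤ l2 v * l2 w := by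
  have h := Finset.sum_mul_sq_le_sq_mul_sq Finset.univ v w
  rw [← l2_sq, ← l2_sq, ← mul_pow] at h
  exact abs_le_of_sq_le_sq h (mul_nonneg (l2_nonneg _) (l2_nonneg _))

lemma l2_le_of_dotProduct_le {v : ι → ℝ} {c : ℝ} (hc : 0 ≤ c) (h : v ⬝ᵥ v ≤ c * l2 v) :
    l2 v ≤ c := by
  rw [← l2_sq_dot] at h
  rcases (l2_nonneg v).eq_or_lt with h0 | h0
  · rw [← h0]; exact hc
  · nlinarith

/-- The Frobenius norm. -/
def frob (A : ι → κ → ℝ) : ℝ := √(∑ i, ∑ j, A i j ^ 2)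

lemma frob_eq_l2 (A : ι → κ → ℝ) : frob A = l2 (fun p : ι × κ => A p.1 p.2) := by
  rw [frob, l2, Fintype.sum_prod_type]

lemma frob_nonneg (A : ι → κ → ℝ) : 0 ≤ frob A := Real.sqrt_nonneg _

lemma frob_add_le (A A' : ι → κ → ℝ) : frob (A + A') ≤ frob A + frob A' := by
  simp only [frob_eq_l2]
  exact l2_add_le (fun p : ι × κ => A p.1 p.2) (fun p => A' p.1 p.2)

lemma frob_smul (c : ℝ) (A : ι → κ → ℝ) : frob (c • A) = |c| * frob A := by
  simp only [frob_eq_l2]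
  exact l2_smul c (fun p : ι × κ => A p.1 p.2)

@[simp] lemma frob_zero : frob (0 : ι → κ → ℝ) = 0 := by simp [frob]

lemma frob_sum_le {α : Type*} (s : Finset α) (f : α → ι → κ → ℝ) :
    frob (∑ a ∈ s, f a) ≤ ∑ a ∈ s, frob (f a) := by
  classical
  induction s using Finset.induction_on with
  | empty => simp
  | insert a s ha ih =>
    rw [Finset.sum_insert ha, Finset.sum_insert ha]
    exact (frob_add_le _ _).trans (by linarith)

lemma frob_rankOne (c : ℝ) (u : ι → ℝ) (v : κ → ℝ) :
    frob (fun i j => c * (u i * v j)) = |c| * (l2 u * l2 v) := by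
  have h : ∑ i, ∑ j, (c * (u i * v j)) ^ 2 = c ^ 2 * ((∑ i, u i ^ 2) * ∑ j, v j ^ 2) := by
    rw [Finset.sum_mul_sum, Finset.mul_sum]
    refine Finset.sum_congr rfl fun i _ => ?_
    rw [Finset.mul_sum]
    exact Finset.sum_congr rfl fun j _ => by ring
  rw [frob, h, Real.sqrt_mul (sq_nonneg _), Real.sqrt_sq_eq_abs,
    Real.sqrt_mul (Finset.sum_nonneg fun _ _ => sq_nonneg _)]
  rfl

lemma l2_mulVec_le (A : ι → κ → ℝ) (v : κ → ℝ) : l2 (Matrix.of A *ᵥ v) ≤ frob A * l2 v := by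
  have h : ∀ i, (Matrix.of A *ᵥ v) i ^ 2 ≤ (∑ j, A i j ^ 2) * ∑ j, v j ^ 2 := fun i =>
    Finset.sum_mul_sq_le_sq_mul_sq Finset.univ (A i) v
  rw [frob, l2, l2, ← Real.sqrt_mul (Finset.sum_nonneg fun _ _ =>
    Finset.sum_nonneg fun _ _ => sq_nonneg _), Finset.sum_mul]
  exact Real.sqrt_le_sqrt (Finset.sum_le_sum fun i _ => h i)

lemma abs_sum_sum_mul_le (A A' : ι → κ → ℝ) : |∑ i, ∑ j, A i j * A' i j| ≤ frob A * frob A' := by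
  simp only [frob_eq_l2]
  have := abs_dotProduct_le (fun p : ι × κ => A p.1 p.2) (fun p : ι × κ => A' p.1 p.2)
  simpa [dotProduct, Fintype.sum_prod_type] using this

lemma l2_mul_le_of_le_one {M v : ι → ℝ} (h0 : ∀ i, 0 ≤ M i) (h1 : ∀ i, M i ≤ 1) :
    l2 (M * v) ≤ l2 v := by
  refine l2_mono fun i => ?_
  rw [Pi.mul_apply, abs_mul, abs_of_nonneg (h0 i)]
  exact mul_le_of_le_one_left (abs_nonneg _) (h1 i)

/-- A coordinate count: at most `‖v‖² / τ²` coordinates are at least `τ` in absolute value. -/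
lemma card_le_of_l2 (v : ι → ℝ) {τ : ℝ} (hτ : 0 ≤ τ) (s : Finset ι) (hs : ∀ i ∈ s, τ ≤ |v i|) :
    s.card * τ ^ 2 ≤ l2 v ^ 2 := by
  rw [l2_sq, ← nsmul_eq_mul]
  refine (Finset.card_nsmul_le_sum s _ _ fun i hi => ?_).trans
    (Finset.sum_le_sum_of_subset_of_nonneg (Finset.subset_univ s) fun _ _ _ => sq_nonneg _)
  rw [← sq_abs (v i)]
  exact pow_le_pow_left₀ hτ (hs i hi) 2

end Euclid

/-! ## Nets of coordinate blocks -/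

section Net

/-- The weights 2^{-|k|} have total mass below 3; they serve to count grid points in
`card_gridTuples_le`. -/
lemma sum_half_pow_natAbs_le (M : ℕ) :
    ∑ k ∈ Finset.Icc (-(M : ℤ)) M, (1 / 2 : ℝ) ^ k.natAbs ≤ 3 := by
  have h : ∑ k ∈ Finset.Icc (-(M : ℤ)) M, (1 / 2 : ℝ) ^ k.natAbs = 3 - 2 * (1 / 2) ^ M := by
    induction M with
    | zero => norm_num
    | succ M ih =>
      have e : Finset.Icc (-((M + 1 : ℕ) : ℤ)) ((M + 1 : ℕ) : ℤ) =
          insert (-((M + 1 : ℕ) : ℤ)) (insert (((M + 1 : ℕ) : ℤ)) (Finset.Icc (-(M : ℤ)) M)) := by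
        ext k; simp only [Finset.mem_Icc, Finset.mem_insert]; push_cast; omega
      rw [e, Finset.sum_insert, Finset.sum_insert, ih]
      · simp only [Int.natAbs_neg, Int.natAbs_natCast, pow_succ]; ring
      · simp only [Finset.mem_Icc]; push_cast; omega
      · simp only [Finset.mem_insert, Finset.mem_Icc]; push_cast; omega
  rw [h]
  have : (0 : ℝ) < (1 / 2) ^ M := by positivity
  linarith

variable {ι : Type*} [Fintype ι] [DecidableEq ι]

/-- Integer tuples supported in `I` with `ℓ¹` norm at most `4 |I|`. -/
def gridTuples (I : Finset ι) : Finset (ι → ℤ) :=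
  (Fintype.piFinset fun i => if i ∈ I then Finset.Icc (-((4 * I.card : ℕ) : ℤ)) ((4 * I.card : ℕ) : ℤ)
    else {0}).filter fun k => ∑ i, (k i).natAbs ≤ 4 * I.card

/-- Give a tuple the weight ∏ 2^{-|kᵢ|}. The ℓ¹ constraint makes each weight at least 2^{-4|I|},
while the sum of all weights factorizes and is at most 3^{|I|}. Hence the count is at most (16 ·
3)^{|I|}. -/
lemma card_gridTuples_le (I : Finset ι) : (gridTuples I).card ≤ 48 ^ I.card := by
  have h1 : ((gridTuples I).card : ℝ) ≤
      2 ^ (4 * I.card) * ∑ k ∈ Fintype.piFinset fun i => if i ∈ I then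
        Finset.Icc (-((4 * I.card : ℕ) : ℤ)) ((4 * I.card : ℕ) : ℤ) else {0},
        ∏ i, (1 / 2 : ℝ) ^ (k i).natAbs := by
    rw [Finset.mul_sum, ← nsmul_one, ← Finset.sum_const]
    refine (Finset.sum_le_sum fun k hk => ?_).trans (Finset.sum_le_sum_of_subset_of_nonneg
      (Finset.filter_subset _ _) fun _ _ _ => by positivity)
    have hk2 : ∑ i, (k i).natAbs ≤ 4 * I.card := (Finset.mem_filter.1 hk).2
    rw [Finset.prod_pow_eq_pow_sum, one_div, inv_pow, ← div_eq_mul_inv, le_div_iff₀ (by positivity),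
      one_mul]
    exact pow_le_pow_right₀ (by norm_num) hk2
  have h2 : ∀ i : ι, ∑ k ∈ (if i ∈ I then Finset.Icc (-((4 * I.card : ℕ) : ℤ)) ((4 * I.card : ℕ) : ℤ)
      else {0}), (1 / 2 : ℝ) ^ k.natAbs ≤ if i ∈ I then 3 else 1 := by
    intro i
    split_ifs
    · exact sum_half_pow_natAbs_le _
    · simp
  have h3 : ((gridTuples I).card : ℝ) ≤ 48 ^ I.card := by
    refine h1.trans ?_
    rw [← Finset.prod_univ_sum (fun i => if i ∈ I then
      Finset.Icc (-((4 * I.card : ℕ) : ℤ)) ((4 * I.card : ℕ) : ℤ) else {0})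
      fun _ k => (1 / 2 : ℝ) ^ k.natAbs]
    refine (mul_le_mul_of_nonneg_left (Finset.prod_le_prod (fun i _ => Finset.sum_nonneg
      fun _ _ => by positivity) fun i _ => h2 i) (by positivity)).trans ?_
    rw [Finset.prod_ite_mem, Finset.univ_inter, Finset.prod_const, pow_mul, ← mul_pow]
    norm_num
  exact_mod_cast h3

/-- The grid net of the unit ball of `ℝ^I`. -/
def blockNet (I : Finset ι) : Finset (ι → ℝ) :=
  (gridTuples I).image fun k i => (k i : ℝ) / (2 * √(I.card : ℝ))

lemma card_blockNet_le (I : Finset ι) : (blockNet I).card ≤ 48 ^ I.card :=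
  Finset.card_image_le.trans (card_gridTuples_le I)

lemma exists_trunc (x : ℝ) : ∃ k : ℤ, |(k : ℝ)| ≤ |x| ∧ |x - k| ≤ 1 := by
  rcases le_total 0 x with h | h
  · refine ⟨⌊x⌋, ?_, ?_⟩
    · rw [abs_of_nonneg h, abs_of_nonneg (by exact_mod_cast Int.floor_nonneg.2 h)]
      exact Int.floor_le x
    · rw [abs_le]; constructor <;> linarith [Int.floor_le x, Int.lt_floor_add_one x]
  · refine ⟨⌈x⌉, ?_, ?_⟩
    · rw [abs_of_nonpos h, abs_of_nonpos (by exact_mod_cast Int.ceil_le.2 (by simpa using h))]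
      linarith [Int.le_ceil x]
    · rw [abs_le]; constructor <;> linarith [Int.le_ceil x, Int.ceil_lt_add_one x]

/-- Scale by s = 2√|I| and truncate each coordinate towards zero. Truncation, unlike rounding to the
nearest integer, cannot increase the norm. Each coordinate moves by at most 1/s, so the total error
is at most √|I|/s = 1/2. The ℓ¹ bound of the grid comes from |k| ≤ k² for integers. -/
lemma exists_mem_blockNet (I : Finset ι) (v : ι → ℝ) (hv : ∀ i ∉ I, v i = 0) (hv1 : l2 v ≤ 1) :
    ∃ u ∈ blockNet I, (∀ i ∉ I, u i = 0) ∧ l2 u ≤ 1 ∧ l2 (v - u) ≤ 1 / 2 := by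
  set s : ℝ := 2 * √(I.card : ℝ) with hs
  choose k hk1 hk2 using fun i => exists_trunc (s * v i)
  have hs0 : 0 ≤ s := by positivity
  have hs2 : s ^ 2 = 4 * I.card := by
    rw [hs, mul_pow, Real.sq_sqrt (Nat.cast_nonneg _)]; norm_num
  have hk0 : ∀ i ∉ I, k i = 0 := by
    intro i hi
    have := hk1 i
    rw [hv i hi, mul_zero, abs_zero] at this
    exact_mod_cast abs_nonpos_iff.1 this
  have hsum : ∑ i, (k i : ℝ) ^ 2 ≤ 4 * I.card := by
    calc ∑ i, (k i : ℝ) ^ 2 ≤ ∑ i, (s * v i) ^ 2 := Finset.sum_le_sum fun i _ => sq_le_sq.2 (hk1 i)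
      _ = s ^ 2 * l2 v ^ 2 := by rw [l2_sq, Finset.mul_sum]; simp [mul_pow]
      _ ≤ s ^ 2 * 1 := by
        gcongr; exact pow_le_one₀ (l2_nonneg v) hv1
      _ = _ := by rw [hs2, mul_one]
  have hnat : ∑ i, (k i).natAbs ≤ 4 * I.card := by
    have : ((∑ i, (k i).natAbs : ℕ) : ℝ) ≤ ((4 * I.card : ℕ) : ℝ) := by
      push_cast
      refine le_trans (Finset.sum_le_sum fun i _ => ?_) hsum
      have h : (k i).natAbs ≤ (k i).natAbs ^ 2 := Nat.le_self_pow two_ne_zero _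
      have h' : (((k i).natAbs : ℕ) : ℝ) ≤ (((k i).natAbs ^ 2 : ℕ) : ℝ) := by exact_mod_cast h
      rw [Nat.cast_pow, Nat.cast_natAbs, Int.cast_abs, sq_abs] at h'
      simpa using h'
    exact_mod_cast this
  refine ⟨fun i => (k i : ℝ) / s, ?_, fun i hi => by simp [hk0 i hi], ?_, ?_⟩
  · refine Finset.mem_image.2 ⟨k, Finset.mem_filter.2 ⟨Fintype.mem_piFinset.2 fun i => ?_, hnat⟩, rfl⟩
    by_cases hi : i ∈ I
    · rw [if_pos hi, Finset.mem_Icc]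
      have h1 : (k i).natAbs ≤ ∑ i, (k i).natAbs :=
        Finset.single_le_sum (f := fun i => (k i).natAbs) (fun _ _ => Nat.zero_le _)
          (Finset.mem_univ i)
      omega
    · rw [if_neg hi, Finset.mem_singleton, hk0 i hi]
  · rcases hs0.eq_or_lt with h0 | h0
    · rw [← h0]; simp [l2]
    · refine (l2_mono fun i => ?_).trans hv1
      rw [abs_div, abs_of_pos h0, div_le_iff₀ h0]
      refine (hk1 i).trans ?_
      rw [abs_mul, abs_of_pos h0, mul_comm]
  · rw [l2, Real.sqrt_le_left (by norm_num)]
    rcases hs0.eq_or_lt with h0 | h0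
    · have hI : I = ∅ := by
        rw [← h0] at hs2
        have : (I.card : ℝ) = 0 := by nlinarith
        exact Finset.card_eq_zero.1 (by exact_mod_cast this)
      have : ∀ i, v i = 0 := fun i => hv i (by simp [hI])
      simp [this, ← h0]
    · have hb : ∀ i, (v - fun i => (k i : ℝ) / s) i ^ 2 ≤ if i ∈ I then 1 / s ^ 2 else 0 := by
        intro i
        by_cases hi : i ∈ I
        · rw [if_pos hi]
          have e : (v - fun i => (k i : ℝ) / s) i = (s * v i - k i) / s := by
            simp only [Pi.sub_apply]; field_simp
          rw [e, div_pow]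
          gcongr
          rw [← sq_abs]
          exact pow_le_one₀ (abs_nonneg _) (hk2 i)
        · simp [hi, hk0 i hi, hv i hi]
      refine (Finset.sum_le_sum fun i _ => hb i).trans ?_
      rw [Finset.sum_ite_mem, Finset.univ_inter, Finset.sum_const, nsmul_eq_mul, hs2]
      have hI : (I.card : ℝ) ≠ 0 := by
        intro h; rw [h] at hs2; nlinarith
      apply le_of_eq
      field_simp
      norm_num

/-- An a priori finite bound to start the iteration in `Seminorm.le_of_blockNet`; its size is
irrelevant. -/
lemma Seminorm.exists_le_l2 (Φ : Seminorm ℝ (ι → ℝ)) : ∃ M, 0 ≤ M ∧ ∀ v, Φ v ≤ M * l2 v := by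
  refine ⟨∑ i, Φ (Pi.single i 1), Finset.sum_nonneg fun _ _ => apply_nonneg _ _, fun v => ?_⟩
  have hv : v = ∑ i, v i • (Pi.single i 1 : ι → ℝ) := by
    funext j; simp [Finset.sum_apply, Pi.single_apply]
  calc Φ v = Φ (∑ i, v i • (Pi.single i 1 : ι → ℝ)) := by rw [← hv]
    _ ≤ ∑ i, Φ (v i • (Pi.single i 1 : ι → ℝ)) := by
      refine Finset.le_sum_of_subadditive Φ (map_zero Φ).le (fun x y => map_add_le_add Φ x y) _ _
    _ ≤ ∑ i, Φ (Pi.single i 1) * l2 v := by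
      refine Finset.sum_le_sum fun i _ => ?_
      rw [map_smul_eq_mul, Real.norm_eq_abs, mul_comm]
      exact mul_le_mul_of_nonneg_left (abs_apply_le_l2 v i) (apply_nonneg _ _)
    _ = _ := by rw [Finset.sum_mul]

/-- A seminorm bounded by `a` on the net of a block is bounded by `2 a` on the unit ball of the
block. -/
lemma Seminorm.le_of_blockNet (Φ : Seminorm ℝ (ι → ℝ)) (I : Finset ι) {a : ℝ}
    (h : ∀ u ∈ blockNet I, l2 u ≤ 1 → Φ u ≤ a) (v : ι → ℝ) (hv : ∀ i ∉ I, v i = 0) :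
    Φ v ≤ 2 * a * l2 v := by
  obtain ⟨M, hM, hΦ⟩ := Seminorm.exists_le_l2 Φ
  -- With a net point u within 1/2 of v, Φ v ≤ a + Φ(2(v - u))/2, and 2(v - u) is again in the unit
  -- ball. Iterating halves the a priori bound each time; 2a is the fixed point of c ↦ a + c/2.
  have key : ∀ n : ℕ, ∀ v : ι → ℝ, (∀ i ∉ I, v i = 0) → l2 v ≤ 1 → Φ v ≤ 2 * a + M * (1 / 2) ^ n := by
    intro n
    induction n with
    | zero =>
      intro v hv hv1
      obtain ⟨u, hu, -, hu1, -⟩ := exists_mem_blockNet I v hv hv1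
      have ha : 0 ≤ a := (apply_nonneg Φ u).trans (h u hu hu1)
      have := hΦ v
      nlinarith
    | succ n ih =>
      intro v hv hv1
      obtain ⟨u, hu, hu0, hu1, hvu⟩ := exists_mem_blockNet I v hv hv1
      have h1 := ih ((2 : ℝ) • (v - u)) (fun i hi => by simp [hv i hi, hu0 i hi])
        (by rw [l2_smul, abs_of_pos two_pos]; linarith)
      rw [map_smul_eq_mul, Real.norm_eq_abs, abs_of_pos two_pos] at h1
      have h2 : Φ v ≤ Φ u + Φ (v - u) := by
        have := map_add_le_add Φ u (v - u)
        rwa [add_sub_cancel] at this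
      have h3 := h u hu hu1
      rw [pow_succ]
      linarith
  have key2 : ∀ v : ι → ℝ, (∀ i ∉ I, v i = 0) → l2 v ≤ 1 → Φ v ≤ 2 * a := by
    intro v hv hv1
    have hlim : Filter.Tendsto (fun n : ℕ => 2 * a + M * (1 / 2 : ℝ) ^ n) Filter.atTop
        (nhds (2 * a + M * 0)) :=
      ((tendsto_pow_atTop_nhds_zero_of_lt_one (by norm_num) (by norm_num)).const_mul M).const_add _
    rw [mul_zero, add_zero] at hlim
    exact ge_of_tendsto' hlim fun n => key n v hv hv1
  rcases (l2_nonneg v).eq_or_lt with h0 | h0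
  · rw [l2_eq_zero h0.symm]; simp
  · have h1 := key2 ((l2 v)⁻¹ • v) (fun i hi => by simp [hv i hi])
      (by rw [l2_smul, abs_of_pos (inv_pos.2 h0), inv_mul_cancel₀ h0.ne'])
    rw [map_smul_eq_mul, Real.norm_eq_abs, abs_of_pos (inv_pos.2 h0), inv_mul_le_iff₀ h0] at h1
    linarith

/-- The `b`-th block of `s` consecutive coordinates. -/
def block (m s b : ℕ) : Finset (Fin m) := Finset.univ.filter fun i => i.val / s = b

lemma card_block_le {m s b : ℕ} (hs : 0 < s) : (block m s b).card ≤ s := by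
  have : ((block m s b).image Fin.val) ⊆ Finset.Ico (s * b) (s * b + s) := by
    intro x hx
    obtain ⟨i, hi, rfl⟩ := Finset.mem_image.1 hx
    have h := (Finset.mem_filter.1 hi).2
    rw [Finset.mem_Ico]
    have h1 := Nat.div_add_mod i.val s
    have h2 := Nat.mod_lt i.val hs
    rw [h] at h1
    omega
  have h := Finset.card_le_card this
  rw [Finset.card_image_of_injective _ Fin.val_injective, Nat.card_Ico] at h
  omega

/-- A seminorm bounded on each of `N` blocks is bounded, with loss `√N`. -/
lemma Seminorm.le_of_blocks {m s N : ℕ} (hN : m ≤ N * s)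
    (Φ : Seminorm ℝ (Fin m → ℝ)) {c : ℝ} (hc : 0 ≤ c)
    (h : ∀ b < N, ∀ v : Fin m → ℝ, (∀ i ∉ block m s b, v i = 0) → Φ v ≤ c * l2 v)
    (v : Fin m → ℝ) : Φ v ≤ c * √(N : ℝ) * l2 v := by
  let r : ℕ → Fin m → ℝ := fun b i => if i.val / s = b then v i else 0
  have hb : ∀ i : Fin m, i.val / s < N := fun i =>
    Nat.div_lt_of_lt_mul (by rw [mul_comm]; exact i.isLt.trans_le hN)
  have hv : v = ∑ b ∈ Finset.range N, r b := by
    funext i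
    rw [Finset.sum_apply, Finset.sum_ite_eq, if_pos (Finset.mem_range.2 (hb i))]
  have hsq : ∑ b ∈ Finset.range N, l2 (r b) ^ 2 = l2 v ^ 2 := by
    simp only [l2_sq]
    rw [Finset.sum_comm]
    refine Finset.sum_congr rfl fun i _ => ?_
    simp only [r, ite_pow, ne_eq, OfNat.ofNat_ne_zero, not_false_eq_true, zero_pow]
    rw [Finset.sum_ite_eq, if_pos (Finset.mem_range.2 (hb i))]
  -- Cauchy-Schwarz over the blocks is the source of the factor √N.
  have hcs : ∑ b ∈ Finset.range N, l2 (r b) ≤ √(N : ℝ) * l2 v := by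
    refine le_of_sq_le_sq ?_ (mul_nonneg (Real.sqrt_nonneg _) (l2_nonneg _)) |>.trans le_rfl
    have := sq_sum_le_card_mul_sum_sq (s := Finset.range N) (f := fun b => l2 (r b))
    rw [hsq, Finset.card_range] at this
    rw [mul_pow, Real.sq_sqrt (Nat.cast_nonneg _)]
    exact this
  calc Φ v = Φ (∑ b ∈ Finset.range N, r b) := by rw [← hv]
    _ ≤ ∑ b ∈ Finset.range N, Φ (r b) :=
      Finset.le_sum_of_subadditive Φ (map_zero Φ).le (fun x y => map_add_le_add Φ x y) _ _
    _ ≤ ∑ b ∈ Finset.range N, c * l2 (r b) := by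
      refine Finset.sum_le_sum fun b hb => h b (Finset.mem_range.1 hb) _ fun i hi => ?_
      exact if_neg fun h => hi (Finset.mem_filter.2 ⟨Finset.mem_univ _, h⟩)
    _ = c * ∑ b ∈ Finset.range N, l2 (r b) := by rw [Finset.mul_sum]
    _ ≤ _ := by rw [mul_assoc]; exact mul_le_mul_of_nonneg_left hcs hc

end Net

/-! ## Masked products of layers -/

section Chain

variable {m : ℕ}

/-- The linear map `v ↦ M ∘ (A v)` of a layer with mask `M`. -/
def maskedLayer (M : Fin m → ℝ) (A : Fin m → Fin m → ℝ) : (Fin m → ℝ) →ₗ[ℝ] (Fin m → ℝ) where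
  toFun v := M * (Matrix.of A *ᵥ v)
  map_add' v w := by rw [Matrix.mulVec_add, mul_add]
  map_smul' c v := by rw [Matrix.mulVec_smul, mul_smul_comm, RingHom.id_apply]

lemma maskedLayer_apply (M : Fin m → ℝ) (A : Fin m → Fin m → ℝ) (v : Fin m → ℝ) :
    maskedLayer M A v = M * (Matrix.of A *ᵥ v) := rfl

/-- The product of the masked layers `j, …, j + r - 1`. -/
def chain (M : ℕ → Fin m → ℝ) (V : ℕ → Fin m → Fin m → ℝ) (j : ℕ) :
    ℕ → (Fin m → ℝ) →ₗ[ℝ] (Fin m → ℝ)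
  | 0 => LinearMap.id
  | r + 1 => maskedLayer (M (j + r)) (V (j + r)) ∘ₗ chain M V j r

variable (M M' : ℕ → Fin m → ℝ) (V V' : ℕ → Fin m → Fin m → ℝ)

@[simp] lemma chain_zero (j : ℕ) (v : Fin m → ℝ) : chain M V j 0 v = v := rfl

lemma chain_succ (j r : ℕ) (v : Fin m → ℝ) :
    chain M V j (r + 1) v = M (j + r) * (Matrix.of (V (j + r)) *ᵥ chain M V j r v) := rfl

lemma chain_succ' (j r : ℕ) (v : Fin m → ℝ) :
    chain M V j (r + 1) v = chain M V (j + 1) r (M j * (Matrix.of (V j) *ᵥ v)) := by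
  induction r with
  | zero => rfl
  | succ r ih =>
    rw [chain_succ, ih, chain_succ]
    simp only [add_comm, add_left_comm]

variable {M M' V V'}

lemma chain_congr {j r : ℕ} (hM : ∀ k, j ≤ k → k < j + r → M k = M' k)
    (hV : ∀ k, j ≤ k → k < j + r → V k = V' k) (v : Fin m → ℝ) :
    chain M V j r v = chain M' V' j r v := by
  induction r with
  | zero => rfl
  | succ r ih =>
    rw [chain_succ, chain_succ, ih (fun k h1 h2 => hM k h1 (by omega))
      (fun k h1 h2 => hV k h1 (by omega)), hM _ (by omega) (by omega), hV _ (by omega) (by omega)]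

/-- Solution formula for an inhomogeneous linear recursion through the masked layers. -/
lemma eq_chain_add_sum {j R : ℕ} {D p : ℕ → Fin m → ℝ}
    (hD : ∀ r < R, D (r + 1) = M (j + r) * (Matrix.of (V (j + r)) *ᵥ D r) + p r) :
    D R = chain M V j R (D 0) + ∑ i ∈ Finset.range R, chain M V (j + i + 1) (R - (i + 1)) (p i) := by
  induction R with
  | zero => simp
  | succ R ih =>
    rw [hD R (Nat.lt_succ_self R), ih fun r hr => hD r (hr.trans (Nat.lt_succ_self R)),
      Matrix.mulVec_add, mul_add, ← chain_succ, Finset.sum_range_succ, Nat.sub_self, chain_zero,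
      ← add_assoc]
    congr 2
    rw [← maskedLayer_apply, map_sum]
    refine Finset.sum_congr rfl fun i hi => ?_
    have hi' := Finset.mem_range.1 hi
    have e : R + 1 - (i + 1) = (R - (i + 1)) + 1 := by omega
    rw [e, chain_succ, maskedLayer_apply]
    have e' : j + i + 1 + (R - (i + 1)) = j + R := by omega
    rw [e']

/-- The mask `M` with the entry `i` of layer `k` set to `b`. -/
def setEntry (M : ℕ → Fin m → ℝ) (k : ℕ) (i : Fin m) (b : ℝ) : ℕ → Fin m → ℝ :=
  Function.update M k (Function.update (M k) i b)

/-- Each mask entry enters through a single layer, so the product is affine in it. -/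
lemma chain_setEntry (k : ℕ) (i : Fin m) (j r : ℕ) (v : Fin m → ℝ) :
    chain M V j r v = (1 - M k i) • chain (setEntry M k i 0) V j r v +
      M k i • chain (setEntry M k i 1) V j r v := by
  induction r with
  | zero => simp only [chain_zero, ← add_smul, sub_add_cancel, one_smul]
  | succ r ih =>
    by_cases hk : j + r = k
    · subst hk
      have hc : ∀ b, chain (setEntry M (j + r) i b) V j r v = chain M V j r v := fun b =>
        chain_congr (fun k _ h2 => by simp [setEntry, Function.update_of_ne (ne_of_lt h2)])
          (fun _ _ _ => rfl) v
      rw [chain_succ, chain_succ, chain_succ, hc, hc]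
      funext i'
      simp only [setEntry, Function.update_self, Pi.mul_apply, Pi.add_apply, Pi.smul_apply,
        smul_eq_mul]
      by_cases hi : i' = i
      · subst hi; simp
      · rw [Function.update_of_ne hi, Function.update_of_ne hi]; ring
    · have hb : ∀ b, setEntry M k i b (j + r) = M (j + r) := fun b =>
        Function.update_of_ne hk _ _
      rw [chain_succ, chain_succ, chain_succ, hb, hb]
      conv_lhs => rw [ih]
      rw [Matrix.mulVec_add, Matrix.mulVec_smul, Matrix.mulVec_smul, mul_add, mul_smul_comm,
        mul_smul_comm]

/-- A seminorm of a masked product is at most its maximum over the masks with entries `0` and `1`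
on a finite set of positions. -/
lemma seminorm_chain_le_of_vertices (Φ : Seminorm ℝ (Fin m → ℝ)) {j r : ℕ} {v : Fin m → ℝ} {c : ℝ}
    (Y : Finset (ℕ × Fin m)) (M : ℕ → Fin m → ℝ) (hM0 : ∀ k i, 0 ≤ M k i) (hM1 : ∀ k i, M k i ≤ 1)
    (h : ∀ M' : ℕ → Fin m → ℝ, (∀ k i, (k, i) ∉ Y → M' k i = M k i) →
      (∀ k i, (k, i) ∈ Y → M' k i = 0 ∨ M' k i = 1) → Φ (chain M' V j r v) ≤ c) :
    Φ (chain M V j r v) ≤ c := by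
  classical
  induction Y using Finset.induction_on generalizing M with
  | empty => exact h M (fun _ _ _ => rfl) (fun _ _ h => absurd h (Finset.notMem_empty _))
  | insert p Y hp ih =>
    obtain ⟨k, i⟩ := p
    have hne : ∀ b k' i', (k', i') ≠ (k, i) → setEntry M k i b k' i' = M k' i' := by
      intro b k' i' hne
      by_cases hk : k' = k
      · subst hk
        have hi : i' ≠ i := fun h => hne (by rw [h])
        simp [setEntry, Function.update_of_ne hi]
      · simp [setEntry, Function.update_of_ne hk]
    have heq : ∀ b, setEntry M k i b k i = b := fun b => by simp [setEntry]
    have key : ∀ b : ℝ, b = 0 ∨ b = 1 → Φ (chain (setEntry M k i b) V j r v) ≤ c := by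
      intro b hb
      refine ih (setEntry M k i b) (fun k' i' => ?_) (fun k' i' => ?_) fun M' h1 h2 => ?_
      · by_cases h : (k', i') = (k, i)
        · obtain ⟨rfl, rfl⟩ := Prod.mk.inj h
          rw [heq]; rcases hb with rfl | rfl <;> norm_num
        · rw [hne b k' i' h]; exact hM0 _ _
      · by_cases h : (k', i') = (k, i)
        · obtain ⟨rfl, rfl⟩ := Prod.mk.inj h
          rw [heq]; rcases hb with rfl | rfl <;> norm_num
        · rw [hne b k' i' h]; exact hM1 _ _
      · refine h M' (fun k' i' hn => ?_) fun k' i' hy => ?_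
        · rw [Finset.mem_insert, not_or] at hn
          rw [h1 k' i' hn.2, hne b k' i' hn.1]
        · rcases Finset.mem_insert.1 hy with hy | hy
          · obtain ⟨rfl, rfl⟩ := Prod.mk.inj hy
            rw [h1 _ _ hp, heq]; exact hb
          · exact h2 k' i' hy
    have h0 := key 0 (Or.inl rfl)
    have h1 := key 1 (Or.inr rfl)
    -- The product is a convex combination of its values with the entry set to 0 and to 1, so the
    -- seminorm is at most the larger of the two.
    rw [chain_setEntry k i]
    refine (map_add_le_add Φ _ _).trans ?_
    rw [map_smul_eq_mul, map_smul_eq_mul, Real.norm_eq_abs, Real.norm_eq_abs,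
      abs_of_nonneg (sub_nonneg.2 (hM1 k i)), abs_of_nonneg (hM0 k i)]
    nlinarith [hM0 k i, hM1 k i]

end Chain

/-! ## Perturbation of the hidden layers -/

section Perturb

variable {m : ℕ}

/-- The activations of the layers `V` on the input `h₀`. -/
def actSeq (V : ℕ → Fin m → Fin m → ℝ) (h₀ : Fin m → ℝ) : ℕ → Fin m → ℝ
  | 0 => h₀
  | k + 1 => relu (Matrix.of (V k) *ᵥ actSeq V h₀ k)

/-- The preactivations. -/
def preact (V : ℕ → Fin m → Fin m → ℝ) (h₀ : Fin m → ℝ) (k : ℕ) : Fin m → ℝ :=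
  Matrix.of (V k) *ᵥ actSeq V h₀ k

/-- The activation patterns. -/
def patt (V : ℕ → Fin m → Fin m → ℝ) (h₀ : Fin m → ℝ) (k : ℕ) (i : Fin m) : ℝ :=
  if 0 < preact V h₀ k i then 1 else 0

lemma actSeq_succ (V : ℕ → Fin m → Fin m → ℝ) (h₀ : Fin m → ℝ) (k : ℕ) :
    actSeq V h₀ (k + 1) = relu (preact V h₀ k) := rfl

lemma relu_eq_mul (v : Fin m → ℝ) : relu v = (fun i => if 0 < v i then (1 : ℝ) else 0) * v := by
  funext i
  simp only [relu, Pi.mul_apply, ite_mul, one_mul, zero_mul]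
  split_ifs with h
  · exact max_eq_left h.le
  · exact max_eq_right (not_lt.1 h)

lemma actSeq_eq_chain (V : ℕ → Fin m → Fin m → ℝ) (h₀ : Fin m → ℝ) (k : ℕ) :
    actSeq V h₀ k = chain (patt V h₀) V 0 k h₀ := by
  induction k with
  | zero => rfl
  | succ k ih =>
    rw [actSeq_succ, relu_eq_mul, chain_succ, zero_add, ← ih]
    rfl

lemma patt_nonneg (V : ℕ → Fin m → Fin m → ℝ) (h₀ : Fin m → ℝ) (k : ℕ) (i : Fin m) :
    0 ≤ patt V h₀ k i := by unfold patt; split_ifs <;> norm_num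

lemma patt_le_one (V : ℕ → Fin m → Fin m → ℝ) (h₀ : Fin m → ℝ) (k : ℕ) (i : Fin m) :
    patt V h₀ k i ≤ 1 := by unfold patt; split_ifs <;> norm_num

/-- Masks with entries in `[0, 1]` that differ from the activation pattern in at most `q` entries of
each of the layers below `H`. -/
structure NearPattern (V : ℕ → Fin m → Fin m → ℝ) (h₀ : Fin m → ℝ) (H q : ℕ)
    (M : ℕ → Fin m → ℝ) : Prop where
  nonneg : ∀ k i, 0 ≤ M k i
  le_one : ∀ k i, M k i ≤ 1
  card_le : ∀ k < H, (Finset.univ.filter fun i => M k i ≠ patt V h₀ k i).card ≤ q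

/-- The regularity of the layers `V` with input `h₀` and output row `w` that makes the network and
its gradient stable under small perturbations of `V`. -/
structure IsRegular (V : ℕ → Fin m → Fin m → ℝ) (h₀ w : Fin m → ℝ) (H q : ℕ) (K β a τ : ℝ) :
    Prop where
  chain_le : ∀ M, NearPattern V h₀ H (2 * q) M → ∀ j r, j + r ≤ H → ∀ v,
    l2 (chain M V j r v) ≤ K * l2 v
  out_le : ∀ M, NearPattern V h₀ H (2 * q) M → ∀ j r, j + r = H → ∀ v,
    |w ⬝ᵥ chain M V j r v| ≤ β * l2 v
  layer_le : ∀ k < H, ∀ v, l2 (Matrix.of (V k) *ᵥ v) ≤ K * l2 v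
  act_le : ∀ k ≤ H, l2 (actSeq V h₀ k) ≤ a
  card_small : ∀ k < H, (Finset.univ.filter fun i => |preact V h₀ k i| < τ).card ≤ q

/-! ### Secant slopes and sign flips -/

/-- The slope of the ReLU between two points. -/
def slope (a a' : ℝ) : ℝ :=
  if a = a' then (if 0 < a then 1 else 0) else (max a' 0 - max a 0) / (a' - a)

lemma slope_mul (a a' : ℝ) : max a' 0 - max a 0 = slope a a' * (a' - a) := by
  unfold slope
  split_ifs with h h'
  · simp [h]
  · simp [h]
  · rw [div_mul_cancel₀ _ (sub_ne_zero.2 (Ne.symm h))]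

lemma slope_nonneg (a a' : ℝ) : 0 ≤ slope a a' := by
  unfold slope
  split_ifs with h h'
  · norm_num
  · exact le_rfl
  · rcases lt_or_gt_of_ne h with h1 | h1
    · exact div_nonneg (sub_nonneg.2 (max_le_max_right 0 h1.le)) (by linarith)
    · exact div_nonneg_of_nonpos (sub_nonpos.2 (max_le_max_right 0 h1.le)) (by linarith)

lemma slope_le_one (a a' : ℝ) : slope a a' ≤ 1 := by
  unfold slope
  split_ifs with h h'
  · exact le_rfl
  · norm_num
  · rcases lt_or_gt_of_ne h with h1 | h1
    · rw [div_le_one (by linarith)]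
      rcases max_cases a 0 with h2 | h2 <;> rcases max_cases a' 0 with h3 | h3 <;> linarith
    · rw [div_le_one_of_neg (by linarith)]
      rcases max_cases a 0 with h2 | h2 <;> rcases max_cases a' 0 with h3 | h3 <;> linarith

lemma abs_le_of_sign_ne {a a' : ℝ} (h : ¬(0 < a ↔ 0 < a')) : |a| ≤ |a' - a| := by
  rcases lt_or_ge 0 a with h1 | h1
  · have h2 : a' ≤ 0 := not_lt.1 fun h2 => h (iff_of_true h1 h2)
    rw [abs_of_pos h1, abs_of_nonpos (by linarith)]; linarith
  · have h2 : 0 < a' := by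
      by_contra h2
      exact h (iff_of_false (not_lt.2 h1) h2)
    rw [abs_of_nonpos h1, abs_of_pos (by linarith)]; linarith

/-- The value 𝟙{a > 0} of the slope at coinciding points is chosen for this: secant masks can
deviate from the activation pattern only at sign flips. -/
lemma slope_eq_of_sign {a a' : ℝ} (h : 0 < a ↔ 0 < a') : slope a a' = if 0 < a then 1 else 0 := by
  unfold slope
  split_ifs with h1 h2 h2
  · rfl
  · rfl
  · rw [max_eq_left h2.le, max_eq_left (h.1 h2).le]
    exact div_self (sub_ne_zero.2 (Ne.symm h1))
  · rw [max_eq_right (not_lt.1 h2), max_eq_right (not_lt.1 fun h3 => h2 (h.2 h3))]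
    simp

/-- The secant masks between two families of layers. -/
def secant (V V' : ℕ → Fin m → Fin m → ℝ) (h₀ : Fin m → ℝ) (k : ℕ) (i : Fin m) : ℝ :=
  slope (preact V h₀ k i) (preact V' h₀ k i)

/-- The positions at which the activation patterns differ. -/
def flips (V V' : ℕ → Fin m → Fin m → ℝ) (h₀ : Fin m → ℝ) (k : ℕ) : Finset (Fin m) :=
  Finset.univ.filter fun i => ¬(0 < preact V h₀ k i ↔ 0 < preact V' h₀ k i)

lemma preact_sub (V V' : ℕ → Fin m → Fin m → ℝ) (h₀ : Fin m → ℝ) (k : ℕ) :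
    preact V' h₀ k - preact V h₀ k = Matrix.of (V k) *ᵥ (actSeq V' h₀ k - actSeq V h₀ k) +
      Matrix.of (V' k - V k) *ᵥ actSeq V' h₀ k := by
  have : (Matrix.of (V' k - V k) : Matrix (Fin m) (Fin m) ℝ) = Matrix.of (V' k) - Matrix.of (V k) :=
    rfl
  rw [preact, preact, this, Matrix.sub_mulVec, Matrix.mulVec_sub]
  abel

/-- Writing the ReLU increment as secant slope times preactivation increment leaves no linearization
error. The operator involves only the unperturbed layers, up to the mask; the perturbation appears
as a source term. -/
lemma actSeq_sub_succ (V V' : ℕ → Fin m → Fin m → ℝ) (h₀ : Fin m → ℝ) (k : ℕ) :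
    actSeq V' h₀ (k + 1) - actSeq V h₀ (k + 1) =
      secant V V' h₀ k * (Matrix.of (V k) *ᵥ (actSeq V' h₀ k - actSeq V h₀ k)) +
        secant V V' h₀ k * (Matrix.of (V' k - V k) *ᵥ actSeq V' h₀ k) := by
  rw [← mul_add, ← preact_sub]
  funext i
  exact slope_mul _ _

variable {V V' : ℕ → Fin m → Fin m → ℝ} {h₀ w : Fin m → ℝ} {H q : ℕ} {K β a τ ω : ℝ}

/-- Inside the induction over layers, flips are controlled only below layer n. Filling in the true
pattern above n gives a mask to which the regularity hypothesis applies. -/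
lemma nearPattern_of_flips {M : ℕ → Fin m → ℝ} {n : ℕ} (h0 : ∀ k i, 0 ≤ M k i)
    (h1 : ∀ k i, M k i ≤ 1)
    (hM : ∀ k i, (0 < preact V h₀ k i ↔ 0 < preact V' h₀ k i) → M k i = patt V h₀ k i)
    (hc : ∀ k < n, (flips V V' h₀ k).card ≤ q) : NearPattern V h₀ H q
      (fun k => if k < n then M k else patt V h₀ k) where
  nonneg k i := by split_ifs; exacts [h0 k i, patt_nonneg _ _ _ _]
  le_one k i := by split_ifs; exacts [h1 k i, patt_le_one _ _ _ _]
  card_le k _ := by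
    split_ifs with hk
    · refine (Finset.card_le_card fun i hi => ?_).trans (hc k hk)
      rw [flips, Finset.mem_filter]
      exact ⟨Finset.mem_univ _, fun h => (Finset.mem_filter.1 hi).2 (hM k i h)⟩
    · simp

/-- Unrolling the recursion for the difference gives at most H source terms of norm ω · 2a, each
propagated by a masked product of norm at most K. -/
lemma IsRegular.sub_le (hr : IsRegular V h₀ w H q K β a τ) (hK : 0 ≤ K) (hω : 0 ≤ ω)
    (ha : 0 ≤ a) (hV : ∀ k < H, frob (V' k - V k) ≤ ω) {n : ℕ} (hn : n ≤ H)
    (hact : ∀ k < n, l2 (actSeq V' h₀ k) ≤ 2 * a)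
    (hflip : ∀ k < n, (flips V V' h₀ k).card ≤ 2 * q) :
    l2 (actSeq V' h₀ n - actSeq V h₀ n) ≤ H * K * ω * (2 * a) := by
  have hnear : NearPattern V h₀ H (2 * q)
      (fun k => if k < n then secant V V' h₀ k else patt V h₀ k) :=
    nearPattern_of_flips (fun _ _ => slope_nonneg _ _) (fun _ _ => slope_le_one _ _)
      (fun k i h => slope_eq_of_sign h) hflip
  have h := eq_chain_add_sum (j := 0) (R := n)
    (M := fun k => if k < n then secant V V' h₀ k else patt V h₀ k) (V := V)
    (D := fun k => actSeq V' h₀ k - actSeq V h₀ k)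
    (p := fun k => secant V V' h₀ k * (Matrix.of (V' k - V k) *ᵥ actSeq V' h₀ k))
    (fun r hr => by
      simp only [zero_add, if_pos hr]
      exact actSeq_sub_succ V V' h₀ r)
  rw [h]
  have e0 : actSeq V' h₀ 0 - actSeq V h₀ 0 = 0 := sub_self h₀
  simp only [e0, map_zero, zero_add]
  refine (l2_sum_le _ _).trans ?_
  have hb : ∀ i ∈ Finset.range n, l2 (chain (fun k => if k < n then secant V V' h₀ k else patt V h₀ k)
      V (i + 1) (n - (i + 1)) (secant V V' h₀ i * (Matrix.of (V' i - V i) *ᵥ actSeq V' h₀ i))) ≤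
      K * (ω * (2 * a)) := by
    intro i hi
    have hi' := Finset.mem_range.1 hi
    refine (hr.chain_le _ hnear _ _ (by omega) _).trans (mul_le_mul_of_nonneg_left ?_ hK)
    refine (l2_mul_le_of_le_one (fun _ => slope_nonneg _ _) fun _ => slope_le_one _ _).trans ?_
    refine (l2_mulVec_le _ _).trans ?_
    exact mul_le_mul (hV i (by omega)) (hact i hi') (l2_nonneg _) hω
  refine (Finset.sum_le_card_nsmul _ _ _ hb).trans ?_
  rw [Finset.card_range, nsmul_eq_mul]
  have : (n : ℝ) ≤ H := by exact_mod_cast hn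
  calc (n : ℝ) * (K * (ω * (2 * a))) ≤ H * (K * (ω * (2 * a))) := by gcongr
    _ = _ := by ring

/-- A flipped coordinate either had a preactivation below τ, which happens at most q times, or moved
by at least τ, which the Euclidean bound on the movement also permits at most q times. This is the
origin of 2q in `IsRegular`. -/
lemma IsRegular.card_flips_le (hr : IsRegular V h₀ w H q K β a τ) (hτ : 0 < τ) {n : ℕ} (hn : n < H)
    (hδ : l2 (preact V' h₀ n - preact V h₀ n) ^ 2 ≤ q * τ ^ 2) :
    (flips V V' h₀ n).card ≤ 2 * q := by
  classical
  have hsub : flips V V' h₀ n ⊆ (Finset.univ.filter fun i => |preact V h₀ n i| < τ) ∪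
      (Finset.univ.filter fun i => τ ≤ |(preact V' h₀ n - preact V h₀ n) i|) := by
    intro i hi
    have h := abs_le_of_sign_ne (Finset.mem_filter.1 hi).2
    rw [Finset.mem_union, Finset.mem_filter, Finset.mem_filter]
    rcases lt_or_ge |preact V h₀ n i| τ with h1 | h1
    · exact Or.inl ⟨Finset.mem_univ _, h1⟩
    · exact Or.inr ⟨Finset.mem_univ _, h1.trans h⟩
  have h1 := card_le_of_l2 (preact V' h₀ n - preact V h₀ n) hτ.le
    (Finset.univ.filter fun i => τ ≤ |(preact V' h₀ n - preact V h₀ n) i|)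
    (fun i hi => (Finset.mem_filter.1 hi).2)
  have h2 : ((Finset.univ.filter fun i => τ ≤ |(preact V' h₀ n - preact V h₀ n) i|).card : ℝ) ≤ q :=
    le_of_mul_le_mul_right (h1.trans hδ) (by positivity)
  have h3 : (Finset.univ.filter fun i => τ ≤ |(preact V' h₀ n - preact V h₀ n) i|).card ≤ q := by
    exact_mod_cast h2
  have h4 := Finset.card_le_card hsub
  have h5 := Finset.card_union_le (Finset.univ.filter fun i => |preact V h₀ n i| < τ)
    (Finset.univ.filter fun i => τ ≤ |(preact V' h₀ n - preact V h₀ n) i|)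
  have h6 := hr.card_small n hn
  omega

/-- A bootstrap in the layer index: few flips in earlier layers bound the activation of layer n,
which in turn bounds the flips of layer n. The condition `h1` makes the change of the activation at
most a; `h2` makes the change of the preactivation at most √q τ. -/
lemma IsRegular.act_flips (hr : IsRegular V h₀ w H q K β a τ) (hK : 0 ≤ K) (hω : 0 ≤ ω)
    (ha : 0 ≤ a) (hτ : 0 < τ) (hV : ∀ k < H, frob (V' k - V k) ≤ ω) (h1 : 2 * H * K * ω ≤ 1)
    (h2 : (K * (H * K * ω * (2 * a)) + ω * (2 * a)) ^ 2 ≤ q * τ ^ 2) (n : ℕ) (hn : n ≤ H) :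
    l2 (actSeq V' h₀ n) ≤ 2 * a ∧ (n < H → (flips V V' h₀ n).card ≤ 2 * q) := by
  induction n using Nat.strong_induction_on with
  | _ n ih =>
    have hsub := hr.sub_le hK hω ha hV hn (fun k hk => (ih k hk (by omega)).1)
      (fun k hk => (ih k hk (by omega)).2 (by omega))
    have hact : l2 (actSeq V' h₀ n) ≤ 2 * a := by
      have e : actSeq V' h₀ n = actSeq V h₀ n + (actSeq V' h₀ n - actSeq V h₀ n) := by abel
      rw [e]
      refine (l2_add_le _ _).trans ?_
      have := hr.act_le n hn
      have h3 : H * K * ω * (2 * a) ≤ a := by nlinarith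
      linarith
    refine ⟨hact, fun hlt => hr.card_flips_le hτ hlt (le_trans ?_ h2)⟩
    refine pow_le_pow_left₀ (l2_nonneg _) ?_ 2
    rw [preact_sub]
    refine (l2_add_le _ _).trans (add_le_add ?_ ?_)
    · exact (hr.layer_le n hlt _).trans (mul_le_mul_of_nonneg_left hsub hK)
    · exact (l2_mulVec_le _ _).trans (mul_le_mul (hV n hlt) hact (l2_nonneg _) hω)

/-- The output moves little when the hidden layers do. -/
lemma IsRegular.abs_out_sub_le (hr : IsRegular V h₀ w H q K β a τ) (hK : 0 ≤ K) (hβ : 0 ≤ β)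
    (hω : 0 ≤ ω)
    (ha : 0 ≤ a) (hτ : 0 < τ) (hV : ∀ k < H, frob (V' k - V k) ≤ ω) (h1 : 2 * H * K * ω ≤ 1)
    (h2 : (K * (H * K * ω * (2 * a)) + ω * (2 * a)) ^ 2 ≤ q * τ ^ 2) :
    |w ⬝ᵥ actSeq V' h₀ H - w ⬝ᵥ actSeq V h₀ H| ≤ H * (β * (ω * (2 * a))) := by
  have hA := hr.act_flips hK hω ha hτ hV h1 h2
  have hnear : NearPattern V h₀ H (2 * q)
      (fun k => if k < H then secant V V' h₀ k else patt V h₀ k) :=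
    nearPattern_of_flips (fun _ _ => slope_nonneg _ _) (fun _ _ => slope_le_one _ _)
      (fun k i h => slope_eq_of_sign h) fun k hk => (hA k hk.le).2 hk
  have h := eq_chain_add_sum (j := 0) (R := H)
    (M := fun k => if k < H then secant V V' h₀ k else patt V h₀ k) (V := V)
    (D := fun k => actSeq V' h₀ k - actSeq V h₀ k)
    (p := fun k => secant V V' h₀ k * (Matrix.of (V' k - V k) *ᵥ actSeq V' h₀ k))
    (fun r hr => by
      simp only [zero_add, if_pos hr]
      exact actSeq_sub_succ V V' h₀ r)
  rw [← dotProduct_sub, h]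
  have e0 : actSeq V' h₀ 0 - actSeq V h₀ 0 = 0 := sub_self h₀
  simp only [e0, map_zero, zero_add]
  rw [dotProduct_sum]
  refine (Finset.abs_sum_le_sum_abs _ _).trans ?_
  have hb : ∀ i ∈ Finset.range H, |w ⬝ᵥ chain (fun k => if k < H then secant V V' h₀ k else
      patt V h₀ k) V (i + 1) (H - (i + 1))
        (secant V V' h₀ i * (Matrix.of (V' i - V i) *ᵥ actSeq V' h₀ i))| ≤ β * (ω * (2 * a)) := by
    intro i hi
    have hi' := Finset.mem_range.1 hi
    refine (hr.out_le _ hnear _ _ (by omega) _).trans (mul_le_mul_of_nonneg_left ?_ hβ)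
    refine (l2_mul_le_of_le_one (fun _ => slope_nonneg _ _) fun _ => slope_le_one _ _).trans ?_
    refine (l2_mulVec_le _ _).trans ?_
    exact mul_le_mul (hV i hi') (hA i hi'.le).1 (l2_nonneg _) hω
  refine (Finset.sum_le_card_nsmul _ _ _ hb).trans ?_
  rw [Finset.card_range, nsmul_eq_mul]

/-- The backward pass stays bounded when the hidden layers move little. -/
lemma IsRegular.abs_out_chain_le (hr : IsRegular V h₀ w H q K β a τ) (hK : 0 ≤ K) (hβ : 0 ≤ β)
    (hω : 0 ≤ ω)
    (ha : 0 ≤ a) (hτ : 0 < τ) (hV : ∀ k < H, frob (V' k - V k) ≤ ω) (h1 : 2 * H * K * ω ≤ 1)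
    (h2 : (K * (H * K * ω * (2 * a)) + ω * (2 * a)) ^ 2 ≤ q * τ ^ 2) {j r : ℕ} (hj : j + r = H)
    (v : Fin m → ℝ) : |w ⬝ᵥ chain (patt V' h₀) V' j r v| ≤ 2 * β * l2 v := by
  have hA := hr.act_flips hK hω ha hτ hV h1 h2
  have hnear : NearPattern V h₀ H (2 * q)
      (fun k => if k < H then patt V' h₀ k else patt V h₀ k) :=
    nearPattern_of_flips (fun _ _ => patt_nonneg _ _ _ _) (fun _ _ => patt_le_one _ _ _ _)
      (fun k i h => by simp only [patt, h]) fun k hk => (hA k hk.le).2 hk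
  set M : ℕ → Fin m → ℝ := fun k => if k < H then patt V' h₀ k else patt V h₀ k with hMdef
  set p : ℕ → Fin m → ℝ := fun i =>
    patt V' h₀ (j + i) * (Matrix.of (V' (j + i) - V (j + i)) *ᵥ chain (patt V' h₀) V' j i v) with hp
  -- Here the masks of the two products agree and only the layers differ, so the perturbed product
  -- is the unperturbed one plus source terms that involve shorter perturbed products.
  have hrec : ∀ R ≤ r, chain (patt V' h₀) V' j R v = chain M V j R v +
      ∑ i ∈ Finset.range R, chain M V (j + i + 1) (R - (i + 1)) (p i) := by
    intro R hR
    refine eq_chain_add_sum (D := fun R => chain (patt V' h₀) V' j R v) fun s hs => ?_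
    have e : (Matrix.of (V' (j + s) - V (j + s)) : Matrix (Fin m) (Fin m) ℝ) =
        Matrix.of (V' (j + s)) - Matrix.of (V (j + s)) := rfl
    have hM : M (j + s) = patt V' h₀ (j + s) := if_pos (by omega)
    rw [hp, hM]
    simp only [chain_succ]
    rw [← mul_add, e, Matrix.sub_mulVec, add_sub_cancel]
  have hpb : ∀ i < r, l2 (p i) ≤ ω * l2 (chain (patt V' h₀) V' j i v) := by
    intro i hi
    refine (l2_mul_le_of_le_one (fun _ => patt_nonneg _ _ _ _) fun _ => patt_le_one _ _ _ _).trans ?_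
    refine (l2_mulVec_le _ _).trans ?_
    exact mul_le_mul_of_nonneg_right (hV _ (by omega)) (l2_nonneg _)
  -- Under the bound 2K‖v‖ for shorter products, the source terms add at most 2HKω · K‖v‖ ≤ K‖v‖, so
  -- the factor 2 reproduces itself.
  have hchain : ∀ R ≤ r, l2 (chain (patt V' h₀) V' j R v) ≤ 2 * K * l2 v := by
    intro R
    induction R using Nat.strong_induction_on with
    | _ R ih =>
      intro hR
      rw [hrec R hR]
      refine (l2_add_le _ _).trans ?_
      have hb : ∀ i ∈ Finset.range R, l2 (chain M V (j + i + 1) (R - (i + 1)) (p i)) ≤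
          K * (ω * (2 * K * l2 v)) := by
        intro i hi
        have hi' := Finset.mem_range.1 hi
        refine (hr.chain_le _ hnear _ _ (by omega) _).trans (mul_le_mul_of_nonneg_left ?_ hK)
        exact (hpb i (by omega)).trans (mul_le_mul_of_nonneg_left (ih i hi' (by omega)) hω)
      have h3 := (l2_sum_le _ _).trans (Finset.sum_le_card_nsmul _ _ _ hb)
      rw [Finset.card_range, nsmul_eq_mul] at h3
      have h4 := hr.chain_le _ hnear j R (by omega) v
      have h5 : (R : ℝ) ≤ H := by exact_mod_cast (by omega : R ≤ H)
      have h6 : (R : ℝ) * (K * (ω * (2 * K * l2 v))) ≤ H * (K * (ω * (2 * K * l2 v))) := by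
        have := l2_nonneg v
        gcongr
      have h7 : H * (K * (ω * (2 * K * l2 v))) = 2 * H * K * ω * (K * l2 v) := by ring
      have h8 : 2 * H * K * ω * (K * l2 v) ≤ 1 * (K * l2 v) :=
        mul_le_mul_of_nonneg_right h1 (mul_nonneg hK (l2_nonneg v))
      linarith
  rw [hrec r le_rfl, dotProduct_add, dotProduct_sum]
  refine (abs_add_le _ _).trans ?_
  have hb : ∀ i ∈ Finset.range r, |w ⬝ᵥ chain M V (j + i + 1) (r - (i + 1)) (p i)| ≤
      β * (ω * (2 * K * l2 v)) := by
    intro i hi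
    have hi' := Finset.mem_range.1 hi
    refine (hr.out_le _ hnear _ _ (by omega) _).trans (mul_le_mul_of_nonneg_left ?_ hβ)
    exact (hpb i hi').trans (mul_le_mul_of_nonneg_left (hchain i hi'.le) hω)
  have h3 := (Finset.abs_sum_le_sum_abs _ _).trans (Finset.sum_le_card_nsmul _ _ _ hb)
  rw [Finset.card_range, nsmul_eq_mul] at h3
  have h4 := hr.out_le _ hnear j r hj v
  have h5 : (r : ℝ) ≤ H := by exact_mod_cast (by omega : r ≤ H)
  have h6 : (r : ℝ) * (β * (ω * (2 * K * l2 v))) ≤ H * (β * (ω * (2 * K * l2 v))) := by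
    have := l2_nonneg v
    gcongr
  have h7 : H * (β * (ω * (2 * K * l2 v))) = 2 * H * K * ω * (β * l2 v) := by ring
  have h8 : 2 * H * K * ω * (β * l2 v) ≤ 1 * (β * l2 v) :=
    mul_le_mul_of_nonneg_right h1 (mul_nonneg hβ (l2_nonneg v))
  linarith

end Perturb

/-! ## The network in terms of masked products -/

section Network

variable {d m H : ℕ}

/-- The hidden layers as a sequence indexed by `ℕ`. -/
def layers (w : Fin H → Fin m → Fin m → ℝ) (k : ℕ) : Fin m → Fin m → ℝ :=
  if h : k < H then w ⟨k, h⟩ else 0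

lemma layers_val (w : Fin H → Fin m → Fin m → ℝ) (k : Fin H) : layers w k = w k := by
  simp [layers]

/-- The first activation. -/
def firstAct (w : Fin m → Fin d → ℝ) (z : EuclideanSpace ℝ (Fin d)) : Fin m → ℝ :=
  relu (Matrix.of w *ᵥ fun j => z j)

lemma act_eq_actSeq (W : Weights d m H) (z : EuclideanSpace ℝ (Fin d)) (k : Fin (H + 1)) :
    act W z k = actSeq (layers W.2.1) (firstAct W.1 z) k := by
  induction k using Fin.induction with
  | zero => rfl
  | succ k ih =>
    rw [act, Fin.induction_succ, Fin.val_succ, actSeq, layers_val]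
    rw [act, Fin.val_castSucc] at ih
    rw [ih]
    rfl

lemma mask_act_succ (W : Weights d m H) (z : EuclideanSpace ℝ (Fin d)) (k : Fin H) (v : Fin m → ℝ) :
    mask (act W z k.succ) v = patt (layers W.2.1) (firstAct W.1 z) k * v := by
  funext i
  rw [act_eq_actSeq, Fin.val_succ, actSeq_succ]
  simp [mask, patt, relu]

lemma mask_dotProduct_comm (h u v : Fin m → ℝ) : mask h u ⬝ᵥ v = u ⬝ᵥ mask h v := by
  simp only [dotProduct, mask]
  refine Finset.sum_congr rfl fun i _ => ?_
  split_ifs <;> simp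

lemma mask_mask (h u : Fin m → ℝ) : mask h (mask h u) = mask h u := by
  funext i; simp only [mask]; split_ifs <;> rfl

lemma back_last (W : Weights d m H) (z : EuclideanSpace ℝ (Fin d)) :
    back W z (Fin.last H) = mask (act W z (Fin.last H)) W.last := by
  rw [back, Fin.reverseInduction_last]

lemma back_castSucc (W : Weights d m H) (z : EuclideanSpace ℝ (Fin d)) (k : Fin H) :
    back W z k.castSucc = mask (act W z k.castSucc) ((W.hidden k)ᵀ *ᵥ back W z k.succ) := by
  rw [back, Fin.reverseInduction_castSucc]; rfl

lemma mask_back (W : Weights d m H) (z : EuclideanSpace ℝ (Fin d)) (k : Fin (H + 1)) :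
    mask (act W z k) (back W z k) = back W z k := by
  refine Fin.lastCases ?_ (fun k => ?_) k
  · rw [back_last, mask_mask]
  · rw [back_castSucc, mask_mask]

/-- Backpropagation is the transpose of forward propagation through the masked layers. Thus bounds
on masked products tested against the output row become bounds on gradients. -/
lemma back_dotProduct (W : Weights d m H) (z : EuclideanSpace ℝ (Fin d)) (k : Fin (H + 1))
    (v : Fin m → ℝ) : back W z k ⬝ᵥ v = W.last ⬝ᵥ
      chain (patt (layers W.2.1) (firstAct W.1 z)) (layers W.2.1) k (H - k) (mask (act W z k) v) := by
  induction k using Fin.reverseInduction generalizing v with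
  | last => rw [back_last, mask_dotProduct_comm]; simp
  | cast k ih =>
    have e : H - (k.castSucc : ℕ) = (H - ((k : ℕ) + 1)) + 1 := by
      have := k.isLt
      simp only [Fin.val_castSucc]; omega
    rw [back_castSucc, mask_dotProduct_comm, Matrix.mulVec_transpose, ← Matrix.dotProduct_mulVec, ih,
      mask_act_succ, e, chain_succ', Fin.val_castSucc, layers_val, Fin.val_succ]
    rfl

lemma net_eq (W : Weights d m H) (z : EuclideanSpace ℝ (Fin d)) :
    net W z = √(m : ℝ) * (W.last ⬝ᵥ actSeq (layers W.2.1) (firstAct W.1 z) H) := by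
  rw [net, act_eq_actSeq]; rfl

/-- The backward vector is fixed by its own mask, so testing it against itself bounds its squared
norm by c times its norm. -/
lemma l2_back_le (W : Weights d m H) (z : EuclideanSpace ℝ (Fin d)) {c : ℝ} (hc : 0 ≤ c)
    (h : ∀ j r, j + r = H → ∀ v, |W.last ⬝ᵥ chain (patt (layers W.2.1) (firstAct W.1 z))
      (layers W.2.1) j r v| ≤ c * l2 v) (k : Fin (H + 1)) : l2 (back W z k) ≤ c := by
  refine l2_le_of_dotProduct_le hc ?_
  rw [back_dotProduct, mask_back]
  exact (le_abs_self _).trans (h _ _ (by have := k.isLt; omega) _)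

/-- A perturbation may cancel an example. At the zero input the scale τ of small preactivations
degenerates, but all activations vanish whatever the weights, so this input is treated separately.
-/
lemma firstAct_zero (w : Fin m → Fin d → ℝ) : firstAct w 0 = 0 := by
  funext i; simp [firstAct, relu, Matrix.mulVec, dotProduct]

lemma actSeq_zero (V : ℕ → Fin m → Fin m → ℝ) (k : ℕ) : actSeq V 0 k = 0 := by
  induction k with
  | zero => rfl
  | succ k ih => rw [actSeq, ih]; funext i; simp [relu]

end Network

/-! ## Gaussian rows -/

section Gaussian

lemma measure_le_of_lintegral_le {α : Type*} [MeasurableSpace α] {μ : Measure α} {f : α → ℝ}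
    (hf : Measurable f) {A c : ℝ} (hc : 0 < c) (h : ∫⁻ x, ENNReal.ofReal (f x) ∂μ ≤ ENNReal.ofReal A)
    {s : Set α} (hs : ∀ x ∈ s, c ≤ f x) : μ s ≤ ENNReal.ofReal (A / c) := by
  have h1 := mul_meas_ge_le_lintegral (μ := μ) hf.ennreal_ofReal (ENNReal.ofReal c)
  have h2 : μ s ≤ μ {x | ENNReal.ofReal c ≤ ENNReal.ofReal (f x)} :=
    measure_mono fun x hx => ENNReal.ofReal_le_ofReal (hs x hx)
  have hc' : ENNReal.ofReal c ≠ 0 := by simpa using hc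
  rw [ENNReal.ofReal_div_of_pos hc, ENNReal.le_div_iff_mul_le (Or.inl hc')
    (Or.inl ENNReal.ofReal_ne_top), mul_comm]
  exact (mul_le_mul_right h2 _).trans (h1.trans h)

lemma lintegral_exp_sq_gaussianReal (s : ℝ≥0) {τ : ℝ} (h : 2 * τ * s < 1) :
    ∫⁻ x, ENNReal.ofReal (Real.exp (τ * x ^ 2)) ∂(gaussianReal 0 s) =
      ENNReal.ofReal ((√(1 - 2 * τ * s))⁻¹) := by
  rcases eq_or_ne s 0 with rfl | hs
  · simp [gaussianReal_zero_var]
  have hs' : (0 : ℝ) < s := by positivity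
  set b : ℝ := (1 - 2 * τ * s) / (2 * s) with hb
  have hb0 : 0 < b := div_pos (by linarith) (by positivity)
  have hf : ∀ x : ℝ, gaussianPDF 0 s x * ENNReal.ofReal (Real.exp (τ * x ^ 2)) =
      ENNReal.ofReal ((√(2 * Real.pi * s))⁻¹ * Real.exp (-b * x ^ 2)) := by
    intro x
    rw [gaussianPDF, ← ENNReal.ofReal_mul (gaussianPDFReal_nonneg _ _ _), gaussianPDFReal, mul_assoc,
      ← Real.exp_add]
    congr 3
    rw [hb]; field_simp; ring
  rw [gaussianReal_of_var_ne_zero _ hs, lintegral_withDensity_eq_lintegral_mul _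
    (measurable_gaussianPDF _ _) (by fun_prop)]
  simp only [Pi.mul_apply, hf]
  rw [← ofReal_integral_eq_lintegral_ofReal ((integrable_exp_neg_mul_sq hb0).const_mul _)
    (Filter.Eventually.of_forall fun x => by positivity), integral_const_mul, integral_gaussian]
  congr 1
  rw [← Real.sqrt_inv, ← Real.sqrt_mul (by positivity), ← Real.sqrt_inv]
  congr 1
  rw [hb]
  have : (1 - 2 * τ * s) ≠ 0 := by linarith
  field_simp

lemma gaussianReal_abs_lt_le (s : ℝ≥0) (hs : s ≠ 0) (x : ℝ) :
    gaussianReal 0 s {y | |y| < x} ≤ ENNReal.ofReal (2 * x / √(2 * Real.pi * s)) := by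
  have hb : ∀ y, gaussianPDF 0 s y ≤ ENNReal.ofReal ((√(2 * Real.pi * s))⁻¹) := by
    intro y
    rw [gaussianPDF, gaussianPDFReal]
    refine ENNReal.ofReal_le_ofReal (mul_le_of_le_one_right (by positivity) ?_)
    rw [Real.exp_le_one_iff, neg_div]
    exact neg_nonpos.2 (by positivity)
  have e : {y : ℝ | |y| < x} = Set.Ioo (-x) x := by ext y; simp [abs_lt]
  rw [gaussianReal_apply _ hs, e]
  refine (lintegral_mono hb).trans ?_
  rw [lintegral_const, Measure.restrict_apply MeasurableSet.univ, Set.univ_inter, Real.volume_Ioo,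
    ← ENNReal.ofReal_mul (by positivity)]
  refine ENNReal.ofReal_le_ofReal (le_of_eq ?_)
  rw [div_eq_mul_inv]; ring

/-- Characteristic functions: the exponential of the dot product factorizes over the independent
coordinates, and the variances v uᵢ² add up. -/
lemma sum_sq_dotProduct_gaussian {κ : Type*} [Fintype κ] (v : ℝ≥0) (u : κ → ℝ) :
    (Measure.pi fun _ : κ => gaussianReal 0 v).map (fun w => w ⬝ᵥ u) =
      gaussianReal 0 (v * (l2 u ^ 2).toNNReal) := by
  have hm : Measurable fun w : κ → ℝ => w ⬝ᵥ u := by unfold dotProduct; fun_prop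
  have := Measure.isProbabilityMeasure_map (μ := Measure.pi fun _ : κ => gaussianReal 0 v)
    hm.aemeasurable
  refine Measure.ext_of_charFun (funext fun t => ?_)
  rw [charFun_apply, integral_map hm.aemeasurable (Measurable.aestronglyMeasurable (by fun_prop)),
    charFun_gaussianReal]
  have e : ∀ w : κ → ℝ, Complex.exp (((inner ℝ (w ⬝ᵥ u) t : ℝ) : ℂ) * Complex.I) =
      ∏ i, Complex.exp (((inner ℝ (w i) (u i * t) : ℝ) : ℂ) * Complex.I) := by
    intro w
    rw [← Complex.exp_sum, ← Finset.sum_mul]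
    congr 2
    rw [← Complex.ofReal_sum]
    congr 1
    simp only [dotProduct, RCLike.inner_apply, conj_trivial, Finset.mul_sum]
    exact Finset.sum_congr rfl fun i _ => by ring
  simp_rw [e]
  rw [integral_fintype_prod_eq_prod
    (f := fun i x => Complex.exp (((inner ℝ x (u i * t) : ℝ) : ℂ) * Complex.I))]
  simp_rw [← charFun_apply, charFun_gaussianReal]
  rw [← Complex.exp_sum]
  congr 1
  simp only [Complex.ofReal_zero, mul_zero, zero_mul, zero_sub, Finset.sum_neg_distrib]
  congr 1
  rw [NNReal.coe_mul, Real.coe_toNNReal _ (sq_nonneg _), l2_sq]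
  push_cast
  rw [Finset.mul_sum, Finset.sum_mul, Finset.sum_div]
  exact Finset.sum_congr rfl fun i _ => by ring

variable {κ : Type*} [Fintype κ]

lemma measurable_dotProduct_left (u : κ → ℝ) : Measurable fun w : κ → ℝ => w ⬝ᵥ u := by
  unfold dotProduct; fun_prop

lemma lintegral_exp_sq_dotProduct (v : ℝ≥0) (u : κ → ℝ) {τ y : ℝ}
    (hy : 2 * τ * (v * l2 u ^ 2) = y) (h : y < 1) :
    ∫⁻ w, ENNReal.ofReal (Real.exp (τ * (w ⬝ᵥ u) ^ 2)) ∂(Measure.pi fun _ : κ => gaussianReal 0 v) =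
      ENNReal.ofReal ((√(1 - y))⁻¹) := by
  have h1 : ((v * (l2 u ^ 2).toNNReal : ℝ≥0) : ℝ) = v * l2 u ^ 2 := by
    rw [NNReal.coe_mul, Real.coe_toNNReal _ (sq_nonneg _)]
  rw [← hy, ← h1, ← lintegral_exp_sq_gaussianReal _ (by rw [h1, hy]; exact h),
    ← sum_sq_dotProduct_gaussian v u,
    lintegral_map (by fun_prop) (measurable_dotProduct_left u)]

lemma measurePreserving_neg_gaussian (v : ℝ≥0) : MeasurePreserving (fun w : κ → ℝ => -w)
    (Measure.pi fun _ : κ => gaussianReal 0 v) (Measure.pi fun _ : κ => gaussianReal 0 v) :=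
  measurePreserving_pi _ _ (f := fun _ x => -x) fun _ =>
    ⟨measurable_neg, by have := gaussianReal_map_neg (μ := 0) (v := v); rwa [neg_zero] at this⟩

/-- Symmetrization under `w ↦ -w`. -/
lemma lintegral_symm (v : ℝ≥0) {f g : (κ → ℝ) → ℝ≥0∞} (hf : Measurable f)
    (hfg : ∀ w, f w + f (-w) ≤ 1 + g w) :
    2 * ∫⁻ w, f w ∂(Measure.pi fun _ : κ => gaussianReal 0 v) ≤
      1 + ∫⁻ w, g w ∂(Measure.pi fun _ : κ => gaussianReal 0 v) := by
  have h1 : ∫⁻ w, f (-w) ∂(Measure.pi fun _ : κ => gaussianReal 0 v) =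
      ∫⁻ w, f w ∂(Measure.pi fun _ : κ => gaussianReal 0 v) :=
    (measurePreserving_neg_gaussian v).lintegral_comp hf
  rw [two_mul]
  nth_rw 2 [← h1]
  rw [← lintegral_add_left hf]
  refine (lintegral_mono hfg).trans ?_
  rw [lintegral_add_left measurable_const]
  simp

lemma measurable_gate (h : κ → ℝ) : Measurable fun w : κ → ℝ => if 0 < w ⬝ᵥ h then (1 : ℝ) else 0 :=
  Measurable.ite (measurableSet_lt measurable_const (measurable_dotProduct_left h)) measurable_const
    measurable_const

lemma ofReal_le_of_two_mul_le {a : ℝ≥0∞} {b c : ℝ} (h : 2 * a ≤ 1 + ENNReal.ofReal b) (hb : 0 ≤ b)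
    (hc : (1 + b) / 2 ≤ c) : a ≤ ENNReal.ofReal c := by
  have h1 : (1 : ℝ≥0∞) + ENNReal.ofReal b = 2 * ENNReal.ofReal ((1 + b) / 2) := by
    rw [← ENNReal.ofReal_one, ← ENNReal.ofReal_add zero_le_one hb,
      show (2 : ℝ≥0∞) = ENNReal.ofReal 2 by simp, ← ENNReal.ofReal_mul two_pos.le]
    congr 1; ring
  rw [h1] at h
  exact ((ENNReal.mul_le_mul_iff_right two_ne_zero ENNReal.ofNat_ne_top).1 h).trans
    (ENNReal.ofReal_le_ofReal hc)

/-- The linear coefficient 1/2 is exact. It makes a gated layer norm-preserving to first order, so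
that only the quadratic term accumulates over the depth. -/
lemma inv_sqrt_one_sub_le {y : ℝ} (h0 : 0 ≤ y) (h1 : y ≤ 1 / 2) :
    (√(1 - y))⁻¹ ≤ 1 + y / 2 + y ^ 2 := by
  have hp : 0 < √(1 - y) := Real.sqrt_pos.2 (by linarith)
  rw [inv_le_iff_one_le_mul₀ hp, ← abs_of_pos (by positivity : 0 < 1 + y / 2 + y ^ 2),
    ← Real.sqrt_sq_eq_abs, ← Real.sqrt_mul (sq_nonneg _), Real.one_le_sqrt]
  have e : (1 + y / 2 + y ^ 2) ^ 2 * (1 - y) = 1 + y ^ 2 * (5 / 4 - 5 / 4 * y - y ^ 3) := by ring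
  rw [e]
  have : y ^ 3 ≤ 1 / 8 := by
    calc y ^ 3 ≤ (1 / 2) ^ 3 := pow_le_pow_left₀ h0 h1 3
      _ = _ := by norm_num
  nlinarith [sq_nonneg y, mul_nonneg (sq_nonneg y) (by linarith : 0 ≤ 5 / 4 - 5 / 4 * y - y ^ 3)]

lemma inv_sqrt_one_add_le {y : ℝ} (h0 : 0 ≤ y) : (√(1 + y))⁻¹ ≤ 1 - y / 2 + 3 * y ^ 2 / 8 := by
  have hp : 0 < √(1 + y) := Real.sqrt_pos.2 (by linarith)
  have hq : 0 < 1 - y / 2 + 3 * y ^ 2 / 8 := by nlinarith [sq_nonneg (y - 2 / 3)]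
  rw [inv_le_iff_one_le_mul₀ hp, ← abs_of_pos hq,
    ← Real.sqrt_sq_eq_abs, ← Real.sqrt_mul (sq_nonneg _), Real.one_le_sqrt]
  have e : (1 - y / 2 + 3 * y ^ 2 / 8) ^ 2 * (1 + y) =
      1 + y ^ 3 * (5 / 8 - 15 / 64 * y + 9 / 64 * y ^ 2) := by ring
  rw [e]
  have h1 : 0 ≤ 5 / 8 - 15 / 64 * y + 9 / 64 * y ^ 2 := by nlinarith [sq_nonneg (y - 1)]
  have := mul_nonneg (pow_nonneg h0 3) h1
  linarith

/-- Moment generating function of a gated squared Gaussian. -/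
lemma lintegral_exp_gated_le (v : ℝ≥0) (h u : κ → ℝ) {τ y : ℝ} (hτ : 0 ≤ τ)
    (hy : 2 * τ * (v * l2 u ^ 2) = y) (hy1 : y ≤ 1 / 2) :
    ∫⁻ w, ENNReal.ofReal (Real.exp (τ * ((if 0 < w ⬝ᵥ h then (1 : ℝ) else 0) * (w ⬝ᵥ u)) ^ 2))
      ∂(Measure.pi fun _ : κ => gaussianReal 0 v) ≤ ENNReal.ofReal (Real.exp (y / 4 + y ^ 2 / 2)) := by
  have hy0 : 0 ≤ y := by rw [← hy]; positivity
  have hgm := measurable_gate h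
  have hum := measurable_dotProduct_left u
  -- At most one of the gates at w and -w is open, so the two exponentials sum to at most 1 plus the
  -- ungated one. This halves the first-order exponent from y/2 to y/4, whatever the relation
  -- between h and u.
  have h1 := lintegral_symm (κ := κ) v
    (f := fun w => ENNReal.ofReal (Real.exp (τ * ((if 0 < w ⬝ᵥ h then (1 : ℝ) else 0) * (w ⬝ᵥ u)) ^ 2)))
    (g := fun w => ENNReal.ofReal (Real.exp (τ * (w ⬝ᵥ u) ^ 2))) (by fun_prop) (fun w => ?_)
  · rw [lintegral_exp_sq_dotProduct v u hy (by linarith)] at h1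
    refine ofReal_le_of_two_mul_le h1 (by positivity) ?_
    have := inv_sqrt_one_sub_le hy0 hy1
    have := Real.add_one_le_exp (y / 4 + y ^ 2 / 2)
    linarith
  · rw [← ENNReal.ofReal_one, ← ENNReal.ofReal_add (by positivity) (by positivity),
      ← ENNReal.ofReal_add (by positivity) (by positivity)]
    refine ENNReal.ofReal_le_ofReal ?_
    have h3 : 1 ≤ Real.exp (τ * (w ⬝ᵥ u) ^ 2) := Real.one_le_exp (by positivity)
    simp only [neg_dotProduct, Left.neg_pos_iff]
    have h4 : 0 ≤ τ * (w ⬝ᵥ u) ^ 2 := by positivity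
    split_ifs with ha hb <;> simp <;> linarith

/-- For rows whose mask is forced to 1: without the gate, the exponent bound doubles. -/
lemma lintegral_exp_full_le (v : ℝ≥0) (u : κ → ℝ) {τ y : ℝ} (hτ : 0 ≤ τ)
    (hy : 2 * τ * (v * l2 u ^ 2) = y) (hy1 : y ≤ 1 / 2) :
    ∫⁻ w, ENNReal.ofReal (Real.exp (τ * (w ⬝ᵥ u) ^ 2))
      ∂(Measure.pi fun _ : κ => gaussianReal 0 v) ≤
        ENNReal.ofReal (Real.exp (2 * (y / 4 + y ^ 2 / 2))) := by
  have hy0 : 0 ≤ y := by rw [← hy]; positivity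
  rw [lintegral_exp_sq_dotProduct v u hy (by linarith)]
  refine ENNReal.ofReal_le_ofReal ?_
  have := inv_sqrt_one_sub_le hy0 hy1
  have := Real.add_one_le_exp (2 * (y / 4 + y ^ 2 / 2))
  linarith

/-- Laplace transform of a squared ReLU of a Gaussian. -/
lemma lintegral_exp_neg_relu_le (v : ℝ≥0) (u : κ → ℝ) {τ y : ℝ} (hτ : 0 ≤ τ)
    (hy : 2 * τ * (v * l2 u ^ 2) = y) :
    ∫⁻ w, ENNReal.ofReal (Real.exp (-τ * (max (w ⬝ᵥ u) 0) ^ 2))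
      ∂(Measure.pi fun _ : κ => gaussianReal 0 v) ≤
        ENNReal.ofReal (Real.exp (-(y / 4) + 3 * y ^ 2 / 16)) := by
  have hy0 : 0 ≤ y := by rw [← hy]; positivity
  have hum := measurable_dotProduct_left u
  have h1 := lintegral_symm (κ := κ) v
    (f := fun w => ENNReal.ofReal (Real.exp (-τ * (max (w ⬝ᵥ u) 0) ^ 2)))
    (g := fun w => ENNReal.ofReal (Real.exp (-τ * (w ⬝ᵥ u) ^ 2))) (by fun_prop) (fun w => ?_)
  · rw [lintegral_exp_sq_dotProduct v u (τ := -τ) (y := -y) (by rw [← hy]; ring) (by linarith),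
      sub_neg_eq_add] at h1
    refine ofReal_le_of_two_mul_le h1 (by positivity) ?_
    have := inv_sqrt_one_add_le hy0
    have := Real.add_one_le_exp (-(y / 4) + 3 * y ^ 2 / 16)
    linarith
  · rw [← ENNReal.ofReal_one, ← ENNReal.ofReal_add (by positivity) (by positivity),
      ← ENNReal.ofReal_add (by positivity) (by positivity)]
    refine ENNReal.ofReal_le_ofReal ?_
    rw [neg_dotProduct]
    rcases le_total 0 (w ⬝ᵥ u) with ha | ha
    · rw [max_eq_left ha, max_eq_right (by linarith)]; simp [add_comm]
    · rw [max_eq_right ha, max_eq_left (by linarith)]; simp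

end Gaussian

/-! ## One random layer -/

section OneLayer

variable {κ : Type*} [Fintype κ] {m : ℕ}

lemma lintegral_pi_prod {E : Type*} [MeasurableSpace E] (ν : Measure E) [IsProbabilityMeasure ν]
    (f : Fin m → E → ℝ≥0∞) (hf : ∀ i, Measurable (f i)) :
    ∫⁻ w, ∏ i, f i (w i) ∂(Measure.pi fun _ : Fin m => ν) = ∏ i, ∫⁻ x, f i x ∂ν := by
  have h := lintegral_prod_eq_prod_lintegral_of_indepFun (μ := Measure.pi fun _ : Fin m => ν)
    Finset.univ (fun i w => f i (w i))
    (iIndepFun_pi fun i => (hf i).aemeasurable) fun i => (hf i).comp (measurable_pi_apply i)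
  refine h.trans ?_
  refine Finset.prod_congr rfl fun i _ => ?_
  exact (measurePreserving_eval (fun _ : Fin m => ν) i).lintegral_comp (hf i)

/-- The law of a layer with `m` rows. -/
abbrev layerLaw (m : ℕ) (κ : Type*) [Fintype κ] : Measure (Fin m → κ → ℝ) :=
  Measure.pi fun _ => Measure.pi fun _ => gaussianReal 0 (2 / (m : ℝ≥0))

/-- The activation pattern of the layer `w` on the input `h`, overridden by the indicator of `S` on
the set `G`. -/
def gate (G S : Finset (Fin m)) (w : Fin m → κ → ℝ) (h : κ → ℝ) (i : Fin m) : ℝ :=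
  if i ∈ G then (if i ∈ S then 1 else 0) else if 0 < (Matrix.of w *ᵥ h) i then 1 else 0

/-- One entry of `gate`, as a function of the row. -/
def gateRow (G S : Finset (Fin m)) (h : κ → ℝ) (i : Fin m) (x : κ → ℝ) : ℝ :=
  if i ∈ G then (if i ∈ S then 1 else 0) else if 0 < x ⬝ᵥ h then 1 else 0

lemma measurable_gateRow (G S : Finset (Fin m)) (h : κ → ℝ) (i : Fin m) :
    Measurable (gateRow G S h i) := by
  unfold gateRow
  split_ifs
  · exact measurable_const
  · exact measurable_const
  · exact measurable_gate h

lemma two_div_coe (m : ℕ) : ((2 / (m : ℝ≥0) : ℝ≥0) : ℝ) = 2 / m := by push_cast; rfl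

/-- Moments of a masked random layer. -/
lemma lintegral_gate_pow_le (G S : Finset (Fin m)) (h u : κ → ℝ) (p : ℕ) (hm : 0 < m)
    (hp : 8 * p ≤ m) :
    ∫⁻ w, ENNReal.ofReal (l2 (gate G S w h * (Matrix.of w *ᵥ u)) ^ (2 * p)) ∂(layerLaw m κ) ≤
      ENNReal.ofReal (Real.exp (16 * p ^ 2 / m + p * G.card / m) * l2 u ^ (2 * p)) := by
  rcases (l2_nonneg u).eq_or_lt with h0 | h0
  · have hu := l2_eq_zero h0.symm
    subst hu
    simp only [Matrix.mulVec_zero, mul_zero, l2_zero]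
    rw [lintegral_const, measure_univ, mul_one]
    refine ENNReal.ofReal_le_ofReal (le_mul_of_one_le_left (by positivity) (Real.one_le_exp ?_))
    positivity
  have hm' : (0 : ℝ) < m := by exact_mod_cast hm
  set N := l2 u ^ 2 with hN
  have hN0 : 0 < N := by positivity
  set τ : ℝ := p / N with hτ
  have hτ0 : 0 ≤ τ := by positivity
  set y : ℝ := 4 * p / m with hy
  have hyτ : 2 * τ * (((2 / (m : ℝ≥0) : ℝ≥0) : ℝ) * l2 u ^ 2) = y := by
    rw [two_div_coe, hτ, ← hN, hy]; field_simp; ring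
  have hp' : 8 * (p : ℝ) ≤ m := by exact_mod_cast hp
  have hy1 : y ≤ 1 / 2 := by rw [hy, div_le_iff₀ hm']; linarith
  set θ : ℝ := y / 4 + y ^ 2 / 2 with hθ
  have hθ0 : 0 ≤ θ := by positivity
  have hrow : ∀ i : Fin m, ∫⁻ x, ENNReal.ofReal (Real.exp (τ * (gateRow G S h i x * (x ⬝ᵥ u)) ^ 2))
      ∂(Measure.pi fun _ : κ => gaussianReal 0 (2 / (m : ℝ≥0))) ≤
      ENNReal.ofReal (Real.exp (if i ∈ G then 2 * θ else θ)) := by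
    intro i
    unfold gateRow
    split_ifs with hG hS
    · simp only [one_mul]
      exact lintegral_exp_full_le _ u hτ0 hyτ hy1
    · simp only [zero_mul, ne_eq, OfNat.ofNat_ne_zero, not_false_eq_true, zero_pow, mul_zero,
        Real.exp_zero]
      rw [lintegral_const, measure_univ, mul_one]
      exact ENNReal.ofReal_le_ofReal (Real.one_le_exp (by positivity))
    · exact lintegral_exp_gated_le _ h u hτ0 hyτ hy1
  -- From x ≤ e^{x-1} at x = X/N, raised to the power p. This is why τ = p/N: the 2p-th moment
  -- reduces to an exponential moment that factorizes over the rows.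
  have hpt : ∀ w : Fin m → κ → ℝ, ENNReal.ofReal (l2 (gate G S w h * (Matrix.of w *ᵥ u)) ^ (2 * p)) ≤
      ENNReal.ofReal (N ^ p * Real.exp (-p)) *
        ∏ i, ENNReal.ofReal (Real.exp (τ * (gateRow G S h i (w i) * (w i ⬝ᵥ u)) ^ 2)) := by
    intro w
    rw [← ENNReal.ofReal_prod_of_nonneg fun _ _ => by positivity, ← Real.exp_sum,
      ← ENNReal.ofReal_mul (by positivity), ← Finset.mul_sum]
    refine ENNReal.ofReal_le_ofReal ?_
    have e : ∑ i, (gateRow G S h i (w i) * (w i ⬝ᵥ u)) ^ 2 =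
        l2 (gate G S w h * (Matrix.of w *ᵥ u)) ^ 2 := by rw [l2_sq]; rfl
    rw [e, pow_mul]
    set X := l2 (gate G S w h * (Matrix.of w *ᵥ u)) ^ 2
    have hX : X / N ≤ Real.exp (X / N - 1) := by
      have := Real.add_one_le_exp (X / N - 1); linarith
    calc X ^ p = N ^ p * (X / N) ^ p := by rw [div_pow, mul_div_cancel₀ _ (by positivity)]
      _ ≤ N ^ p * Real.exp (X / N - 1) ^ p := by
        gcongr
      _ = N ^ p * Real.exp (-p) * Real.exp (τ * X) := by
        rw [← Real.exp_nat_mul, mul_assoc, ← Real.exp_add]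
        congr 2
        rw [hτ]; field_simp; ring
  refine (lintegral_mono hpt).trans ?_
  have hmeas : ∀ i : Fin m, Measurable fun x : κ → ℝ =>
      ENNReal.ofReal (Real.exp (τ * (gateRow G S h i x * (x ⬝ᵥ u)) ^ 2)) := by
    intro i
    have h1 := measurable_gateRow G S h i
    have h2 := measurable_dotProduct_left u
    fun_prop
  have hprodm : Measurable fun w : Fin m → κ → ℝ =>
      ∏ i, ENNReal.ofReal (Real.exp (τ * (gateRow G S h i (w i) * (w i ⬝ᵥ u)) ^ 2)) :=
    Finset.measurable_prod _ fun i _ => (hmeas i).comp (measurable_pi_apply i)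
  rw [lintegral_const_mul _ hprodm, lintegral_pi_prod _ (fun i x => ENNReal.ofReal
      (Real.exp (τ * (gateRow G S h i x * (x ⬝ᵥ u)) ^ 2))) hmeas]
  refine (mul_le_mul_right (Finset.prod_le_prod' fun i _ => hrow i) _).trans ?_
  rw [← ENNReal.ofReal_prod_of_nonneg fun _ _ => by positivity, ← Real.exp_sum,
    ← ENNReal.ofReal_mul (by positivity)]
  refine ENNReal.ofReal_le_ofReal ?_
  -- The total exponent is mθ + |G|θ. Its leading term p cancels the prefactor e^{-p}; what remains
  -- is of second order in p, plus the cost p|G|/m of the overridden rows.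
  have hsum : ∑ i : Fin m, (if i ∈ G then 2 * θ else θ) = m * θ + G.card * θ := by
    have : ∀ i : Fin m, (if i ∈ G then 2 * θ else θ) = θ + if i ∈ G then θ else 0 := by
      intro i; split_ifs <;> ring
    simp_rw [this]
    rw [Finset.sum_add_distrib, Finset.sum_ite_mem, Finset.univ_inter]
    simp
  rw [hsum, mul_assoc, ← Real.exp_add, pow_mul, mul_comm]
  refine mul_le_mul_of_nonneg_right (Real.exp_le_exp.2 ?_) (by positivity)
  have hG : (G.card : ℝ) ≤ m := by
    exact_mod_cast (Finset.card_le_univ G).trans_eq (Fintype.card_fin m)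
  have e1 : θ = p / m + 8 * (p : ℝ) ^ 2 / m ^ 2 := by
    rw [hθ, hy]; field_simp; ring
  have e2 : (m : ℝ) * θ = p + 8 * (p : ℝ) ^ 2 / m := by rw [e1]; field_simp
  have e3 : (G.card : ℝ) * θ ≤ p * G.card / m + 8 * (p : ℝ) ^ 2 / m := by
    rw [e1, mul_add]
    have : (G.card : ℝ) * (8 * (p : ℝ) ^ 2 / m ^ 2) ≤ m * (8 * (p : ℝ) ^ 2 / m ^ 2) := by gcongr
    have e4 : (m : ℝ) * (8 * (p : ℝ) ^ 2 / m ^ 2) = 8 * (p : ℝ) ^ 2 / m := by field_simp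
    have e5 : (G.card : ℝ) * (p / m) = p * G.card / m := by ring
    linarith
  have e6 : (16 : ℝ) * p ^ 2 / m = 8 * (p : ℝ) ^ 2 / m + 8 * (p : ℝ) ^ 2 / m := by ring
  linarith

lemma gate_empty_mul (w : Fin m → κ → ℝ) (h : κ → ℝ) :
    gate ∅ ∅ w h * (Matrix.of w *ᵥ h) = relu (Matrix.of w *ᵥ h) := by
  rw [relu_eq_mul]; funext i; simp [gate]

lemma gate_univ_mul (w : Fin m → κ → ℝ) (h u : κ → ℝ) :
    gate Finset.univ Finset.univ w h * (Matrix.of w *ᵥ u) = Matrix.of w *ᵥ u := by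
  funext i; simp [gate]

lemma measurable_mulVec (u : κ → ℝ) :
    Measurable fun w : Fin m → κ → ℝ => (Matrix.of w *ᵥ u : Fin m → ℝ) := by
  refine measurable_pi_lambda _ fun i => ?_
  simp only [Matrix.mulVec, dotProduct, Matrix.of_apply]
  fun_prop

/-- A random layer does not shrink its input much. -/
lemma measure_l2_relu_le (h : κ → ℝ) (hh : 0 < l2 h) (hm : 0 < m) {ε : ℝ} (hε : 0 ≤ ε) :
    layerLaw m κ {w | l2 (relu (Matrix.of w *ᵥ h)) ^ 2 ≤ (1 - ε) * l2 h ^ 2} ≤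
      ENNReal.ofReal (Real.exp (-(ε ^ 2 * m / 12))) := by
  have hm' : (0 : ℝ) < m := by exact_mod_cast hm
  set N := l2 h ^ 2 with hN
  have hN0 : 0 < N := by positivity
  -- This p minimizes the final exponent -εp + 3p²/m, with value -ε²m/12.
  set p : ℝ := ε * m / 6 with hp
  set τ : ℝ := p / N with hτ
  have hτ0 : 0 ≤ τ := by positivity
  set y : ℝ := 4 * p / m with hy
  have hyτ : 2 * τ * (((2 / (m : ℝ≥0) : ℝ≥0) : ℝ) * l2 h ^ 2) = y := by
    rw [two_div_coe, hτ, ← hN, hy]; field_simp; ring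
  have hmeas : ∀ i : Fin m, Measurable fun x : κ → ℝ =>
      ENNReal.ofReal (Real.exp (-τ * (max (x ⬝ᵥ h) 0) ^ 2)) := by
    intro i
    have h2 := measurable_dotProduct_left h
    fun_prop
  have hI : ∫⁻ w, ENNReal.ofReal (Real.exp (-τ * l2 (relu (Matrix.of w *ᵥ h)) ^ 2)) ∂(layerLaw m κ) ≤
      ENNReal.ofReal (Real.exp (-p + 3 * p ^ 2 / m)) := by
    have e : ∀ w : Fin m → κ → ℝ, ENNReal.ofReal (Real.exp (-τ * l2 (relu (Matrix.of w *ᵥ h)) ^ 2)) =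
        ∏ i, ENNReal.ofReal (Real.exp (-τ * (max (w i ⬝ᵥ h) 0) ^ 2)) := by
      intro w
      rw [← ENNReal.ofReal_prod_of_nonneg fun _ _ => by positivity, ← Real.exp_sum,
        ← Finset.mul_sum, l2_sq]
      rfl
    simp_rw [e]
    rw [lintegral_pi_prod _ (fun _ x => ENNReal.ofReal (Real.exp (-τ * (max (x ⬝ᵥ h) 0) ^ 2))) hmeas]
    refine (Finset.prod_le_prod' fun i _ => lintegral_exp_neg_relu_le _ h hτ0 hyτ).trans ?_
    rw [← ENNReal.ofReal_prod_of_nonneg fun _ _ => by positivity, ← Real.exp_sum]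
    refine ENNReal.ofReal_le_ofReal (Real.exp_le_exp.2 (le_of_eq ?_))
    rw [Finset.sum_const, Finset.card_univ, Fintype.card_fin, nsmul_eq_mul, hy]
    field_simp
    ring
  refine (measure_le_of_lintegral_le (c := Real.exp (-(p * (1 - ε)))) ?_ (Real.exp_pos _) hI
    fun w hw => ?_).trans ?_
  · have : Measurable fun w : Fin m → κ → ℝ => l2 (relu (Matrix.of w *ᵥ h)) := by
      have h1 := measurable_mulVec (m := m) h
      unfold l2 relu
      fun_prop
    fun_prop
  · refine Real.exp_le_exp.2 ?_
    have hw' : l2 (relu (Matrix.of w *ᵥ h)) ^ 2 ≤ (1 - ε) * N := hw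
    have := mul_le_mul_of_nonneg_left hw' hτ0
    have e : τ * ((1 - ε) * N) = p * (1 - ε) := by rw [hτ]; field_simp
    linarith
  · rw [← Real.exp_sub]
    refine ENNReal.ofReal_le_ofReal (Real.exp_le_exp.2 (le_of_eq ?_))
    rw [hp]; field_simp; ring

/-- Few preactivations of a random layer are small. -/
lemma measure_card_small_le (h : κ → ℝ) (hh : 0 < l2 h) (hm : 0 < m) (q : ℕ) {t τ : ℝ} (ht : 0 ≤ t)
    (hτ : τ ≤ t * l2 h / √(m : ℝ)) :
    layerLaw m κ {w | q < (Finset.univ.filter fun i => |(Matrix.of w *ᵥ h) i| < τ).card} ≤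
      ENNReal.ofReal (Real.exp (7 * t * m - 2 * q)) := by
  have hm' : (0 : ℝ) < m := by exact_mod_cast hm
  have hset : MeasurableSet {x : κ → ℝ | |x ⬝ᵥ h| < τ} :=
    measurableSet_lt ((measurable_dotProduct_left h).abs) measurable_const
  have hprob : (Measure.pi fun _ : κ => gaussianReal 0 (2 / (m : ℝ≥0))) {x | |x ⬝ᵥ h| < τ} ≤
      ENNReal.ofReal t := by
    have h1 : (Measure.pi fun _ : κ => gaussianReal 0 (2 / (m : ℝ≥0))) {x | |x ⬝ᵥ h| < τ} =
        gaussianReal 0 (2 / (m : ℝ≥0) * (l2 h ^ 2).toNNReal) {y | |y| < τ} := by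
      rw [← sum_sq_dotProduct_gaussian, Measure.map_apply (measurable_dotProduct_left h)
        (measurableSet_lt continuous_abs.measurable measurable_const)]
      rfl
    rw [h1]
    refine (gaussianReal_abs_lt_le _ ?_ τ).trans (ENNReal.ofReal_le_ofReal ?_)
    · refine mul_ne_zero (div_ne_zero two_ne_zero (by exact_mod_cast hm.ne')) ?_
      rw [Ne, Real.toNNReal_eq_zero, not_le]; positivity
    · rw [NNReal.coe_mul, Real.coe_toNNReal _ (sq_nonneg _), two_div_coe]
      have e : 2 * Real.pi * (2 / m * l2 h ^ 2) = Real.pi * (2 * l2 h / √(m : ℝ)) ^ 2 := by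
        rw [div_pow, Real.sq_sqrt hm'.le]; ring
      have h2 : 0 < 2 * l2 h / √(m : ℝ) := by positivity
      have h3 : 2 * l2 h / √(m : ℝ) ≤ √(2 * Real.pi * (2 / m * l2 h ^ 2)) := by
        rw [e]
        refine Real.le_sqrt_of_sq_le (le_mul_of_one_le_left (sq_nonneg _) ?_)
        linarith [Real.pi_gt_three]
      rw [div_le_iff₀ (h2.trans_le h3)]
      refine le_trans ?_ (mul_le_mul_of_nonneg_left h3 ht)
      calc 2 * τ ≤ 2 * (t * l2 h / √(m : ℝ)) := by linarith
        _ = _ := by ring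
  -- A Chernoff bound with weight e² for each small coordinate: since e² ≤ 8, a row has mean at most
  -- 1 + 7t ≤ e^{7t}, while more than q small coordinates give weight at least e^{2q}.
  set f : (κ → ℝ) → ℝ := fun x => if |x ⬝ᵥ h| < τ then Real.exp 2 else 1 with hf
  have hfm : Measurable f := Measurable.ite hset measurable_const measurable_const
  have hrow : ∫⁻ x, ENNReal.ofReal (f x) ∂(Measure.pi fun _ : κ => gaussianReal 0 (2 / (m : ℝ≥0))) ≤
      ENNReal.ofReal (Real.exp (7 * t)) := by
    have hle : ∀ x, ENNReal.ofReal (f x) ≤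
        1 + {x : κ → ℝ | |x ⬝ᵥ h| < τ}.indicator (fun _ => ENNReal.ofReal 7) x := by
      intro x
      simp only [hf, Set.indicator_apply, Set.mem_ofPred_eq]
      split_ifs
      · rw [← ENNReal.ofReal_one, ← ENNReal.ofReal_add zero_le_one (by norm_num)]
        refine ENNReal.ofReal_le_ofReal ?_
        have h1 := Real.exp_one_lt_d9
        have h2 : Real.exp 2 = Real.exp 1 * Real.exp 1 := by rw [← Real.exp_add]; norm_num
        rw [h2]
        nlinarith [Real.exp_pos 1]
      · simp
    refine (lintegral_mono hle).trans ?_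
    rw [lintegral_add_left measurable_const, lintegral_const, measure_univ, mul_one,
      lintegral_indicator_const hset]
    refine (add_le_add le_rfl (mul_le_mul_right hprob _)).trans ?_
    rw [← ENNReal.ofReal_mul (by norm_num), ← ENNReal.ofReal_one,
      ← ENNReal.ofReal_add zero_le_one (by positivity)]
    refine ENNReal.ofReal_le_ofReal ?_
    have := Real.add_one_le_exp (7 * t)
    linarith
  have hI : ∫⁻ w : Fin m → κ → ℝ, ENNReal.ofReal (∏ i, f (w i)) ∂(layerLaw m κ) ≤
      ENNReal.ofReal (Real.exp (7 * t * m)) := by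
    have hf0 : ∀ x, 0 ≤ f x := fun x => by simp only [hf]; split_ifs <;> positivity
    simp_rw [ENNReal.ofReal_prod_of_nonneg fun i (_ : i ∈ Finset.univ) => hf0 _]
    rw [lintegral_pi_prod _ (fun _ x => ENNReal.ofReal (f x)) fun _ => hfm.ennreal_ofReal]
    refine (Finset.prod_le_prod' fun i _ => hrow).trans ?_
    rw [Finset.prod_const, Finset.card_univ, Fintype.card_fin, ← ENNReal.ofReal_pow (by positivity),
      ← Real.exp_nat_mul]
    exact ENNReal.ofReal_le_ofReal (Real.exp_le_exp.2 (le_of_eq (by ring)))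
  refine (measure_le_of_lintegral_le (c := Real.exp (2 * q)) ?_ (Real.exp_pos _) hI
    fun w hw => ?_).trans ?_
  · exact Finset.measurable_prod _ fun i _ => hfm.comp (measurable_pi_apply i)
  · have e : ∏ i, f (w i) =
        Real.exp 2 ^ (Finset.univ.filter fun i => |(Matrix.of w *ᵥ h) i| < τ).card := by
      simp only [hf]
      rw [Finset.prod_ite, Finset.prod_const, Finset.prod_const_one, mul_one]
      rfl
    rw [e, ← Real.exp_nat_mul, mul_comm]
    have : (q : ℝ) ≤ (Finset.univ.filter fun i => |(Matrix.of w *ᵥ h) i| < τ).card := by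
      exact_mod_cast (le_of_lt hw)
    exact Real.exp_le_exp.2 (by linarith)
  · rw [← Real.exp_sub]

/-- Gaussian tail of the output row. -/
lemma measure_out_le (v : Fin m → ℝ) (hm : 0 < m) (p : ℝ) {r : ℝ} (hr : 4 * p ≤ r ^ 2 * m)
    (hr0 : 0 ≤ r) :
    (Measure.pi fun _ : Fin m => gaussianReal 0 (1 / (m : ℝ≥0))) {w | r * l2 v < |w ⬝ᵥ v|} ≤
      ENNReal.ofReal (2 * Real.exp (-p)) := by
  have hm' : (0 : ℝ) < m := by exact_mod_cast hm
  rcases (l2_nonneg v).eq_or_lt with h0 | h0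
  · have hv := l2_eq_zero h0.symm
    subst hv
    simp
  set τ : ℝ := m / (4 * l2 v ^ 2) with hτ
  have hy : 2 * τ * (((1 / (m : ℝ≥0) : ℝ≥0) : ℝ) * l2 v ^ 2) = 1 / 2 := by
    have : ((1 / (m : ℝ≥0) : ℝ≥0) : ℝ) = 1 / m := by push_cast; rfl
    rw [this, hτ]; field_simp; norm_num
  have hI := (lintegral_exp_sq_dotProduct (1 / (m : ℝ≥0)) v hy (by norm_num)).le
  have hum := measurable_dotProduct_left v
  refine (measure_le_of_lintegral_le (c := Real.exp p) (by fun_prop) (Real.exp_pos _) hI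
    fun w hw => ?_).trans ?_
  · refine Real.exp_le_exp.2 ?_
    have hw' : r * l2 v < |w ⬝ᵥ v| := hw
    have h1 : (r * l2 v) ^ 2 ≤ (w ⬝ᵥ v) ^ 2 := by
      rw [← sq_abs (w ⬝ᵥ v)]
      exact pow_le_pow_left₀ (by positivity) hw'.le 2
    have h2 := mul_le_mul_of_nonneg_left h1 (by positivity : 0 ≤ τ)
    have e : τ * (r * l2 v) ^ 2 = r ^ 2 * m / 4 := by rw [hτ]; field_simp
    linarith
  · refine ENNReal.ofReal_le_ofReal ?_
    rw [Real.exp_neg, ← div_eq_mul_inv]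
    refine div_le_div_of_nonneg_right ?_ (Real.exp_pos _).le
    have := inv_sqrt_one_sub_le (y := 1 / 2) (by norm_num) (by norm_num)
    linarith

end OneLayer

/-! ## Overridden activation patterns -/

section Override

variable {m : ℕ}

/-- The activation patterns of `V`, overridden by the indicators of the sets `S k` on the sets
`G k`. -/
def overridden (G S : ℕ → Finset (Fin m)) (V : ℕ → Fin m → Fin m → ℝ) (h₀ : Fin m → ℝ) (k : ℕ) :
    Fin m → ℝ := gate (G k) (S k) (V k) (actSeq V h₀ k)

/-- Extension of a finite family of sets by the empty set. -/
def extendFamily {H : ℕ} (G : Fin H → Finset (Fin m)) (k : ℕ) : Finset (Fin m) :=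
  if h : k < H then G ⟨k, h⟩ else ∅

lemma card_extendFamily_le {H q : ℕ} {G : Fin H → Finset (Fin m)} (hG : ∀ k, (G k).card ≤ q)
    (k : ℕ) : (extendFamily G k).card ≤ q := by
  unfold extendFamily
  split_ifs
  · exact hG _
  · simp

lemma overridden_empty (V : ℕ → Fin m → Fin m → ℝ) (h₀ : Fin m → ℝ) :
    overridden (fun _ => ∅) (fun _ => ∅) V h₀ = patt V h₀ := by
  funext k i
  simp only [overridden, gate, Finset.notMem_empty, if_false]
  rfl

/-- The Euclidean norm as a seminorm on tuples. -/
def l2Seminorm (ι : Type*) [Fintype ι] : Seminorm ℝ (ι → ℝ) :=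
  Seminorm.of l2 l2_add_le fun c v => by rw [l2_smul, Real.norm_eq_abs]

/-- The seminorm `v ↦ |⟨w, v⟩|`. -/
def dotSeminorm {ι : Type*} [Fintype ι] (w : ι → ℝ) : Seminorm ℝ (ι → ℝ) :=
  Seminorm.of (fun v => |w ⬝ᵥ v|) (fun u v => by rw [dotProduct_add]; exact abs_add_le _ _)
    fun c v => by rw [dotProduct_smul, smul_eq_mul, abs_mul, Real.norm_eq_abs]

/-- The grid nets of all the blocks. -/
def allNets (m s N : ℕ) : Finset (Fin m → ℝ) :=
  ((Finset.range N).biUnion fun b => blockNet (block m s b)).filter fun u => l2 u ≤ 1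

lemma card_allNets_le {m s N : ℕ} (hs : 0 < s) : (allNets m s N).card ≤ N * 48 ^ s := by
  refine (Finset.card_filter_le _ _).trans (Finset.card_biUnion_le.trans ?_)
  refine (Finset.sum_le_card_nsmul _ _ (48 ^ s) fun b _ => ?_).trans_eq (by simp)
  exact (card_blockNet_le _).trans (Nat.pow_le_pow_right (by norm_num) (card_block_le hs))

/-- A single net of the unit ball would be exponential in m; nets of the separate blocks have only N
· 48^s points in total and cost the factor √N. -/
lemma seminorm_le_of_allNets {s N : ℕ} (hN : m ≤ N * s) (Φ : Seminorm ℝ (Fin m → ℝ)) {c : ℝ}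
    (hc : 0 ≤ c) (h : ∀ u ∈ allNets m s N, Φ u ≤ c) (v : Fin m → ℝ) :
    Φ v ≤ 2 * c * √(N : ℝ) * l2 v := by
  refine Seminorm.le_of_blocks hN Φ (by positivity) (fun b hb v hv => ?_) v
  refine Seminorm.le_of_blockNet Φ _ (fun u hu hu1 => h u ?_) v hv
  exact Finset.mem_filter.2 ⟨Finset.mem_biUnion.2 ⟨b, Finset.mem_range.2 hb, hu⟩, hu1⟩

/-- Bounds on the nets for all overridden patterns give bounds on the unit ball for all masks near the
activation pattern. -/
lemma seminorm_chain_le_of_allNets {V : ℕ → Fin m → Fin m → ℝ} {h₀ : Fin m → ℝ} {s N H q : ℕ}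
    (hN : m ≤ N * s) (Φ : Seminorm ℝ (Fin m → ℝ)) {c : ℝ} (hc : 0 ≤ c) {j r : ℕ} (hj : j + r ≤ H)
    (h : ∀ G S : Fin H → Finset (Fin m), (∀ k, (G k).card ≤ q) → (∀ k, (S k).card ≤ q) →
      ∀ u ∈ allNets m s N,
        Φ (chain (overridden (extendFamily G) (extendFamily S) V h₀) V j r u) ≤ c)
    {M : ℕ → Fin m → ℝ} (hM : NearPattern V h₀ H q M) (v : Fin m → ℝ) :
    Φ (chain M V j r v) ≤ 2 * c * √(N : ℝ) * l2 v := by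
  classical
  refine seminorm_chain_le_of_vertices Φ
    ((Finset.range H ×ˢ Finset.univ).filter fun p => M p.1 p.2 ≠ patt V h₀ p.1 p.2) M hM.nonneg
    hM.le_one fun M' h1 h2 => ?_
  have hmem : ∀ k < H, ∀ i, (k, i) ∈ ((Finset.range H ×ˢ Finset.univ).filter fun p : ℕ × Fin m =>
      M p.1 p.2 ≠ patt V h₀ p.1 p.2) ↔ M k i ≠ patt V h₀ k i := by
    intro k hk i
    simp [hk]
  -- G k is where M leaves the pattern in layer k, and S k is the part of G k where the vertex M'
  -- equals 1. The vertex is then the pattern overridden by S k on G k, so although the pattern is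
  -- random, finitely many overrides suffice.
  set G : Fin H → Finset (Fin m) := fun k => Finset.univ.filter fun i => M k i ≠ patt V h₀ k i
  set S : Fin H → Finset (Fin m) := fun k => (G k).filter fun i => M' k i = 1
  have hG : ∀ k, (G k).card ≤ q := fun k => hM.card_le k k.isLt
  have hS : ∀ k, (S k).card ≤ q := fun k => (Finset.card_filter_le _ _).trans (hG k)
  have hM' : ∀ k, j ≤ k → k < j + r →
      M' k = overridden (extendFamily G) (extendFamily S) V h₀ k := by
    intro k _ hk
    have hk' : k < H := by omega
    funext i
    simp only [overridden, gate, extendFamily, dif_pos hk']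
    by_cases hi : M k i ≠ patt V h₀ k i
    · have hiG : i ∈ G ⟨k, hk'⟩ := Finset.mem_filter.2 ⟨Finset.mem_univ _, hi⟩
      rw [if_pos hiG]
      rcases h2 k i ((hmem k hk' i).2 hi) with h3 | h3
      · rw [h3, if_neg]
        intro h4
        have := (Finset.mem_filter.1 h4).2
        simp only [h3] at this
        exact zero_ne_one this
      · rw [h3, if_pos]
        exact Finset.mem_filter.2 ⟨hiG, h3⟩
    · have hiG : i ∉ G ⟨k, hk'⟩ := fun h => hi (Finset.mem_filter.1 h).2
      rw [if_neg hiG, h1 k i (fun h => hi ((hmem k hk' i).1 h)), not_not.1 hi]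
      rfl
  rw [chain_congr hM' fun _ _ _ => rfl]
  exact seminorm_le_of_allNets hN (Φ.comp (chain _ V j r)) hc (fun u hu => h G S hG hS u hu) v

/-- The output row is compared with the vectors that the masked products actually reach, so it
contributes its own factor r' on each net vector, before the passage from the net to the ball. -/
lemma isRegular_of_allNets {V : ℕ → Fin m → Fin m → ℝ} {h₀ w : Fin m → ℝ} {s N H q : ℕ}
    {c r' a τ : ℝ} (hN : m ≤ N * s) (hc : 0 ≤ c) (hr' : 0 ≤ r')
    (h : ∀ G S : Fin H → Finset (Fin m), (∀ k, (G k).card ≤ 2 * q) → (∀ k, (S k).card ≤ 2 * q) →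
      ∀ j r, j + r ≤ H → ∀ u ∈ allNets m s N,
        l2 (chain (overridden (extendFamily G) (extendFamily S) V h₀) V j r u) ≤ c)
    (hout : ∀ G S : Fin H → Finset (Fin m), (∀ k, (G k).card ≤ 2 * q) → (∀ k, (S k).card ≤ 2 * q) →
      ∀ j r, j + r ≤ H → ∀ u ∈ allNets m s N,
        |w ⬝ᵥ chain (overridden (extendFamily G) (extendFamily S) V h₀) V j r u| ≤
        r' * l2 (chain (overridden (extendFamily G) (extendFamily S) V h₀) V j r u))
    (hlayer : ∀ k < H, ∀ u ∈ allNets m s N, l2 (Matrix.of (V k) *ᵥ u) ≤ c)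
    (hact : ∀ k ≤ H, l2 (actSeq V h₀ k) ≤ a)
    (hsmall : ∀ k < H, (Finset.univ.filter fun i => |preact V h₀ k i| < τ).card ≤ q) :
    IsRegular V h₀ w H q (2 * c * √(N : ℝ)) (2 * (r' * c) * √(N : ℝ)) a τ where
  chain_le _ hM _ _ hj v := seminorm_chain_le_of_allNets hN (l2Seminorm _) hc hj
    (fun G S hG hS u hu => h G S hG hS _ _ hj u hu) hM v
  out_le _ hM _ _ hj v := seminorm_chain_le_of_allNets hN (dotSeminorm w) (by positivity) hj.le
    (fun G S hG hS u hu => (hout G S hG hS _ _ hj.le u hu).trans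
      (mul_le_mul_of_nonneg_left (h G S hG hS _ _ hj.le u hu) hr')) hM v
  layer_le k hk v := seminorm_le_of_allNets hN
    ((l2Seminorm _).comp (Matrix.mulVecLin (Matrix.of (V k)))) hc (fun u hu => hlayer k hk u hu) v
  act_le := hact
  card_small := hsmall

end Override

/-! ## Random layers -/

section Layers

variable {m H : ℕ}

/-- The law of the hidden layers. -/
abbrev hiddenLaw (m H : ℕ) : Measure (Fin H → Fin m → Fin m → ℝ) :=
  Measure.pi fun _ => layerLaw m (Fin m)

/-- Integrating out one coordinate. -/
lemma lintegral_pi_le_of_update {E : Type*} [MeasurableSpace E] {ν : Measure E}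
    [IsProbabilityMeasure ν] {f g : (Fin H → E) → ℝ≥0∞} (hf : Measurable f) (hg : Measurable g)
    (k : Fin H) (hgk : ∀ w x, g (Function.update w k x) = g w)
    (h : ∀ w, ∫⁻ x, f (Function.update w k x) ∂ν ≤ g w) :
    ∫⁻ w, f w ∂(Measure.pi fun _ => ν) ≤ ∫⁻ w, g w ∂(Measure.pi fun _ => ν) := by
  refine lintegral_le_of_lmarginal_le {k} hf hg ?_
  rw [lmarginal_singleton, lmarginal_singleton]
  intro w
  simp only [hgk, lintegral_const, measure_univ, mul_one]
  exact h w

lemma layers_update (w : Fin H → Fin m → Fin m → ℝ) (k : Fin H) (x : Fin m → Fin m → ℝ) :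
    layers (Function.update w k x) = Function.update (layers w) k x := by
  funext i
  by_cases hi : i = k
  · subst hi; rw [layers_val]; simp
  · rw [Function.update_of_ne hi]
    unfold layers
    split_ifs with h
    · rw [Function.update_of_ne]
      intro h'; exact hi (by rw [← h'])
    · rfl

lemma actSeq_congr {V V' : ℕ → Fin m → Fin m → ℝ} (h₀ : Fin m → ℝ) {n : ℕ}
    (h : ∀ i < n, V i = V' i) : actSeq V h₀ n = actSeq V' h₀ n := by
  induction n with
  | zero => rfl
  | succ n ih =>
    rw [actSeq, actSeq, h n (Nat.lt_succ_self n), ih fun i hi => h i (hi.trans (Nat.lt_succ_self n))]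

/-- Adaptedness: the product, including its random masks, depends only on the layers below j + r.
Layer j + r can therefore be integrated out with the product held fixed. -/
lemma chain_overridden_congr {V V' : ℕ → Fin m → Fin m → ℝ} (G S : ℕ → Finset (Fin m))
    (h₀ : Fin m → ℝ) {j r : ℕ} (h : ∀ i < j + r, V i = V' i) (u : Fin m → ℝ) :
    chain (overridden G S V h₀) V j r u = chain (overridden G S V' h₀) V' j r u :=
  chain_congr (fun k _ hk => by
    rw [overridden, overridden, h k hk, actSeq_congr h₀ fun i hi => h i (hi.trans hk)])
    (fun k _ hk => h k hk) u

section Measurability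

variable {Ω : Type*} [MeasurableSpace Ω] {κ : Type*} [Fintype κ]

lemma measurable_matrixMulVec {A : Ω → Fin m → κ → ℝ} {u : Ω → κ → ℝ} (hA : Measurable A)
    (hu : Measurable u) : Measurable fun ω => (Matrix.of (A ω) *ᵥ u ω : Fin m → ℝ) := by
  refine measurable_pi_lambda _ fun i => ?_
  simp only [Matrix.mulVec, dotProduct, Matrix.of_apply]
  fun_prop

lemma measurable_l2 {u : Ω → κ → ℝ} (hu : Measurable u) : Measurable fun ω => l2 (u ω) := by
  unfold StreamNet.l2; fun_prop

lemma measurable_relu {u : Ω → Fin m → ℝ} (hu : Measurable u) : Measurable fun ω => relu (u ω) := by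
  refine measurable_pi_lambda _ fun i => ?_
  unfold StreamNet.relu; fun_prop

lemma measurable_gateMask {A : Ω → Fin m → κ → ℝ} {u : Ω → κ → ℝ} (hA : Measurable A)
    (hu : Measurable u) (G S : Finset (Fin m)) : Measurable fun ω => gate G S (A ω) (u ω) := by
  refine measurable_pi_lambda _ fun i => ?_
  unfold StreamNet.gate
  split_ifs
  · exact measurable_const
  · exact measurable_const
  · exact Measurable.ite (measurableSet_lt measurable_const
      ((measurable_pi_apply i).comp (measurable_matrixMulVec hA hu))) measurable_const measurable_const

lemma measurable_dot {u v : Ω → κ → ℝ} (hu : Measurable u) (hv : Measurable v) :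
    Measurable fun ω => u ω ⬝ᵥ v ω := by
  unfold dotProduct; fun_prop

lemma measurable_cardSmall {u : Ω → Fin m → ℝ} (hu : Measurable u) {τ : Ω → ℝ} (hτ : Measurable τ) :
    Measurable fun ω => (Finset.univ.filter fun i => |u ω i| < τ ω).card := by
  simp_rw [Finset.card_filter]
  refine Finset.measurable_sum _ fun i _ => Measurable.ite (measurableSet_lt ?_ hτ) measurable_const
    measurable_const
  fun_prop

lemma measurable_layers (k : ℕ) : Measurable fun w : Fin H → Fin m → Fin m → ℝ => layers w k := by
  unfold layers
  split_ifs
  · exact measurable_pi_apply _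
  · exact measurable_const

lemma measurable_actSeq {V : Ω → ℕ → Fin m → Fin m → ℝ} {h₀ : Ω → Fin m → ℝ}
    (hV : ∀ k, Measurable fun ω => V ω k) (hh : Measurable h₀) (n : ℕ) :
    Measurable fun ω => actSeq (V ω) (h₀ ω) n := by
  induction n with
  | zero => exact hh
  | succ n ih => exact measurable_relu (measurable_matrixMulVec (hV n) ih)

lemma measurable_chain {V : Ω → ℕ → Fin m → Fin m → ℝ} {h₀ u : Ω → Fin m → ℝ}
    (hV : ∀ k, Measurable fun ω => V ω k) (hh : Measurable h₀) (hu : Measurable u)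
    (G S : ℕ → Finset (Fin m)) (j r : ℕ) :
    Measurable fun ω => chain (overridden G S (V ω) (h₀ ω)) (V ω) j r (u ω) := by
  induction r with
  | zero => exact hu
  | succ r ih =>
    have h1 := measurable_gateMask (hV (j + r)) (measurable_actSeq hV hh (j + r)) (G (j + r)) (S (j + r))
    exact h1.mul (measurable_matrixMulVec (hV (j + r)) ih)

end Measurability

/-- Moments of a product of masked random layers. -/
lemma lintegral_chain_pow_le (G S : ℕ → Finset (Fin m)) (h₀ u : Fin m → ℝ) (p : ℕ) (hm : 0 < m)
    (hp : 8 * p ≤ m) (j r : ℕ) (hj : j + r ≤ H) :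
    ∫⁻ w, ENNReal.ofReal (l2 (chain (overridden G S (layers w) h₀) (layers w) j r u) ^ (2 * p))
      ∂(hiddenLaw m H) ≤
      ENNReal.ofReal (Real.exp (∑ i ∈ Finset.range r,
        (16 * p ^ 2 / m + p * (G (j + i)).card / m : ℝ)) * l2 u ^ (2 * p)) := by
  induction r with
  | zero => simp
  | succ r ih =>
    have hmeas : ∀ r, Measurable fun w : Fin H → Fin m → Fin m → ℝ =>
        l2 (chain (overridden G S (layers w) h₀) (layers w) j r u) := fun r =>
      measurable_l2 (measurable_chain (V := fun w : Fin H → Fin m → Fin m → ℝ => layers w)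
        (fun k => measurable_layers k) measurable_const measurable_const G S j r)
    set C : ℝ := Real.exp (16 * p ^ 2 / m + p * (G (j + r)).card / m) with hC
    -- Integrate over layer j + r alone. The earlier product and the activation that opens the gates
    -- are then constants, and the one-layer moment bound applies.
    have hstep := lintegral_pi_le_of_update (ν := layerLaw m (Fin m)) (H := H)
      (f := fun w => ENNReal.ofReal
        (l2 (chain (overridden G S (layers w) h₀) (layers w) j (r + 1) u) ^ (2 * p)))
      (g := fun w => ENNReal.ofReal C * ENNReal.ofReal
        (l2 (chain (overridden G S (layers w) h₀) (layers w) j r u) ^ (2 * p)))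
      ((hmeas (r + 1)).pow_const _).ennreal_ofReal
      (((hmeas r).pow_const _).ennreal_ofReal.const_mul _) ⟨j + r, by omega⟩
      (fun w x => by
        rw [layers_update]
        congr 4
        exact chain_overridden_congr G S h₀ (fun i hi => Function.update_of_ne hi.ne _ _) u)
      (fun w => by
        have e : ∀ x, chain (overridden G S (layers (Function.update w ⟨j + r, by omega⟩ x)) h₀)
            (layers (Function.update w ⟨j + r, by omega⟩ x)) j (r + 1) u =
            gate (G (j + r)) (S (j + r)) x (actSeq (layers w) h₀ (j + r)) *
              (Matrix.of x *ᵥ chain (overridden G S (layers w) h₀) (layers w) j r u) := by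
          intro x
          rw [layers_update, chain_succ, chain_overridden_congr (V' := layers w) G S h₀
            (fun i hi => Function.update_of_ne hi.ne _ _) u, overridden, Function.update_self,
            actSeq_congr (V' := layers w) h₀ fun i hi => Function.update_of_ne hi.ne _ _]
        simp_rw [e]
        refine (lintegral_gate_pow_le _ _ _ _ p hm hp).trans ?_
        rw [ENNReal.ofReal_mul (Real.exp_pos _).le])
    refine hstep.trans ?_
    rw [lintegral_const_mul _ ((hmeas r).pow_const _).ennreal_ofReal]
    refine (mul_le_mul_right (ih (by omega)) _).trans ?_
    rw [← ENNReal.ofReal_mul (Real.exp_pos _).le, Finset.sum_range_succ,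
      Real.exp_add (∑ i ∈ Finset.range r, _), ← hC]
    exact le_of_eq (by congr 1; ring)

/-- Norms of products of masked random layers do not grow. -/
lemma measure_chain_le (G S : ℕ → Finset (Fin m)) (h₀ u : Fin m → ℝ) (p q : ℕ) (hm : 0 < m)
    (hp : 64 * (H + 2) * p ≤ m) (hG : ∀ k, (G k).card ≤ 2 * q) (hq : 4 * H * q ≤ m)
    (j r : ℕ) (hj : j + r ≤ H) :
    hiddenLaw m H {w | 3 * l2 u <
      l2 (chain (overridden G S (layers w) h₀) (layers w) j r u)} ≤
      ENNReal.ofReal (Real.exp (-p / 2)) := by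
  have hm' : (0 : ℝ) < m := by exact_mod_cast hm
  rcases (l2_nonneg u).eq_or_lt with h0 | h0
  · have hu := l2_eq_zero h0.symm
    subst hu
    simp
  have hI := lintegral_chain_pow_le (H := H) G S h₀ u p hm (by nlinarith) j r hj
  refine (measure_le_of_lintegral_le (c := (3 * l2 u) ^ (2 * p)) ?_ (by positivity) hI
    fun w hw => ?_).trans ?_
  · exact (measurable_l2 (measurable_chain (V := fun w : Fin H → Fin m → Fin m → ℝ => layers w)
      (fun k => measurable_layers k) measurable_const measurable_const G S j r)).pow_const _
  · exact pow_le_pow_left₀ (by positivity) (le_of_lt hw) _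
  · refine ENNReal.ofReal_le_ofReal ?_
    rw [mul_pow, mul_div_mul_right _ _ (by positivity), div_le_iff₀ (by positivity)]
    -- As e < 3, the threshold contributes at least e^{2p}. The accumulated exponent is at most p:
    -- the conditions on p and q bound its two parts by p/4 and p/2.
    have h3 : Real.exp (2 * p) ≤ 3 ^ (2 * p) := by
      have : Real.exp (2 * p) = Real.exp 1 ^ (2 * p) := by
        rw [← Real.exp_nat_mul]; push_cast; ring_nf
      rw [this]
      exact pow_le_pow_left₀ (Real.exp_pos _).le (by linarith [Real.exp_one_lt_d9]) _
    refine le_trans ?_ (mul_le_mul_of_nonneg_left h3 (Real.exp_pos _).le)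
    rw [← Real.exp_add]
    refine Real.exp_le_exp.2 ?_
    have hp' : 64 * ((H : ℝ) + 2) * p ≤ m := by exact_mod_cast hp
    have hq' : 4 * (H : ℝ) * q ≤ m := by exact_mod_cast hq
    have hterm : ∀ i ∈ Finset.range r, (16 * p ^ 2 / m + p * (G (j + i)).card / m : ℝ) ≤
        16 * p ^ 2 / m + p * (2 * q) / m := by
      intro i _
      have : ((G (j + i)).card : ℝ) ≤ 2 * q := by exact_mod_cast hG _
      gcongr
    have hsum := Finset.sum_le_card_nsmul _ _ _ hterm
    rw [Finset.card_range, nsmul_eq_mul] at hsum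
    refine hsum.trans ?_
    have hr : (r : ℝ) ≤ H := by exact_mod_cast (by omega : r ≤ H)
    have h1 : (r : ℝ) * (16 * p ^ 2 / m + p * (2 * q) / m) ≤
        H * (16 * p ^ 2 / m + p * (2 * q) / m) := by gcongr
    have h2 : (H : ℝ) * (16 * p ^ 2 / m + p * (2 * q) / m) ≤ p := by
      have e : (H : ℝ) * (16 * p ^ 2 / m + p * (2 * q) / m) =
          p * ((16 * H * p + 2 * H * q) / m) := by field_simp
      rw [e]
      refine mul_le_of_le_one_right (by positivity) ?_
      rw [div_le_one hm']
      have : 0 ≤ (H : ℝ) * p := by positivity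
      nlinarith
    linarith

/-- Operator bound of one random layer on one vector. -/
lemma measure_layer_le {κ : Type*} [Fintype κ] (G S : Finset (Fin m)) (h u : κ → ℝ) (p : ℕ)
    (hm : 0 < m) (hp : 64 * p ≤ m) :
    layerLaw m κ {w | 3 * l2 u < l2 (gate G S w h * (Matrix.of w *ᵥ u))} ≤
      ENNReal.ofReal (Real.exp (-p / 2)) := by
  have hm' : (0 : ℝ) < m := by exact_mod_cast hm
  rcases (l2_nonneg u).eq_or_lt with h0 | h0
  · have hu := l2_eq_zero h0.symm
    subst hu
    simp
  have hI := lintegral_gate_pow_le G S h u p hm (by omega)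
  refine (measure_le_of_lintegral_le (c := (3 * l2 u) ^ (2 * p)) ?_ (by positivity) hI
    fun w hw => ?_).trans ?_
  · have h1 := measurable_gateMask (measurable_id (α := Fin m → κ → ℝ)) (measurable_const (a := h)) G S
    exact (measurable_l2 (h1.mul (measurable_mulVec u))).pow_const _
  · exact pow_le_pow_left₀ (by positivity) (le_of_lt hw) _
  · refine ENNReal.ofReal_le_ofReal ?_
    rw [mul_pow, mul_div_mul_right _ _ (by positivity), div_le_iff₀ (by positivity)]
    have h3 : Real.exp (2 * p) ≤ 3 ^ (2 * p) := by
      have : Real.exp (2 * p) = Real.exp 1 ^ (2 * p) := by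
        rw [← Real.exp_nat_mul]; push_cast; ring_nf
      rw [this]
      exact pow_le_pow_left₀ (Real.exp_pos _).le (by linarith [Real.exp_one_lt_d9]) _
    refine le_trans ?_ (mul_le_mul_of_nonneg_left h3 (Real.exp_pos _).le)
    rw [← Real.exp_add]
    refine Real.exp_le_exp.2 ?_
    have hp' : 64 * (p : ℝ) ≤ m := by exact_mod_cast hp
    have hG : (G.card : ℝ) ≤ m := by
      exact_mod_cast (Finset.card_le_univ G).trans_eq (Fintype.card_fin m)
    have h1 : p * (G.card : ℝ) / m ≤ p := by
      rw [div_le_iff₀ hm']; gcongr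
    have h2 : 16 * (p : ℝ) ^ 2 / m ≤ p / 4 := by
      rw [div_le_iff₀ hm']
      nlinarith [(Nat.cast_nonneg p : (0 : ℝ) ≤ p)]
    linarith [(Nat.cast_nonneg p : (0 : ℝ) ≤ p)]

/-- An event about one layer and its input. -/
lemma measure_hidden_layer_le (k : Fin H) (h₀ : Fin m → ℝ)
    (P : (Fin m → ℝ) → (Fin m → Fin m → ℝ) → Prop) {c : ℝ≥0∞}
    (hP : MeasurableSet {w : Fin H → Fin m → Fin m → ℝ | P (actSeq (layers w) h₀ k) (w k)})
    (h : ∀ v, layerLaw m (Fin m) {x | P v x} ≤ c) :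
    hiddenLaw m H {w | P (actSeq (layers w) h₀ k) (w k)} ≤ c := by
  have hstep := lintegral_pi_le_of_update (ν := layerLaw m (Fin m)) (H := H)
    (f := {w : Fin H → Fin m → Fin m → ℝ | P (actSeq (layers w) h₀ k) (w k)}.indicator 1)
    (g := fun _ => c) (measurable_one.indicator hP) measurable_const k (fun _ _ => rfl)
    (fun w => by
      have e : ∀ x, ({w : Fin H → Fin m → Fin m → ℝ | P (actSeq (layers w) h₀ k) (w k)}.indicator
          (1 : (Fin H → Fin m → Fin m → ℝ) → ℝ≥0∞)) (Function.update w k x) =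
          {x | P (actSeq (layers w) h₀ k) x}.indicator (fun _ => 1) x := by
        intro x
        have h1 : P (actSeq (layers (Function.update w k x)) h₀ k) (Function.update w k x k) ↔
            P (actSeq (layers w) h₀ k) x := by
          rw [layers_update, Function.update_self,
            actSeq_congr (V' := layers w) h₀ fun i hi => Function.update_of_ne hi.ne _ _]
        have h2 : Function.update w k x ∈
            {w : Fin H → Fin m → Fin m → ℝ | P (actSeq (layers w) h₀ k) (w k)} ↔
            x ∈ {x | P (actSeq (layers w) h₀ k) x} := h1
        by_cases hx : x ∈ {x | P (actSeq (layers w) h₀ k) x}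
        · rw [Set.indicator_of_mem (h2.2 hx), Set.indicator_of_mem hx]; rfl
        · rw [Set.indicator_of_notMem (fun h => hx (h2.1 h)), Set.indicator_of_notMem hx]
      simp_rw [e]
      refine (lintegral_indicator_const_le _ _).trans ?_
      rw [one_mul]
      exact h _)
  rw [lintegral_indicator_one hP, lintegral_const, measure_univ, mul_one] at hstep
  exact hstep

end Layers

/-! ## Regularity of the random initialization -/

section Init

variable {d m H : ℕ}

lemma measure_prod_le_of_section {α β : Type*} [MeasurableSpace α] [MeasurableSpace β]
    {μ : Measure α} {ν : Measure β} [IsProbabilityMeasure μ] [SFinite ν] {s : Set (α × β)}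
    (hs : MeasurableSet s) {c : ℝ≥0∞} (h : ∀ a, ν (Prod.mk a ⁻¹' s) ≤ c) : μ.prod ν s ≤ c := by
  rw [Measure.prod_apply hs]
  refine (lintegral_mono h).trans ?_
  rw [lintegral_const, measure_univ, mul_one]

lemma measure_prod_le_of_fst {α β : Type*} [MeasurableSpace α] [MeasurableSpace β]
    {μ : Measure α} {ν : Measure β} [IsProbabilityMeasure ν] [SFinite μ] {s : Set α} :
    μ.prod ν (Prod.fst ⁻¹' s) ≤ μ s := by
  have : (Prod.fst ⁻¹' s : Set (α × β)) = s ×ˢ Set.univ := by ext; simp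
  rw [this, Measure.prod_prod, measure_univ, mul_one]

lemma measure_biUnion_le_card {α ι : Type*} [MeasurableSpace α] (μ : Measure α) (s : Finset ι)
    (A : ι → Set α) {c : ℝ≥0∞} (h : ∀ i ∈ s, μ (A i) ≤ c) : μ (⋃ i ∈ s, A i) ≤ s.card * c := by
  refine (measure_biUnion_finset_le s A).trans ((Finset.sum_le_card_nsmul _ _ c h).trans_eq ?_)
  rw [nsmul_eq_mul]

/-- The sets of at most `q` coordinates. -/
def smallSets (m q : ℕ) : Finset (Finset (Fin m)) := Finset.univ.filter fun G => G.card ≤ q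

lemma card_smallSets_le (m q : ℕ) : (smallSets m q).card ≤ (m + 1) ^ q := by
  classical
  have h : smallSets m q ⊆ (Finset.range (q + 1)).biUnion fun i =>
      Finset.powersetCard i (Finset.univ : Finset (Fin m)) := by
    intro G hG
    rw [Finset.mem_biUnion]
    exact ⟨G.card, Finset.mem_range.2 (Nat.lt_succ_of_le (Finset.mem_filter.1 hG).2),
      Finset.mem_powersetCard.2 ⟨Finset.subset_univ _, rfl⟩⟩
  refine (Finset.card_le_card h).trans (Finset.card_biUnion_le.trans ?_)
  rw [add_pow]
  refine Finset.sum_le_sum fun i hi => ?_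
  rw [Finset.card_powersetCard, Finset.card_univ, Fintype.card_fin, one_pow, mul_one]
  refine (Nat.choose_le_pow m i).trans (Nat.le_mul_of_pos_right _ (Nat.choose_pos ?_))
  exact Nat.le_of_lt_succ (Finset.mem_range.1 hi)

/-- The families of overriding sets. -/
def overrideFamilies (m H q : ℕ) : Finset (Fin H → Finset (Fin m)) :=
  Fintype.piFinset fun _ => smallSets m q

lemma mem_overrideFamilies {q : ℕ} {G : Fin H → Finset (Fin m)} :
    G ∈ overrideFamilies m H q ↔ ∀ k, (G k).card ≤ q := by
  simp [overrideFamilies, smallSets]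

lemma card_overrideFamilies_le (m H q : ℕ) : (overrideFamilies m H q).card ≤ (m + 1) ^ (q * H) := by
  rw [overrideFamilies, Fintype.card_piFinset_const, pow_mul]
  exact Nat.pow_le_pow_left (card_smallSets_le m q) H

/-- The law of the output row. -/
abbrev outLaw (m : ℕ) : Measure (Fin m → ℝ) := Measure.pi fun _ => gaussianReal 0 (1 / (m : ℝ≥0))

lemma initLaw_eq : initLaw d m H = (layerLaw m (Fin d)).prod ((hiddenLaw m H).prod (outLaw m)) := rfl

lemma initLaw_first_le {s : Set (Fin m → Fin d → ℝ)} {c : ℝ≥0∞} (h : layerLaw m (Fin d) s ≤ c) :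
    initLaw d m H {W | W.1 ∈ s} ≤ c := by
  rw [initLaw_eq]
  exact measure_prod_le_of_fst.trans h

lemma initLaw_hidden_le {s : Set ((Fin m → Fin d → ℝ) × (Fin H → Fin m → Fin m → ℝ))} {c : ℝ≥0∞}
    (hs : MeasurableSet s) (h : ∀ a, hiddenLaw m H {w | (a, w) ∈ s} ≤ c) :
    initLaw d m H {W | (W.1, W.2.1) ∈ s} ≤ c := by
  rw [initLaw_eq]
  have hm : Measurable fun W : Weights d m H => (W.1, W.2.1) :=
    measurable_fst.prodMk (measurable_fst.comp measurable_snd)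
  exact measure_prod_le_of_section (hm hs) fun a => measure_prod_le_of_fst.trans (h a)

lemma initLaw_out_le {s : Set (Weights d m H)} {c : ℝ≥0∞} (hs : MeasurableSet s)
    (h : ∀ a b, outLaw m {w | (a, b, w) ∈ s} ≤ c) : initLaw d m H s ≤ c := by
  rw [initLaw_eq]
  exact measure_prod_le_of_section hs fun a =>
    measure_prod_le_of_section (measurable_prodMk_left hs) fun b => h a b

section Measurability

variable (z : EuclideanSpace ℝ (Fin d))

lemma measurable_firstAct {Ω : Type*} [MeasurableSpace Ω] {A : Ω → Fin m → Fin d → ℝ}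
    (hA : Measurable A) : Measurable fun ω => firstAct (A ω) z :=
  measurable_relu (measurable_matrixMulVec hA measurable_const)

lemma measurable_layers_comp {Ω : Type*} [MeasurableSpace Ω] {A : Ω → Fin H → Fin m → Fin m → ℝ}
    (hA : Measurable A) (k : ℕ) : Measurable fun ω => layers (A ω) k :=
  (measurable_layers k).comp hA

end Measurability

/-! ### Failure probabilities of the individual events -/

variable (z : EuclideanSpace ℝ (Fin d)) (p q s N : ℕ)

lemma measure_first_gt (hm : 0 < m) (hp : 64 * (H + 2) * p ≤ m) :
    initLaw d m H {W | 3 * ‖z‖ < l2 (firstAct W.1 z)} ≤ ENNReal.ofReal (Real.exp (-p / 2)) := by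
  refine initLaw_first_le (s := {w | 3 * ‖z‖ < l2 (firstAct w z)}) ?_
  have h := measure_layer_le (m := m) ∅ ∅ (fun j => z j) (fun j => z j) p hm (by nlinarith)
  simp only [gate_empty_mul, l2_coe] at h
  exact h

lemma measure_first_lt (hm : 0 < m) (hz : 0 < ‖z‖) {ε : ℝ} (hε : 0 ≤ ε) :
    initLaw d m H {W | l2 (firstAct W.1 z) ^ 2 ≤ (1 - ε) * ‖z‖ ^ 2} ≤
      ENNReal.ofReal (Real.exp (-(ε ^ 2 * m / 12))) := by
  refine initLaw_first_le (s := {w | l2 (firstAct w z) ^ 2 ≤ (1 - ε) * ‖z‖ ^ 2}) ?_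
  have h := measure_l2_relu_le (m := m) (fun j => z j) (by rwa [l2_coe]) hm hε
  simp only [l2_coe] at h
  exact h

/-- Positivity of the incoming norm is part of the event because a zero input satisfies the
shrinking inequality trivially. -/
lemma measure_shrink (hm : 0 < m) {ε : ℝ} (hε : 0 ≤ ε) (k : Fin H) :
    initLaw d m H {W | 0 < l2 (actSeq (layers W.2.1) (firstAct W.1 z) k) ∧
      l2 (actSeq (layers W.2.1) (firstAct W.1 z) (k + 1)) ^ 2 ≤
        (1 - ε) * l2 (actSeq (layers W.2.1) (firstAct W.1 z) k) ^ 2} ≤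
      ENNReal.ofReal (Real.exp (-(ε ^ 2 * m / 12))) := by
  have hact : ∀ n, Measurable fun W : (Fin m → Fin d → ℝ) × (Fin H → Fin m → Fin m → ℝ) =>
      l2 (actSeq (layers W.2) (firstAct W.1 z) n) := fun n =>
    measurable_l2 (measurable_actSeq (fun k => measurable_layers_comp measurable_snd k)
      (measurable_firstAct z measurable_fst) n)
  have hs : MeasurableSet {W : (Fin m → Fin d → ℝ) × (Fin H → Fin m → Fin m → ℝ) |
      0 < l2 (actSeq (layers W.2) (firstAct W.1 z) k) ∧
      l2 (actSeq (layers W.2) (firstAct W.1 z) (k + 1)) ^ 2 ≤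
        (1 - ε) * l2 (actSeq (layers W.2) (firstAct W.1 z) k) ^ 2} :=
    (measurableSet_lt measurable_const (hact k)).inter
      (measurableSet_le ((hact _).pow_const 2) (((hact _).pow_const 2).const_mul _))
  refine initLaw_hidden_le hs fun a => ?_
  have h := measure_hidden_layer_le k (firstAct a z)
    (fun v x => 0 < l2 v ∧ l2 (relu (Matrix.of x *ᵥ v)) ^ 2 ≤ (1 - ε) * l2 v ^ 2)
    (c := ENNReal.ofReal (Real.exp (-(ε ^ 2 * m / 12)))) ?_ fun v => ?_
  · refine le_trans (measure_mono fun w hw => ?_) h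
    have hw' : 0 < l2 (actSeq (layers w) (firstAct a z) k) ∧
      l2 (relu (Matrix.of (layers w k) *ᵥ actSeq (layers w) (firstAct a z) k)) ^ 2 ≤
        (1 - ε) * l2 (actSeq (layers w) (firstAct a z) k) ^ 2 := hw
    rw [layers_val] at hw'
    exact hw'
  · have hact' : Measurable fun w : Fin H → Fin m → Fin m → ℝ =>
        actSeq (layers w) (firstAct a z) k :=
      measurable_actSeq (fun k => measurable_layers k) measurable_const k
    exact (measurableSet_lt measurable_const (measurable_l2 hact')).inter
      (measurableSet_le ((measurable_l2 (measurable_relu (measurable_matrixMulVec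
        (measurable_pi_apply k) hact'))).pow_const 2)
        (((measurable_l2 hact').pow_const 2).const_mul _))
  · by_cases hv : 0 < l2 v
    · exact (measure_mono fun x hx => (hx : _ ∧ _).2).trans (measure_l2_relu_le v hv hm hε)
    · have : {x : Fin m → Fin m → ℝ | 0 < l2 v ∧
          l2 (relu (Matrix.of x *ᵥ v)) ^ 2 ≤ (1 - ε) * l2 v ^ 2} = ∅ := by
        ext x; simp [hv]
      rw [this]; simp

/-- The threshold is relative to the random incoming norm, which is constant once the layer is
conditioned on its input; `exists_bad_set` replaces it by a multiple of ‖z‖. -/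
lemma measure_card_small (hm : 0 < m) {t : ℝ} (ht : 0 ≤ t) (htq : 7 * t * m ≤ q) (k : Fin H) :
    initLaw d m H {W | 0 < l2 (actSeq (layers W.2.1) (firstAct W.1 z) k) ∧
      q < (Finset.univ.filter fun i => |preact (layers W.2.1) (firstAct W.1 z) k i| <
        t * l2 (actSeq (layers W.2.1) (firstAct W.1 z) k) / √(m : ℝ)).card} ≤
      ENNReal.ofReal (Real.exp (-q)) := by
  have hact : Measurable fun W : (Fin m → Fin d → ℝ) × (Fin H → Fin m → Fin m → ℝ) =>
      actSeq (layers W.2) (firstAct W.1 z) k :=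
    measurable_actSeq (fun k => measurable_layers_comp measurable_snd k)
      (measurable_firstAct z measurable_fst) k
  have hs : MeasurableSet {W : (Fin m → Fin d → ℝ) × (Fin H → Fin m → Fin m → ℝ) |
      0 < l2 (actSeq (layers W.2) (firstAct W.1 z) k) ∧
      q < (Finset.univ.filter fun i => |preact (layers W.2) (firstAct W.1 z) k i| <
        t * l2 (actSeq (layers W.2) (firstAct W.1 z) k) / √(m : ℝ)).card} :=
    (measurableSet_lt measurable_const (measurable_l2 hact)).inter
      (measurableSet_lt measurable_const (measurable_cardSmall
        (measurable_matrixMulVec (measurable_layers_comp measurable_snd k) hact)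
        (((measurable_l2 hact).const_mul t).div_const _)))
  refine initLaw_hidden_le hs fun a => ?_
  have h := measure_hidden_layer_le k (firstAct a z)
    (fun v x => 0 < l2 v ∧ q < (Finset.univ.filter fun i => |(Matrix.of x *ᵥ v) i| <
        t * l2 v / √(m : ℝ)).card)
    (c := ENNReal.ofReal (Real.exp (-q))) ?_ fun v => ?_
  · refine le_trans (measure_mono fun w hw => ?_) h
    have hw' : 0 < l2 (actSeq (layers w) (firstAct a z) k) ∧
      q < (Finset.univ.filter fun i =>
        |(Matrix.of (layers w k) *ᵥ actSeq (layers w) (firstAct a z) k) i| <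
        t * l2 (actSeq (layers w) (firstAct a z) k) / √(m : ℝ)).card := hw
    rw [layers_val] at hw'
    exact hw'
  · have hact' : Measurable fun w : Fin H → Fin m → Fin m → ℝ =>
        actSeq (layers w) (firstAct a z) k :=
      measurable_actSeq (fun k => measurable_layers k) measurable_const k
    exact (measurableSet_lt measurable_const (measurable_l2 hact')).inter
      (measurableSet_lt measurable_const (measurable_cardSmall
        (measurable_matrixMulVec (measurable_pi_apply k) hact')
        (((measurable_l2 hact').const_mul t).div_const _)))
  · by_cases hv : 0 < l2 v
    · refine (measure_mono fun x hx => (hx : _ ∧ _).2).trans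
        ((measure_card_small_le v hv hm q ht le_rfl).trans ?_)
      exact ENNReal.ofReal_le_ofReal (Real.exp_le_exp.2 (by linarith))
    · have : {x : Fin m → Fin m → ℝ | 0 < l2 v ∧ q < (Finset.univ.filter fun i =>
          |(Matrix.of x *ᵥ v) i| < t * l2 v / √(m : ℝ)).card} = ∅ := by
        ext x; simp [hv]
      rw [this]; simp

lemma measurable_chain_weights (G S : ℕ → Finset (Fin m)) (j r : ℕ) {u : (Fin m → ℝ) → Fin m → ℝ}
    (hu : Measurable u) : Measurable fun W : (Fin m → Fin d → ℝ) × (Fin H → Fin m → Fin m → ℝ) =>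
      chain (overridden G S (layers W.2) (firstAct W.1 z)) (layers W.2) j r (u (firstAct W.1 z)) :=
  measurable_chain (V := fun W : (Fin m → Fin d → ℝ) × (Fin H → Fin m → Fin m → ℝ) => layers W.2)
    (fun k => measurable_layers_comp measurable_snd k)
    (measurable_firstAct z measurable_fst) (hu.comp (measurable_firstAct z measurable_fst)) G S j r

/-- The starting vector may depend on the first layer. Constant choices give the net vectors; the
first activation itself gives the norms of all later activations. -/
lemma measure_chain_gt (G S : ℕ → Finset (Fin m)) {u : (Fin m → ℝ) → Fin m → ℝ}
    (hu : Measurable u) (hm : 0 < m)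
    (hp : 64 * (H + 2) * p ≤ m) (hG : ∀ k, (G k).card ≤ 2 * q) (hq : 4 * H * q ≤ m)
    (j r : ℕ) (hj : j + r ≤ H) :
    initLaw d m H {W | 3 * l2 (u (firstAct W.1 z)) < l2 (chain (overridden G S (layers W.2.1)
      (firstAct W.1 z)) (layers W.2.1) j r (u (firstAct W.1 z)))} ≤
      ENNReal.ofReal (Real.exp (-p / 2)) := by
  have hs : MeasurableSet {W : (Fin m → Fin d → ℝ) × (Fin H → Fin m → Fin m → ℝ) |
      3 * l2 (u (firstAct W.1 z)) < l2 (chain (overridden G S (layers W.2)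
      (firstAct W.1 z)) (layers W.2) j r (u (firstAct W.1 z)))} :=
    measurableSet_lt ((measurable_l2 (hu.comp (measurable_firstAct z measurable_fst))).const_mul _)
      (measurable_l2 (measurable_chain_weights z G S j r hu))
  have h := initLaw_hidden_le hs (c := ENNReal.ofReal (Real.exp (-p / 2))) fun a =>
    (measure_mono fun w hw => by simpa only [Set.mem_ofPred_eq] using hw).trans
      (measure_chain_le G S (firstAct a z) (u (firstAct a z)) p q hm hp hG hq j r hj)
  exact (measure_mono fun W hW => by simpa only [Set.mem_ofPred_eq] using hW).trans h

lemma measure_layer_gt (u : Fin m → ℝ) (hm : 0 < m) (hp : 64 * (H + 2) * p ≤ m) (k : Fin H) :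
    initLaw d m H {W | 3 * l2 u < l2 (Matrix.of (layers W.2.1 k) *ᵥ u)} ≤
      ENNReal.ofReal (Real.exp (-p / 2)) := by
  have hs : MeasurableSet {W : (Fin m → Fin d → ℝ) × (Fin H → Fin m → Fin m → ℝ) |
      3 * l2 u < l2 (Matrix.of (layers W.2 k) *ᵥ u)} :=
    measurableSet_lt measurable_const (measurable_l2 (measurable_matrixMulVec
      (measurable_layers_comp measurable_snd k) measurable_const))
  refine initLaw_hidden_le hs fun a => ?_
  have h := measure_hidden_layer_le k (0 : Fin m → ℝ) (fun _ x => 3 * l2 u < l2 (Matrix.of x *ᵥ u))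
    (c := ENNReal.ofReal (Real.exp (-p / 2))) ?_ fun v => ?_
  · refine le_trans (measure_mono fun w hw => ?_) h
    have hw' : 3 * l2 u < l2 (Matrix.of (layers w k) *ᵥ u) := hw
    rw [layers_val] at hw'
    exact hw'
  · exact measurableSet_lt measurable_const (measurable_l2 (measurable_matrixMulVec
      (measurable_pi_apply k) measurable_const))
  · have h := measure_layer_le (m := m) Finset.univ Finset.univ u u p hm (by nlinarith)
    simp only [gate_univ_mul] at h
    exact h

lemma measure_out_gt_of_measurable {g : (Fin m → Fin d → ℝ) × (Fin H → Fin m → Fin m → ℝ) → Fin m → ℝ}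
    (hg : Measurable g) (hm : 0 < m) {ρ : ℝ} (hρ0 : 0 ≤ ρ) (hρ : 4 * p ≤ ρ ^ 2 * m) :
    initLaw d m H {W | ρ * l2 (g (W.1, W.2.1)) < |W.2.2 ⬝ᵥ g (W.1, W.2.1)|} ≤
      ENNReal.ofReal (2 * Real.exp (-p)) := by
  have hc : Measurable fun W : Weights d m H => g (W.1, W.2.1) :=
    hg.comp (measurable_fst.prodMk (measurable_fst.comp measurable_snd))
  exact initLaw_out_le (measurableSet_lt ((measurable_l2 hc).const_mul ρ)
    (measurable_dot (measurable_snd.comp measurable_snd) hc).abs) fun a b =>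
      measure_out_le (g (a, b)) hm p hρ hρ0

lemma measure_out_gt (G S : ℕ → Finset (Fin m)) (u : Fin m → ℝ) (hm : 0 < m) (j r : ℕ) {ρ : ℝ}
    (hρ0 : 0 ≤ ρ) (hρ : 4 * p ≤ ρ ^ 2 * m) :
    initLaw d m H {W | ρ * l2 (chain (overridden G S (layers W.2.1) (firstAct W.1 z))
        (layers W.2.1) j r u) <
      |W.2.2 ⬝ᵥ chain (overridden G S (layers W.2.1) (firstAct W.1 z)) (layers W.2.1) j r u|} ≤
      ENNReal.ofReal (2 * Real.exp (-p)) :=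
  measure_out_gt_of_measurable p
    (measurable_chain_weights z G S j r (measurable_const (a := u))) hm hρ0 hρ

/-- A lower bound for a sequence that shrinks by at most the factor `1 - 1 / (2 n)` per step. -/
lemma half_le_of_shrink {b : ℕ → ℝ} {n : ℕ} (hn : 0 < n) (h0 : 0 < b 0)
    (h : ∀ k < n, 0 < b k → (1 - 1 / (2 * n)) * b k ≤ b (k + 1)) :
    ∀ k ≤ n, 1 / 2 * b 0 ≤ b k := by
  have hn' : (1 : ℝ) ≤ n := by exact_mod_cast hn
  have hx : 1 / (2 * (n : ℝ)) ≤ 1 / 2 := by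
    rw [div_le_div_iff₀ (by positivity) (by positivity)]; linarith
  have key : ∀ k ≤ n, (1 - k * (1 / (2 * (n : ℝ)))) * b 0 ≤ b k := by
    intro k
    induction k with
    | zero => intro _; simp
    | succ k ih =>
      intro hk
      have h1 := ih (by omega)
      have hk' : (k : ℝ) + 1 ≤ n := by exact_mod_cast hk
      have h2 : (k : ℝ) * (1 / (2 * (n : ℝ))) ≤ 1 / 2 := by
        rw [mul_one_div, div_le_div_iff₀ (by positivity) (by positivity)]; linarith
      have hpos : 0 < b k := lt_of_lt_of_le (mul_pos (by linarith) h0) h1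
      refine le_trans ?_ (h k (by omega) hpos)
      refine le_trans ?_ (mul_le_mul_of_nonneg_left h1 (by linarith))
      rw [← mul_assoc]
      refine mul_le_mul_of_nonneg_right ?_ h0.le
      have : 0 ≤ (k : ℝ) * (1 / (2 * (n : ℝ))) * (1 / (2 * (n : ℝ))) := by positivity
      push_cast
      nlinarith
  intro k hk
  refine le_trans (mul_le_mul_of_nonneg_right ?_ h0.le) (key k hk)
  have hk' : (k : ℝ) ≤ n := by exact_mod_cast hk
  have h2 : (k : ℝ) * (1 / (2 * (n : ℝ))) ≤ 1 / 2 := by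
    rw [mul_one_div, div_le_div_iff₀ (by positivity) (by positivity)]; linarith
  linarith

/-- With high probability, the random initialization is regular at the input `z`. -/
theorem exists_bad_set (hm : 0 < m) (hz : 0 < ‖z‖) (hp : 64 * (H + 2) * p ≤ m)
    (hq : 4 * H * q ≤ m) (hqp : 2 * q ≤ p) (hqm : 48 * (H + 1) ^ 2 * q ≤ m) (hs : 0 < s)
    (hN : m ≤ N * s) {t ρ : ℝ} (ht : 0 ≤ t) (htq : 7 * t * m ≤ q) (hρ0 : 0 ≤ ρ)
    (hρ : 4 * p ≤ ρ ^ 2 * m)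
    (hcard : (((m + 1) ^ (2 * q * H)) ^ 2 * (H + 1) ^ 2 * (N * 48 ^ s) : ℝ) *
      (2 * Real.exp (-p / 2)) ≤ Real.exp (-q)) :
    ∃ Bad : Set (Weights d m H),
      initLaw d m H Bad ≤ ENNReal.ofReal (8 * (H + 1) * Real.exp (-q)) ∧
      ∀ W ∉ Bad, IsRegular (layers W.2.1) (firstAct W.1 z) W.last H q
        (2 * 3 * √(N : ℝ)) (2 * (ρ * 3) * √(N : ℝ)) (9 * ‖z‖) (t * (‖z‖ / 2) / √(m : ℝ)) := by
  classical
  have hm' : (0 : ℝ) < m := by exact_mod_cast hm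
  -- With this ε, the H + 1 layers together lose at most half of the squared norm.
  set ε : ℝ := 1 / (2 * ((H + 1 : ℕ) : ℝ)) with hε
  have hε0 : 0 ≤ ε := by positivity
  let I := overrideFamilies m H (2 * q)
  let J := Finset.range (H + 1)
  let U := allNets m s N
  let A₁ : Set (Weights d m H) := {W | 3 * ‖z‖ < l2 (firstAct W.1 z)}
  let A₂ : Set (Weights d m H) := {W | l2 (firstAct W.1 z) ^ 2 ≤ (1 - ε) * ‖z‖ ^ 2}
  let A₃ : Fin H → Set (Weights d m H) := fun k =>
    {W | 0 < l2 (actSeq (layers W.2.1) (firstAct W.1 z) k) ∧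
      l2 (actSeq (layers W.2.1) (firstAct W.1 z) (k + 1)) ^ 2 ≤
        (1 - ε) * l2 (actSeq (layers W.2.1) (firstAct W.1 z) k) ^ 2}
  let A₄ : Fin H → Set (Weights d m H) := fun k =>
    {W | 0 < l2 (actSeq (layers W.2.1) (firstAct W.1 z) k) ∧
      q < (Finset.univ.filter fun i => |preact (layers W.2.1) (firstAct W.1 z) k i| <
        t * l2 (actSeq (layers W.2.1) (firstAct W.1 z) k) / √(m : ℝ)).card}
  let A₅ : ℕ → Set (Weights d m H) := fun k =>
    {W | 3 * l2 (id (firstAct W.1 z)) < l2 (chain (overridden (fun _ => ∅) (fun _ => ∅)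
      (layers W.2.1) (firstAct W.1 z)) (layers W.2.1) 0 k (id (firstAct W.1 z)))}
  let A₆ : Fin H × (Fin m → ℝ) → Set (Weights d m H) := fun a =>
    {W | 3 * l2 a.2 < l2 (Matrix.of (layers W.2.1 a.1) *ᵥ a.2)}
  let A₇ : ((Fin H → Finset (Fin m)) × (Fin H → Finset (Fin m))) × (ℕ × ℕ) × (Fin m → ℝ) →
      Set (Weights d m H) := fun a =>
    {W | 3 * l2 a.2.2 < l2 (chain (overridden (extendFamily a.1.1) (extendFamily a.1.2)
      (layers W.2.1) (firstAct W.1 z)) (layers W.2.1) a.2.1.1 a.2.1.2 a.2.2)}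
  let A₈ : ((Fin H → Finset (Fin m)) × (Fin H → Finset (Fin m))) × (ℕ × ℕ) × (Fin m → ℝ) →
      Set (Weights d m H) := fun a =>
    {W | ρ * l2 (chain (overridden (extendFamily a.1.1) (extendFamily a.1.2)
      (layers W.2.1) (firstAct W.1 z)) (layers W.2.1) a.2.1.1 a.2.1.2 a.2.2) <
      |W.2.2 ⬝ᵥ chain (overridden (extendFamily a.1.1) (extendFamily a.1.2)
      (layers W.2.1) (firstAct W.1 z)) (layers W.2.1) a.2.1.1 a.2.1.2 a.2.2|}
  let T := ((I ×ˢ I) ×ˢ (J ×ˢ J) ×ˢ U).filter fun a => a.2.1.1 + a.2.1.2 ≤ H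
  set c : ℝ := Real.exp (-q) with hc
  have hc0 : 0 < c := Real.exp_pos _
  have hpq : Real.exp (-p / 2) ≤ c := by
    have : 2 * (q : ℝ) ≤ p := by exact_mod_cast hqp
    exact Real.exp_le_exp.2 (by linarith)
  have hεq : Real.exp (-(ε ^ 2 * m / 12)) ≤ c := by
    have h1 : 48 * ((H : ℝ) + 1) ^ 2 * q ≤ m := by exact_mod_cast hqm
    refine Real.exp_le_exp.2 (neg_le_neg ?_)
    have e : ε ^ 2 * m / 12 = m / (48 * ((H : ℝ) + 1) ^ 2) := by
      rw [hε]; push_cast; field_simp; norm_num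
    rw [e, le_div_iff₀ (by positivity)]
    linarith
  have hU : (U.card : ℝ) ≤ N * 48 ^ s := by exact_mod_cast card_allNets_le (m := m) (N := N) hs
  have hIc : (I.card : ℝ) ≤ (m + 1) ^ (2 * q * H) := by
    exact_mod_cast card_overrideFamilies_le m H (2 * q)
  have hT : (T.card : ℝ) ≤ ((m + 1) ^ (2 * q * H)) ^ 2 * (H + 1) ^ 2 * (N * 48 ^ s) := by
    have h1 : T.card ≤ I.card * I.card * ((H + 1) * (H + 1) * U.card) := by
      refine (Finset.card_filter_le _ _).trans_eq ?_
      rw [Finset.card_product, Finset.card_product, Finset.card_product, Finset.card_product,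
        Finset.card_range]
    have h2 : (T.card : ℝ) ≤ I.card * I.card * ((H + 1) * (H + 1) * U.card) := by exact_mod_cast h1
    refine h2.trans ?_
    rw [sq, sq, mul_assoc (_ * _) (_ * _) (_ * _)]
    gcongr
  have hone : (1 : ℝ) ≤ (((m : ℝ) + 1) ^ (2 * q * H)) ^ 2 :=
    one_le_pow₀ (one_le_pow₀ (by linarith))
  have hHU : ((((Finset.univ : Finset (Fin H)) ×ˢ U).card : ℕ) : ℝ) ≤
      ((m + 1) ^ (2 * q * H)) ^ 2 * (H + 1) ^ 2 * (N * 48 ^ s) := by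
    rw [Finset.card_product, Finset.card_univ, Fintype.card_fin, Nat.cast_mul]
    have h1 : (H : ℝ) ≤ (((m : ℝ) + 1) ^ (2 * q * H)) ^ 2 * (H + 1) ^ 2 := by
      have : (H : ℝ) ≤ 1 * (H + 1) ^ 2 := by nlinarith [(Nat.cast_nonneg H : (0 : ℝ) ≤ H)]
      refine this.trans (mul_le_mul_of_nonneg_right hone (by positivity))
    gcongr
  have hfam : ∀ n : ℕ, (n : ℝ) ≤ ((m + 1) ^ (2 * q * H)) ^ 2 * (H + 1) ^ 2 * (N * 48 ^ s) →
      (n : ℝ≥0∞) * ENNReal.ofReal (2 * Real.exp (-p / 2)) ≤ ENNReal.ofReal c := by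
    intro n hn
    rw [← ENNReal.ofReal_natCast, ← ENNReal.ofReal_mul (Nat.cast_nonneg _)]
    exact ENNReal.ofReal_le_ofReal ((mul_le_mul_of_nonneg_right hn (by positivity)).trans hcard)
  have hle2 : Real.exp (-p / 2) ≤ 2 * Real.exp (-p / 2) := by
    linarith [Real.exp_pos (-(p : ℝ) / 2)]
  have hI' : ∀ G ∈ I, ∀ k, (extendFamily G k).card ≤ 2 * q := fun G hG k =>
    card_extendFamily_le (mem_overrideFamilies.1 hG) k
  have hcov : ∀ n : ℕ, (n : ℝ≥0∞) * ENNReal.ofReal c = ENNReal.ofReal (n * c) := fun n => by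
    rw [← ENNReal.ofReal_natCast, ← ENNReal.ofReal_mul (Nat.cast_nonneg _)]
  -- The events A₁ and A₂ and each member of A₃, A₄ and A₅ cost at most c; the families A₆, A₇ and
  -- A₈ cost at most c each as a whole, by `hcard`. The total is (3H + 6)c.
  refine ⟨A₁ ∪ A₂ ∪ (⋃ k ∈ (Finset.univ : Finset (Fin H)), A₃ k) ∪
    (⋃ k ∈ (Finset.univ : Finset (Fin H)), A₄ k) ∪ (⋃ k ∈ J, A₅ k) ∪
    (⋃ a ∈ (Finset.univ : Finset (Fin H)) ×ˢ U, A₆ a) ∪ (⋃ a ∈ T, A₇ a) ∪ (⋃ a ∈ T, A₈ a), ?_, ?_⟩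
  · have b1 : initLaw d m H A₁ ≤ ENNReal.ofReal c :=
      (measure_first_gt z p hm hp).trans (ENNReal.ofReal_le_ofReal hpq)
    have b2 : initLaw d m H A₂ ≤ ENNReal.ofReal c :=
      (measure_first_lt z hm hz hε0).trans (ENNReal.ofReal_le_ofReal hεq)
    have b3 := measure_biUnion_le_card (initLaw d m H) Finset.univ A₃ fun k _ =>
      (measure_shrink z hm hε0 k).trans (ENNReal.ofReal_le_ofReal hεq)
    have b4 := measure_biUnion_le_card (initLaw d m H) Finset.univ A₄ (c := ENNReal.ofReal c) fun k _ =>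
      measure_card_small z q hm ht htq k
    have b5 := measure_biUnion_le_card (initLaw d m H) J A₅ fun k hk =>
      (measure_chain_gt z p q (fun _ => ∅) (fun _ => ∅) measurable_id hm hp (by simp) hq 0 k
        (by have := Finset.mem_range.1 hk; omega)).trans (ENNReal.ofReal_le_ofReal hpq)
    have b6 := (measure_biUnion_le_card (initLaw d m H) (Finset.univ ×ˢ U) A₆ fun a _ =>
      (measure_layer_gt p a.2 hm hp a.1).trans (ENNReal.ofReal_le_ofReal hle2)).trans (hfam _ hHU)
    have b7 := (measure_biUnion_le_card (initLaw d m H) T A₇ fun a ha => by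
      have ha1 := Finset.mem_filter.1 ha
      have ha2 := Finset.mem_product.1 (Finset.mem_product.1 ha1.1).1
      exact (measure_chain_gt z p q (extendFamily a.1.1) (extendFamily a.1.2)
        (measurable_const (a := a.2.2)) hm hp (hI' _ ha2.1) hq _ _ ha1.2).trans
          (ENNReal.ofReal_le_ofReal hle2)).trans (hfam _ hT)
    have b8 := (measure_biUnion_le_card (initLaw d m H) T A₈ fun a _ =>
      (measure_out_gt z p (extendFamily a.1.1) (extendFamily a.1.2) a.2.2 hm _ _ hρ0 hρ).trans
        (ENNReal.ofReal_le_ofReal (mul_le_mul_of_nonneg_left (Real.exp_le_exp.2 (by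
          linarith [(Nat.cast_nonneg p : (0 : ℝ) ≤ p)])) two_pos.le))).trans (hfam _ hT)
    simp only [Finset.card_univ, Fintype.card_fin, J, Finset.card_range, hcov] at b3 b4 b5
    refine (measure_union_le _ _).trans ((add_le_add ((measure_union_le _ _).trans (add_le_add
      ((measure_union_le _ _).trans (add_le_add ((measure_union_le _ _).trans (add_le_add
      ((measure_union_le _ _).trans (add_le_add ((measure_union_le _ _).trans (add_le_add
      ((measure_union_le _ _).trans (add_le_add b1 b2)) b3)) b4)) b5)) b6)) b7)) b8).trans ?_)
    have hHc : 0 ≤ (H : ℝ) * c := by positivity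
    have hHc' : 0 ≤ ((H + 1 : ℕ) : ℝ) * c := by positivity
    rw [← ENNReal.ofReal_add (by positivity) (by positivity),
      ← ENNReal.ofReal_add (by positivity) (by positivity),
      ← ENNReal.ofReal_add (by positivity) (by positivity),
      ← ENNReal.ofReal_add (by positivity) (by positivity),
      ← ENNReal.ofReal_add (by positivity) (by positivity),
      ← ENNReal.ofReal_add (by positivity) (by positivity),
      ← ENNReal.ofReal_add (by positivity) (by positivity)]
    refine ENNReal.ofReal_le_ofReal ?_
    push_cast
    nlinarith
  · intro W hW
    simp only [Set.mem_union, not_or, Set.mem_iUnion, not_exists] at hW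
    obtain ⟨⟨⟨⟨⟨⟨⟨n1, n2⟩, n3⟩, n4⟩, n5⟩, n6⟩, n7⟩, n8⟩ := hW
    have g1 : l2 (firstAct W.1 z) ≤ 3 * ‖z‖ := not_lt.1 n1
    have g2 : (1 - ε) * ‖z‖ ^ 2 < l2 (firstAct W.1 z) ^ 2 := not_le.1 n2
    have hUl : ∀ u ∈ U, l2 u ≤ 1 := fun u hu => (Finset.mem_filter.1 hu).2
    -- The index is shifted by one, with the input norm in position 0, so that the first layer joins
    -- the same recursion as the hidden ones.
    set b : ℕ → ℝ := fun k => Nat.casesOn k (‖z‖ ^ 2)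
      fun k => l2 (actSeq (layers W.2.1) (firstAct W.1 z) k) ^ 2 with hb
    have hlow : ∀ k ≤ H, ‖z‖ / 2 ≤ l2 (actSeq (layers W.2.1) (firstAct W.1 z) k) := by
      have h := half_le_of_shrink (b := b) (n := H + 1) (Nat.succ_pos H)
        (show (0 : ℝ) < ‖z‖ ^ 2 by positivity) (fun k hk hbk => by
          cases k with
          | zero => exact g2.le
          | succ k =>
            have hk' : k < H := by omega
            have hpos : 0 < l2 (actSeq (layers W.2.1) (firstAct W.1 z) k) :=
              lt_of_le_of_ne (l2_nonneg _) fun h0 => by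
                simp only [hb, ← h0] at hbk; norm_num at hbk
            have h3 := n3 ⟨k, hk'⟩ (Finset.mem_univ _)
            by_contra h4
            exact h3 ⟨hpos, le_of_lt (not_le.1 h4)⟩)
      intro k hk
      have h5 : 1 / 2 * ‖z‖ ^ 2 ≤ l2 (actSeq (layers W.2.1) (firstAct W.1 z) k) ^ 2 :=
        h (k + 1) (by omega)
      refine le_of_sq_le_sq ?_ (l2_nonneg _)
      nlinarith [sq_nonneg ‖z‖]
    refine isRegular_of_allNets hN (by norm_num) hρ0 ?_ ?_ ?_ ?_ ?_
    · intro G S hG hS j r hj u hu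
      have hmem : ((G, S), (j, r), u) ∈ T := by
        refine Finset.mem_filter.2 ⟨?_, hj⟩
        simp only [Finset.mem_product]
        exact ⟨⟨mem_overrideFamilies.2 hG, mem_overrideFamilies.2 hS⟩,
          ⟨Finset.mem_range.2 (by omega), Finset.mem_range.2 (by omega)⟩, hu⟩
      have h7 : l2 (chain (overridden (extendFamily G) (extendFamily S) (layers W.2.1)
          (firstAct W.1 z)) (layers W.2.1) j r u) ≤ 3 * l2 u :=
        not_lt.1 fun h => n7 ((G, S), (j, r), u) hmem h
      refine h7.trans ?_
      have := hUl u hu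
      linarith
    · intro G S hG hS j r hj u hu
      have hmem : ((G, S), (j, r), u) ∈ T := by
        refine Finset.mem_filter.2 ⟨?_, hj⟩
        simp only [Finset.mem_product]
        exact ⟨⟨mem_overrideFamilies.2 hG, mem_overrideFamilies.2 hS⟩,
          ⟨Finset.mem_range.2 (by omega), Finset.mem_range.2 (by omega)⟩, hu⟩
      exact not_lt.1 fun h => n8 ((G, S), (j, r), u) hmem h
    · intro k hk u hu
      have h6 : l2 (Matrix.of (layers W.2.1 k) *ᵥ u) ≤ 3 * l2 u :=
        not_lt.1 fun h => n6 (⟨k, hk⟩, u) (Finset.mem_product.2 ⟨Finset.mem_univ _, hu⟩) h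
      refine h6.trans ?_
      have := hUl u hu
      linarith
    -- Activations are the product with no override, started at the first activation: one factor 3
    -- from the product and one from the first layer give 9‖z‖.
    · intro k hk
      have h5 : l2 (chain (overridden (fun _ => ∅) (fun _ => ∅) (layers W.2.1) (firstAct W.1 z))
          (layers W.2.1) 0 k (firstAct W.1 z)) ≤ 3 * l2 (firstAct W.1 z) :=
        not_lt.1 fun h => n5 k (Finset.mem_range.2 (by omega)) h
      rw [overridden_empty] at h5
      rw [actSeq_eq_chain]
      refine h5.trans ?_
      linarith
    · intro k hk
      have hpos : 0 < l2 (actSeq (layers W.2.1) (firstAct W.1 z) k) :=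
        lt_of_lt_of_le (by positivity) (hlow k hk.le)
      have h4 := n4 ⟨k, hk⟩ (Finset.mem_univ _)
      have h4' : (Finset.univ.filter fun i => |preact (layers W.2.1) (firstAct W.1 z) k i| <
          t * l2 (actSeq (layers W.2.1) (firstAct W.1 z) k) / √(m : ℝ)).card ≤ q := by
        by_contra h
        exact h4 ⟨hpos, not_le.1 h⟩
      refine (Finset.card_le_card fun i hi => ?_).trans h4'
      rw [Finset.mem_filter] at hi ⊢
      refine ⟨hi.1, hi.2.trans_le ?_⟩
      have := hlow k hk.le
      gcongr

end Init

/-! ## Training in the neighbourhood of a regular initialization -/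

section Training

variable {d m H : ℕ}

/-- The initialization `W` is regular at the input `z`, with activations of order `‖z‖` and few
preactivations below the order `t ‖z‖ / √m`; nothing is required at `z = 0`. -/
def RegularAt (W : Weights d m H) (z : EuclideanSpace ℝ (Fin d)) (q : ℕ) (K β t : ℝ) : Prop :=
  z = 0 ∨ IsRegular (layers W.2.1) (firstAct W.1 z) W.last H q K β (9 * ‖z‖)
    (t * (‖z‖ / 2) / √(m : ℝ))

/-- The weights `W'` have the outer layers of `W` and square layers at distance at most `ω`. -/
structure HiddenClose (W : Weights d m H) (ω : ℝ) (W' : Weights d m H) : Prop where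
  first_eq : W'.1 = W.1
  last_eq : W'.2.2 = W.2.2
  frob_le : ∀ k, frob (W'.2.1 k - W.2.1 k) ≤ ω

/-- The radius `ω` is small enough for perturbing a regular initialization. -/
structure SmallRadius (m H q : ℕ) (K β t ω : ℝ) : Prop where
  width_pos : 0 < m
  op_nonneg : 0 ≤ K
  out_nonneg : 0 ≤ β
  scale_pos : 0 < t
  radius_nonneg : 0 ≤ ω
  growth_le : 2 * H * K * ω ≤ 1
  flips_le : (K * (H * K * ω * 18) + ω * 18) ^ 2 * (4 * m) ≤ q * t ^ 2

lemma HiddenClose.refl (W : Weights d m H) {ω : ℝ} (hω : 0 ≤ ω) : HiddenClose W ω W :=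
  ⟨rfl, rfl, fun k => by rw [sub_self, frob_zero]; exact hω⟩

variable {W W' : Weights d m H} {z : EuclideanSpace ℝ (Fin d)} {q : ℕ} {K β t ω : ℝ}

lemma HiddenClose.frob_layers_le (hc : HiddenClose W ω W') :
    ∀ k < H, frob (layers W'.2.1 k - layers W.2.1 k) ≤ ω := fun k hk => by
  rw [layers_val _ ⟨k, hk⟩, layers_val _ ⟨k, hk⟩]; exact hc.frob_le ⟨k, hk⟩

/-- Homogeneity in the input norm: both sides scale quadratically, so one scale-free condition
serves all inputs. -/
lemma SmallRadius.flips_le_scaled (hs : SmallRadius m H q K β t ω) (x : ℝ) :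
    (K * (H * K * ω * (2 * (9 * x))) + ω * (2 * (9 * x))) ^ 2 ≤
      q * (t * (x / 2) / √(m : ℝ)) ^ 2 := by
  have hm : (0 : ℝ) < m := by exact_mod_cast hs.width_pos
  rw [div_pow, Real.sq_sqrt hm.le, ← mul_div_assoc, le_div_iff₀ hm]
  have h := mul_le_mul_of_nonneg_right hs.flips_le (sq_nonneg (x / 2))
  nlinarith

lemma l2_act_le (hs : SmallRadius m H q K β t ω) (hr : RegularAt W z q K β t)
    (hc : HiddenClose W ω W') (k : Fin (H + 1)) : l2 (act W' z k) ≤ 18 * ‖z‖ := by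
  rw [act_eq_actSeq]
  rcases hr with rfl | hr
  · rw [firstAct_zero, actSeq_zero, l2_zero, norm_zero, mul_zero]
  · rcases eq_or_ne z 0 with rfl | hz
    · rw [firstAct_zero, actSeq_zero, l2_zero, norm_zero, mul_zero]
    have hz' : 0 < ‖z‖ := norm_pos_iff.2 hz
    have hm : (0 : ℝ) < m := by exact_mod_cast hs.width_pos
    have ht := hs.scale_pos
    rw [hc.first_eq]
    refine ((hr.act_flips hs.op_nonneg hs.radius_nonneg (by positivity) (by positivity)
      hc.frob_layers_le hs.growth_le (hs.flips_le_scaled _) k (Nat.lt_succ_iff.1 k.isLt)).1).trans ?_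
    linarith

lemma l2_back_le_of_regularAt (hs : SmallRadius m H q K β t ω) (hr : RegularAt W z q K β t)
    (hc : HiddenClose W ω W') (hz : z ≠ 0) (k : Fin (H + 1)) : l2 (back W' z k) ≤ 2 * β := by
  rcases hr with rfl | hr
  · exact absurd rfl hz
  have hz' : 0 < ‖z‖ := norm_pos_iff.2 hz
  have hm : (0 : ℝ) < m := by exact_mod_cast hs.width_pos
  have ht := hs.scale_pos
  have hβ := hs.out_nonneg
  refine l2_back_le W' z (by positivity) (fun j r hj v => ?_) k
  rw [Weights.last, hc.first_eq, hc.last_eq]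
  exact hr.abs_out_chain_le hs.op_nonneg hβ hs.radius_nonneg (by positivity) (by positivity)
    hc.frob_layers_le hs.growth_le (hs.flips_le_scaled _) hj v

lemma abs_net_sub_le (hs : SmallRadius m H q K β t ω) (hr : RegularAt W z q K β t)
    (hc : HiddenClose W ω W') :
    |net W' z - net W z| ≤ √(m : ℝ) * (H * (β * (ω * (18 * ‖z‖)))) := by
  have hβ := hs.out_nonneg
  have hω := hs.radius_nonneg
  rcases eq_or_ne z 0 with rfl | hz
  · simp [net_eq, firstAct_zero, actSeq_zero]
  rcases hr with rfl | hr
  · exact absurd rfl hz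
  have hz' : 0 < ‖z‖ := norm_pos_iff.2 hz
  have hm : (0 : ℝ) < m := by exact_mod_cast hs.width_pos
  have ht := hs.scale_pos
  have h := hr.abs_out_sub_le hs.op_nonneg hβ hω (by positivity) (by positivity)
    hc.frob_layers_le hs.growth_le (hs.flips_le_scaled _)
  rw [net_eq, net_eq, ← mul_sub, abs_mul, abs_of_nonneg (Real.sqrt_nonneg _), Weights.last,
    Weights.last, hc.first_eq, hc.last_eq]
  refine mul_le_mul_of_nonneg_left (h.trans_eq ?_) (Real.sqrt_nonneg _)
  ring

lemma frob_gradNet_hidden_le (hs : SmallRadius m H q K β t ω) (hr : RegularAt W z q K β t)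
    (hc : HiddenClose W ω W') (k : Fin H) :
    frob ((gradNet W' z).2.1 k) ≤ √(m : ℝ) * (2 * β * (18 * ‖z‖)) := by
  have hβ := hs.out_nonneg
  have h1 := l2_act_le hs hr hc k.castSucc
  have e : frob ((gradNet W' z).2.1 k) =
      √(m : ℝ) * (l2 (back W' z k.succ) * l2 (act W' z k.castSucc)) := by
    rw [← abs_of_nonneg (Real.sqrt_nonneg (m : ℝ)), ← frob_rankOne]
    rfl
  rw [e]
  refine mul_le_mul_of_nonneg_left ?_ (Real.sqrt_nonneg _)
  rcases eq_or_ne z 0 with rfl | hz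
  · rw [norm_zero, mul_zero] at h1
    rw [le_antisymm h1 (l2_nonneg _), mul_zero, norm_zero, mul_zero, mul_zero]
  · exact mul_le_mul (l2_back_le_of_regularAt hs hr hc hz _) h1 (l2_nonneg _) (by positivity)

lemma frob_gradNet_first_le (hs : SmallRadius m H q K β t ω) (hr : RegularAt W z q K β t) :
    frob (gradNet W z).1 ≤ √(m : ℝ) * (2 * β * ‖z‖) := by
  have hβ := hs.out_nonneg
  have e : frob (gradNet W z).1 = √(m : ℝ) * (l2 (back W z 0) * ‖z‖) := by
    rw [← abs_of_nonneg (Real.sqrt_nonneg (m : ℝ)), ← l2_coe z, ← frob_rankOne]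
    rfl
  rw [e]
  refine mul_le_mul_of_nonneg_left ?_ (Real.sqrt_nonneg _)
  rcases eq_or_ne z 0 with rfl | hz
  · rw [norm_zero, mul_zero, mul_zero]
  · exact mul_le_mul_of_nonneg_right
      (l2_back_le_of_regularAt hs hr (HiddenClose.refl W hs.radius_nonneg) hz _) (norm_nonneg _)

lemma l2_gradNet_last_le (hs : SmallRadius m H q K β t ω) (hr : RegularAt W z q K β t) :
    l2 (gradNet W z).2.2 ≤ √(m : ℝ) * (18 * ‖z‖) := by
  have e : (gradNet W z).2.2 = √(m : ℝ) • act W z (Fin.last H) := rfl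
  rw [e, l2_smul, abs_of_nonneg (Real.sqrt_nonneg _)]
  exact mul_le_mul_of_nonneg_left (l2_act_le hs hr (HiddenClose.refl W hs.radius_nonneg) _)
    (Real.sqrt_nonneg _)

/-- The linear part of a random feature function is of order `r L √m`. -/
lemma abs_innerW_gradNet_le (hs : SmallRadius m H q K β t ω) (hr : RegularAt W z q K β t)
    {U : Weights d m H} {r : ℝ} (hU : U ∈ nbhd (0 : Weights d m H) r) (hr0 : 0 ≤ r) :
    |innerW (gradNet W z) U| ≤ r * √(m : ℝ) * ‖z‖ * (36 * β * (H + 1) + 18) := by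
  have hβ := hs.out_nonneg
  obtain ⟨u1, u2, u3⟩ := hU
  have u1' : frob U.1 ≤ r := by simpa [frob] using u1
  have u2' : ∀ k, frob (U.2.1 k) ≤ r := fun k => by simpa [frob] using u2 k
  have u3' : l2 U.2.2 ≤ r := by simpa [l2] using u3
  have a1 : |∑ i, ∑ j, (gradNet W z).1 i j * U.1 i j| ≤ √(m : ℝ) * (2 * β * ‖z‖) * r :=
    (abs_sum_sum_mul_le _ _).trans
      (mul_le_mul (frob_gradNet_first_le hs hr) u1' (frob_nonneg _) (by positivity))
  have a2 : |∑ k, ∑ i, ∑ j, (gradNet W z).2.1 k i j * U.2.1 k i j| ≤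
      H * (√(m : ℝ) * (2 * β * (18 * ‖z‖)) * r) := by
    refine (Finset.abs_sum_le_sum_abs _ _).trans
      ((Finset.sum_le_card_nsmul _ _ (√(m : ℝ) * (2 * β * (18 * ‖z‖)) * r) fun k _ => ?_).trans_eq ?_)
    · exact (abs_sum_sum_mul_le _ _).trans (mul_le_mul (frob_gradNet_hidden_le hs hr
        (HiddenClose.refl W hs.radius_nonneg) k) (u2' k) (frob_nonneg _) (by positivity))
    · rw [Finset.card_univ, Fintype.card_fin, nsmul_eq_mul]
  have a3 : |∑ i, (gradNet W z).2.2 i * U.2.2 i| ≤ √(m : ℝ) * (18 * ‖z‖) * r :=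
    (abs_dotProduct_le _ _).trans
      (mul_le_mul (l2_gradNet_last_le hs hr) u3' (l2_nonneg _) (by positivity))
  refine (abs_add_three _ _ _).trans ((add_le_add_three a1 a2 a3).trans ?_)
  have : 0 ≤ √(m : ℝ) * β * ‖z‖ * r := by positivity
  nlinarith

/-! ### The loss -/

lemma hasDerivAt_loss (x : ℝ) :
    HasDerivAt loss (-(Real.exp (-x) / (1 + Real.exp (-x)))) x := by
  have h1 : HasDerivAt (fun x : ℝ => 1 + Real.exp (-x)) (-Real.exp (-x)) x := by
    simpa using ((hasDerivAt_neg x).exp).const_add 1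
  have h2 := h1.log (by positivity)
  rw [neg_div] at h2
  exact h2

lemma abs_deriv_loss_le (x : ℝ) : |deriv loss x| ≤ 1 := by
  rw [(hasDerivAt_loss x).deriv, abs_neg, abs_of_nonneg (by positivity), div_le_one (by positivity)]
  linarith

lemma loss_nonneg (x : ℝ) : 0 ≤ loss x :=
  Real.log_nonneg (by linarith [Real.exp_pos (-x)])

/-- The source of the factor 4: log u ≥ 1 - 1/u at u = 1 + e^{-x} ≥ 4/3. -/
lemma one_le_four_mul_loss {x : ℝ} (hx : x ≤ 1) : 1 ≤ 4 * loss x := by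
  have h1 : (1 / 3 : ℝ) ≤ Real.exp (-1) := by
    rw [Real.exp_neg, ← one_div]
    exact one_div_le_one_div_of_le (Real.exp_pos 1) (by linarith [Real.exp_one_lt_d9])
  have h2 : Real.exp (-1) ≤ Real.exp (-x) := Real.exp_le_exp.2 (by linarith)
  have h3 := Real.one_sub_inv_le_log_of_pos (show 0 < 1 + Real.exp (-x) by positivity)
  have h4 : (1 + Real.exp (-x))⁻¹ ≤ (4 / 3)⁻¹ := inv_anti₀ (by norm_num) (by linarith)
  have : 1 - (4 / 3 : ℝ)⁻¹ = 1 / 4 := by norm_num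
  unfold loss
  linarith

/-- If a is misclassified and b is within 1 of a, then b has margin at most 1, where the loss is at
least 1/4. -/
lemma indicator_le_loss {y a b : ℝ} (hy : y = 1 ∨ y = -1) (h : |a - b| ≤ 1) :
    (if y * a < 0 then (1 : ℝ) else 0) ≤ 4 * loss (y * b) := by
  split_ifs with h0
  · have := abs_le.1 h
    refine one_le_four_mul_loss ?_
    rcases hy with rfl | rfl <;> linarith
  · exact mul_nonneg (by norm_num) (loss_nonneg _)

lemma frob_gradLoss_hidden_le (hs : SmallRadius m H q K β t ω) (hr : RegularAt W z q K β t)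
    (hc : HiddenClose W ω W') {y Z : ℝ} (hy : y = 1 ∨ y = -1) (hz : ‖z‖ ≤ Z) (k : Fin H) :
    frob ((gradLoss W' z y).2.1 k) ≤ √(m : ℝ) * (2 * β * (18 * Z)) := by
  have hβ := hs.out_nonneg
  have e : (gradLoss W' z y).2.1 k = (deriv loss (y * net W' z) * y) • (gradNet W' z).2.1 k := rfl
  have hy' : |y| = 1 := by rcases hy with rfl | rfl <;> simp
  rw [e, frob_smul, abs_mul, hy', mul_one]
  refine (mul_le_of_le_one_left (frob_nonneg _) (abs_deriv_loss_le _)).trans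
    ((frob_gradNet_hidden_le hs hr hc k).trans ?_)
  gcongr

/-! ### The iterates -/

variable {n B : ℕ} {x : Fin n → EuclideanSpace ℝ (Fin d)} {y : Fin n → ℝ}
  {ξ : Fin n → EuclideanSpace ℝ (Fin d)} {ξrep : Fin n → Fin B → Fin n → EuclideanSpace ℝ (Fin d)}
  {η Z : ℝ}

lemma iterate_succ (S : Schedule n B) (i : Fin n) :
    iterate x y ξ ξrep η W S i.succ = iterate x y ξ ξrep η W S i.castSucc -
      η • trained (gradLoss (iterate x y ξ ξrep η W S i.castSucc) (x i + ξ i) (y i) +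
        ∑ j, match S i j with
          | none => 0
          | some k => gradLoss (iterate x y ξ ξrep η W S i.castSucc) (x k + ξrep i j k) (y k)) := by
  rw [iterate, Fin.induction_succ]
  rfl

lemma hiddenClose_sub_smul_trained (hc : HiddenClose W ω W') {G : Weights d m H} {g : ℝ}
    (hη : 0 ≤ η) (hG : ∀ k, frob (G.2.1 k) ≤ g) :
    HiddenClose W (ω + η * g) (W' - η • trained G) where
  first_eq := by
    rw [← hc.first_eq]
    exact (congrArg (W'.1 - ·) (smul_zero η)).trans (sub_zero _)
  last_eq := by
    rw [← hc.last_eq]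
    exact (congrArg (W'.2.2 - ·) (smul_zero η)).trans (sub_zero _)
  frob_le k := by
    have e : (W' - η • trained G).2.1 k - W.2.1 k = (W'.2.1 k - W.2.1 k) + (-η) • G.2.1 k := by
      have : (W' - η • trained G).2.1 k = W'.2.1 k - η • G.2.1 k := rfl
      rw [this, neg_smul]; abel
    rw [e]
    refine (frob_add_le _ _).trans (add_le_add (hc.frob_le k) ?_)
    rw [frob_smul, abs_neg, abs_of_nonneg hη]
    exact mul_le_mul_of_nonneg_left (hG k) hη

lemma HiddenClose.mono (hc : HiddenClose W ω W') {ω' : ℝ} (h : ω ≤ ω') : HiddenClose W ω' W' :=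
  ⟨hc.first_eq, hc.last_eq, fun k => (hc.frob_le k).trans h⟩

/-- Gradients are bounded as long as the iterate is within ω of the start. Step i thus adds at most
η(B + 1)g to the distance, and n such steps fit into ω. The argument does not see which examples are
replayed. -/
theorem hiddenClose_iterate (hs : SmallRadius m H q K β t ω) (hη : 0 ≤ η) (hZ0 : 0 ≤ Z)
    (hy : ∀ i, y i = 1 ∨ y i = -1)
    (hr : ∀ i, RegularAt W (x i + ξ i) q K β t) (hZ : ∀ i, ‖x i + ξ i‖ ≤ Z)
    (hr' : ∀ i j k, RegularAt W (x k + ξrep i j k) q K β t)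
    (hZ' : ∀ i j k, ‖x k + ξrep i j k‖ ≤ Z)
    (hω : n * (η * ((B + 1) * (√(m : ℝ) * (2 * β * (18 * Z))))) ≤ ω) (S : Schedule n B)
    (i : Fin (n + 1)) : HiddenClose W ω (iterate x y ξ ξrep η W S i) := by
  have hβ := hs.out_nonneg
  set g : ℝ := √(m : ℝ) * (2 * β * (18 * Z)) with hg
  have hg0 : 0 ≤ g := by positivity
  have hle : ∀ i : Fin (n + 1), (i : ℝ) * (η * ((B + 1) * g)) ≤ ω := fun i => by
    have : ((i : ℕ) : ℝ) ≤ n := by exact_mod_cast Nat.lt_succ_iff.1 i.isLt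
    exact (mul_le_mul_of_nonneg_right this (by positivity)).trans hω
  suffices h : HiddenClose W (i * (η * ((B + 1) * g))) (iterate x y ξ ξrep η W S i) from
    h.mono (hle i)
  induction i using Fin.induction with
  | zero => exact (HiddenClose.refl W le_rfl).mono (by simp)
  | succ i ih =>
    have hc := ih.mono (hle _)
    rw [iterate_succ]
    refine (hiddenClose_sub_smul_trained ih (g := (B + 1) * g) hη fun k => ?_).mono (le_of_eq ?_)
    · set f : Fin B → Weights d m H := fun j => match S i j with
          | none => 0
          | some k => gradLoss (iterate x y ξ ξrep η W S i.castSucc) (x k + ξrep i j k) (y k) with hf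
      have e : (gradLoss (iterate x y ξ ξrep η W S i.castSucc) (x i + ξ i) (y i) +
          ∑ j, f j).2.1 k = (gradLoss (iterate x y ξ ξrep η W S i.castSucc) (x i + ξ i) (y i)).2.1 k +
            ∑ j, (f j).2.1 k := by
        simp [Prod.fst_sum, Prod.snd_sum, Finset.sum_apply]
      rw [e]
      refine (frob_add_le _ _).trans ((add_le_add (frob_gradLoss_hidden_le hs (hr i) hc (hy i) (hZ i) k)
        ((frob_sum_le _ _).trans (Finset.sum_le_card_nsmul _ _ g fun j _ => ?_))).trans_eq ?_)
      · simp only [hf]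
        cases S i j with
        | none => exact frob_zero.trans_le hg0
        | some l => exact frob_gradLoss_hidden_le hs (hr' i j l) hc (hy l) (hZ' i j l) k
      · rw [Finset.card_univ, Fintype.card_fin, nsmul_eq_mul]; ring
    · rw [Fin.val_succ, Fin.val_castSucc]; push_cast; ring

/-- If all the iterates and all the random feature functions of radius `r` are close to the initial
network, then the 0-1 error of the iterates is at most the loss of the random feature functions. -/
lemma expectedError_le_sInf (hn : 1 ≤ n) (hy : ∀ i, y i = 1 ∨ y i = -1) (S : Schedule n B) {r : ℝ}
    (hr : 0 ≤ r)
    (h1 : ∀ (i : Fin (n + 1)) s, |net (iterate x y ξ ξrep η W S i) (x s + ξ s) -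
      net W (x s + ξ s)| ≤ 1 / 2)
    (h2 : ∀ U ∈ nbhd (0 : Weights d m H) r, ∀ s, |innerW (gradNet W (x s + ξ s)) U| ≤ 1 / 2) :
    expectedError x y ξ ξrep η W S ≤
      sInf ((fun f => 4 / (n : ℝ) * ∑ t, loss (y t * f (x t + ξ t))) '' ntrf W r) := by
  have hn' : (0 : ℝ) < n := by exact_mod_cast hn
  -- The zero weights make the class nonempty; on an empty set the real infimum would be 0 by
  -- convention.
  have h0 : (0 : Weights d m H) ∈ nbhd (0 : Weights d m H) r := by
    refine ⟨?_, fun k => ?_, ?_⟩ <;> simpa using hr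
  refine le_csInf ⟨_, _, ⟨0, h0, rfl⟩, rfl⟩ ?_
  rintro _ ⟨f, ⟨U, hU, rfl⟩, rfl⟩
  simp only
  have hstep : ∀ i : Fin (n + 1), zeroOneError x y ξ (iterate x y ξ ξrep η W S i) ≤ 4 / (n : ℝ) *
      ∑ s, loss (y s * (net W (x s + ξ s) + innerW (gradNet W (x s + ξ s)) U)) := fun i => by
    rw [zeroOneError, div_mul_eq_mul_div, Finset.mul_sum]
    refine div_le_div_of_nonneg_right (Finset.sum_le_sum fun s _ => indicator_le_loss (hy s) ?_) hn'.le
    have a1 := abs_le.1 (h1 i s)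
    have a2 := abs_le.1 (h2 U hU s)
    exact abs_le.2 ⟨by linarith, by linarith⟩
  rw [expectedError, div_le_iff₀ (by positivity), mul_comm]
  refine (Finset.sum_le_card_nsmul _ _ _ fun i _ => hstep i).trans_eq ?_
  rw [Finset.card_univ, Fintype.card_fin, nsmul_eq_mul]

lemma expectedError_le_one (S : Schedule n B) : expectedError x y ξ ξrep η W S ≤ 1 := by
  have hstep : ∀ i : Fin (n + 1), zeroOneError x y ξ (iterate x y ξ ξrep η W S i) ≤ 1 := fun i => by
    rw [zeroOneError]
    refine div_le_one_of_le₀ ?_ (Nat.cast_nonneg _)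
    refine (Finset.sum_le_card_nsmul _ _ 1 fun s _ => ?_).trans_eq (by simp)
    split_ifs <;> norm_num
  rw [expectedError]
  refine div_le_one_of_le₀ ?_ (Nat.cast_nonneg _)
  refine (Finset.sum_le_card_nsmul _ _ _ fun i _ => hstep i).trans_eq (by simp)

lemma sInf_loss_nonneg (W : Weights d m H) (r : ℝ) :
    0 ≤ sInf ((fun f => 4 / (n : ℝ) * ∑ t, loss (y t * f (x t + ξ t))) '' ntrf W r) := by
  refine Real.sInf_nonneg ?_
  rintro _ ⟨f, _, rfl⟩
  exact mul_nonneg (by positivity) (Finset.sum_nonneg fun _ _ => loss_nonneg _)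

lemma bddAbove_pert : BddAbove ({r : ℝ | ∃ i, r = ‖ξ i‖ ^ 2} ∪ {r | ∃ i j k, r = ‖ξrep i j k‖ ^ 2}) := by
  refine Set.Finite.bddAbove ?_
  refine ((Set.finite_range fun i => ‖ξ i‖ ^ 2).union (Set.finite_range
    fun a : Fin n × Fin B × Fin n => ‖ξrep a.1 a.2.1 a.2.2‖ ^ 2)).subset ?_
  rintro r (⟨i, rfl⟩ | ⟨i, j, k, rfl⟩)
  exacts [Or.inl ⟨i, rfl⟩, Or.inr ⟨(i, j, k), rfl⟩]

lemma norm_sq_le_supPert (i : Fin n) : ‖ξ i‖ ^ 2 ≤ supPert ξ ξrep :=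
  le_csSup bddAbove_pert (Or.inl ⟨i, rfl⟩)

lemma norm_sq_rep_le_supPert (i : Fin n) (j : Fin B) (k : Fin n) :
    ‖ξrep i j k‖ ^ 2 ≤ supPert ξ ξrep :=
  le_csSup bddAbove_pert (Or.inr ⟨i, j, k, rfl⟩)

lemma norm_add_le_of_supPert {u v : EuclideanSpace ℝ (Fin d)} {Ξ : ℝ} (hu : ‖u‖ = 1)
    (hv : ‖v‖ ^ 2 ≤ Ξ) : ‖u + v‖ ≤ 2 * √(1 + Ξ) := by
  have h1 : ‖v‖ ≤ √(1 + Ξ) := Real.le_sqrt_of_sq_le (by linarith)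
  have h2 : 1 ≤ √(1 + Ξ) := Real.one_le_sqrt.2 (by linarith [sq_nonneg ‖v‖])
  exact (norm_add_le _ _).trans (by linarith)

end Training

/-! ## The choice of the parameters -/

/-- A bootstrap: m ≥ 2 gives log m ≥ 1/2, with which the width condition yields m ≥ 3 > e. -/
lemma one_le_log_of_le {m : ℕ} {c L : ℝ} (hm : 2 ≤ m) (hL : 2 ≤ L) (hc : 1 ≤ c)
    (h : c * L ^ 6 * Real.log m ^ 3 ≤ m) : 1 ≤ Real.log m := by
  have hm' : (2 : ℝ) ≤ m := by exact_mod_cast hm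
  have h2 : (1 / 2 : ℝ) ≤ Real.log m := by
    have := Real.log_two_gt_d9
    have := Real.log_le_log two_pos hm'
    linarith
  have h3 : (3 : ℝ) ≤ m := by
    refine le_trans ?_ h
    calc (3 : ℝ) ≤ 1 * 2 ^ 6 * (1 / 2) ^ 3 := by norm_num
      _ ≤ c * L ^ 6 * Real.log m ^ 3 := by gcongr
  rw [Real.le_log_iff_exp_le (by linarith)]
  linarith [Real.exp_one_lt_d9]

lemma nat_div_bounds (a b : ℕ) (hb : 0 < b) (h : b ≤ a) :
    (b : ℝ) * (a / b : ℕ) ≤ a ∧ (a : ℝ) ≤ 2 * b * (a / b : ℕ) := by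
  have h1 : b * (a / b) ≤ a := Nat.mul_div_le a b
  have h2 : a < b * (a / b + 1) := Nat.lt_mul_div_succ a hb
  have h3 : 1 ≤ a / b := Nat.div_pos h hb
  refine ⟨by exact_mod_cast h1, ?_⟩
  have : a ≤ 2 * b * (a / b) := by nlinarith
  exact_mod_cast this

/-- The override families, the factor (H + 1)² · 2N and the nets are each allotted e^{p/16}. Against
e^{-p/2} this leaves e^{-5p/16}, below e^{-q}. -/
lemma card_mul_exp_le {m H p q s N : ℕ} (hm : (2 : ℝ) ≤ m)
    (h1 : (q : ℝ) * (128 * (H * Real.log m)) ≤ p)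
    (h2 : ((H : ℝ) + 1) ^ 2 * N * 2 ≤ Real.exp (p / 16)) (h3 : 64 * (s : ℝ) ≤ p)
    (h4 : (q : ℝ) * 256 ≤ p) :
    (((m + 1) ^ (2 * q * H)) ^ 2 * (H + 1) ^ 2 * (N * 48 ^ s) : ℝ) * (2 * Real.exp (-p / 2)) ≤
      Real.exp (-q) := by
  have hexp : Real.exp (Real.log m) = m := Real.exp_log (by linarith)
  set ℓ := Real.log m
  have hp0 : (0 : ℝ) ≤ p := Nat.cast_nonneg p
  have a1 : (((m : ℝ) + 1) ^ (2 * q * H)) ^ 2 ≤ Real.exp (p / 16) := by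
    have e1 : (m : ℝ) + 1 ≤ Real.exp (2 * ℓ) := by
      rw [two_mul, Real.exp_add, hexp]; nlinarith
    calc (((m : ℝ) + 1) ^ (2 * q * H)) ^ 2 ≤ (Real.exp (2 * ℓ) ^ (2 * q * H)) ^ 2 := by gcongr
      _ = Real.exp (8 * q * H * ℓ) := by
          rw [← Real.exp_nat_mul, ← Real.exp_nat_mul]; push_cast; ring_nf
      _ ≤ Real.exp (p / 16) := Real.exp_le_exp.2 (by linarith)
  have a3 : (48 : ℝ) ^ s ≤ Real.exp (p / 16) := by
    have e4 : (48 : ℝ) ≤ Real.exp 4 := by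
      have : Real.exp 4 = Real.exp 1 ^ 4 := by rw [← Real.exp_nat_mul]; norm_num
      rw [this]
      calc (48 : ℝ) ≤ 2.7 ^ 4 := by norm_num
        _ ≤ Real.exp 1 ^ 4 := pow_le_pow_left₀ (by norm_num) (by linarith [Real.exp_one_gt_d9]) 4
    calc (48 : ℝ) ^ s ≤ Real.exp 4 ^ s := pow_le_pow_left₀ (by norm_num) e4 s
      _ = Real.exp (s * 4) := by rw [← Real.exp_nat_mul]
      _ ≤ Real.exp (p / 16) := Real.exp_le_exp.2 (by linarith)
  calc (((m : ℝ) + 1) ^ (2 * q * H)) ^ 2 * (H + 1) ^ 2 * (N * 48 ^ s) *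
        (2 * Real.exp (-p / 2)) = (((m : ℝ) + 1) ^ (2 * q * H)) ^ 2 *
          (((H : ℝ) + 1) ^ 2 * N * 2) * 48 ^ s * Real.exp (-p / 2) := by ring
    _ ≤ Real.exp (p / 16) * Real.exp (p / 16) * Real.exp (p / 16) * Real.exp (-p / 2) := by
        gcongr
    _ = Real.exp (p / 16 + p / 16 + p / 16 + -p / 2) := by simp only [Real.exp_add]
    _ ≤ Real.exp (-q) := Real.exp_le_exp.2 (by linarith)

-- With L = H + 2, p is about m/(64L), the largest value that the moment bound allows through the
-- depth. Then s ≈ p/64 makes the nets affordable and N is of order L. The choice q ≈ p/(128 L log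
-- m) pays for the m^{O(qL)} overrides and leaves q of order m/(L² log m).
set_option maxHeartbeats 800000 in
lemma exists_parameters {m H : ℕ} (hm : 2 ≤ m)
    (h : 2 ^ 40 * ((H : ℝ) + 2) ^ 6 * Real.log m ^ 3 ≤ m) :
    ∃ p q s N : ℕ, 64 * (H + 2) * p ≤ m ∧ 4 * H * q ≤ m ∧ 2 * q ≤ p ∧ 48 * (H + 1) ^ 2 * q ≤ m ∧
      0 < s ∧ m ≤ N * s ∧
      (((m + 1) ^ (2 * q * H)) ^ 2 * (H + 1) ^ 2 * (N * 48 ^ s) : ℝ) * (2 * Real.exp (-p / 2)) ≤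
        Real.exp (-q) ∧
      (m : ℝ) ≤ 2 ^ 15 * (H + 2) ^ 2 * Real.log m * q ∧ (N : ℝ) ≤ 2 ^ 15 * (H + 2) := by
  have hm' : (2 : ℝ) ≤ m := by exact_mod_cast hm
  have hH : (0 : ℝ) ≤ H := Nat.cast_nonneg H
  set L : ℝ := (H : ℝ) + 2 with hL
  have hL2 : 2 ≤ L := by linarith
  have hℓ := one_le_log_of_le hm hL2 (by norm_num) h
  set ℓ := Real.log m with hℓdef
  have hexp : Real.exp ℓ = m := Real.exp_log (by linarith)
  have hpow : ∀ a b : ℕ, a ≤ 6 → b ≤ 3 → 2 ^ 40 * L ^ a * ℓ ^ b ≤ m := fun a b ha hb => by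
    refine le_trans ?_ h
    have h1 : L ^ a ≤ L ^ 6 := pow_le_pow_right₀ (by linarith) ha
    have h2 : ℓ ^ b ≤ ℓ ^ 3 := pow_le_pow_right₀ hℓ hb
    gcongr
  have hL1 : 2 ^ 40 * L ≤ m := by simpa using hpow 1 0 (by norm_num) (by norm_num)
  have hbase : 64 * (H + 2) ≤ m := by
    have : (64 * ((H : ℝ) + 2)) ≤ m := by linarith
    exact_mod_cast this
  obtain ⟨p1, p2⟩ := nat_div_bounds m (64 * (H + 2)) (by positivity) hbase
  set p := m / (64 * (H + 2)) with hp
  push_cast at p1 p2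
  rw [← hL] at p1 p2
  have hLℓ : 2 ^ 40 * L ^ 2 * ℓ ≤ m := by simpa using hpow 2 1 (by norm_num) (by norm_num)
  have hpbig : 2 ^ 33 * (L * ℓ) ≤ p := by
    have : L * (2 ^ 33 * (L * ℓ)) ≤ L * p := by nlinarith
    exact le_of_mul_le_mul_left this (by linarith)
  have hLℓ1 : 2 ≤ L * ℓ := by nlinarith
  have hp64 : 64 ≤ p := by
    have : (64 : ℝ) ≤ p := by linarith
    exact_mod_cast this
  obtain ⟨s1, s2⟩ := nat_div_bounds p 64 (by norm_num) hp64
  set s := p / 64 with hs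
  push_cast at s1 s2
  have hs0 : 0 < s := Nat.div_pos hp64 (by norm_num)
  have hsm : s ≤ m := (Nat.div_le_self _ _).trans (Nat.div_le_self _ _)
  have hN1 : m ≤ (m / s + 1) * s := by
    rw [mul_comm]; exact (Nat.lt_mul_div_succ m hs0).le
  have hN2 : ((m / s + 1 : ℕ) : ℝ) ≤ 2 ^ 15 * L := by
    obtain ⟨n1, -⟩ := nat_div_bounds m s hs0 hsm
    have hs0' : (0 : ℝ) < s := by exact_mod_cast hs0
    have : (s : ℝ) * (m / s : ℕ) ≤ s * (2 ^ 14 * L) := by nlinarith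
    have := le_of_mul_le_mul_left this hs0'
    push_cast
    linarith
  set N := m / s + 1 with hN
  set q := ⌊(p : ℝ) / (128 * (L * ℓ))⌋₊ with hq
  have hden : 0 < 128 * (L * ℓ) := by linarith
  have q1 : (q : ℝ) * (128 * (L * ℓ)) ≤ p :=
    (le_div_iff₀ hden).1 (Nat.floor_le (by positivity))
  have q2 : (p : ℝ) ≤ 256 * (L * ℓ) * q := by
    have h1 : (p : ℝ) / (128 * (L * ℓ)) < q + 1 := Nat.lt_floor_add_one _
    rw [div_lt_iff₀ hden] at h1
    have h2 : (1 : ℝ) ≤ q := by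
      have : 1 ≤ q := Nat.le_floor (by rw [Nat.cast_one, le_div_iff₀ hden]; linarith)
      exact_mod_cast this
    nlinarith
  have hq0 : (0 : ℝ) ≤ q := Nat.cast_nonneg q
  have q3 : (q : ℝ) * 256 ≤ p := le_trans (by nlinarith) q1
  have q4 : (q : ℝ) * (128 * L) ≤ p := by
    refine le_trans ?_ q1
    refine mul_le_mul_of_nonneg_left ?_ hq0
    nlinarith
  have c1 : 64 * (H + 2) * p ≤ m := Nat.mul_div_le _ _
  have c4 : 48 * ((H : ℝ) + 1) ^ 2 * q ≤ m := by
    have h1 : ((H : ℝ) + 1) ^ 2 ≤ L ^ 2 := by rw [hL]; gcongr; norm_num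
    have h2 : 48 * ((H : ℝ) + 1) ^ 2 * q ≤ 48 * L ^ 2 * q := by gcongr
    have h3 : L * (q * (128 * L)) ≤ L * p := mul_le_mul_of_nonneg_left q4 (by linarith)
    have h4 : 0 ≤ L ^ 2 * q := by positivity
    nlinarith
  refine ⟨p, q, s, N, c1, ?_, ?_, by exact_mod_cast c4, hs0, hN1, ?_, ?_, hN2⟩
  · have h1 : 4 * (H : ℝ) * q ≤ 48 * ((H : ℝ) + 1) ^ 2 * q := by
      refine mul_le_mul_of_nonneg_right ?_ hq0
      nlinarith
    exact_mod_cast h1.trans c4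
  · have : 2 * (q : ℝ) ≤ p := by linarith
    exact_mod_cast this
  · refine card_mul_exp_le (by linarith) ?_ ?_ ?_ (by linarith)
    · refine le_trans ?_ q1
      gcongr
      linarith
    · have hℓp : ℓ ≤ p / 16 := by
        have : ℓ ≤ L * ℓ := le_mul_of_one_le_left (by linarith) (by linarith)
        linarith
      refine le_trans ?_ (hexp.symm.le.trans (Real.exp_le_exp.2 hℓp))
      calc ((H : ℝ) + 1) ^ 2 * N * 2 ≤ L ^ 2 * (2 ^ 15 * L) * 2 := by
            gcongr
            linarith
        _ = 2 ^ 16 * L ^ 3 := by ring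
        _ ≤ 2 ^ 40 * L ^ 3 * ℓ ^ 0 := by
            rw [pow_zero, mul_one]
            exact mul_le_mul_of_nonneg_right (by norm_num) (by positivity)
        _ ≤ m := hpow 3 0 (by norm_num) (by norm_num)
    · linarith
  · calc (m : ℝ) ≤ 2 * (64 * L) * p := p2
      _ ≤ 2 * (64 * L) * (256 * (L * ℓ) * q) := by gcongr
      _ = 2 ^ 15 * L ^ 2 * ℓ * q := by ring

/-- With high probability, the initialization is regular at finitely many inputs. -/
lemma exists_bad_set_of_family {d m H : ℕ} {ι : Type*} [Fintype ι]
    (z : ι → EuclideanSpace ℝ (Fin d)) (hm : 2 ≤ m)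
    (h : 2 ^ 40 * ((H : ℝ) + 2) ^ 6 * Real.log m ^ 3 ≤ m) :
    ∃ (q : ℕ) (K β : ℝ) (Bad : Set (Weights d m H)),
      (m : ℝ) ≤ 2 ^ 15 * (H + 2) ^ 2 * Real.log m * q ∧
      0 ≤ K ∧ K ^ 2 ≤ 2 ^ 21 * (H + 2) ∧ 0 ≤ β ∧ β ≤ 2 ^ 9 ∧
      initLaw d m H Bad ≤ ENNReal.ofReal (Fintype.card ι * (8 * (H + 1) * Real.exp (-q))) ∧
      ∀ W ∉ Bad, ∀ i, RegularAt W (z i) q K β (q / (7 * m)) := by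
  obtain ⟨p, q, s, N, c1, c2, c3, c4, c5, c6, c7, c8, c9⟩ := exists_parameters hm h
  have hm0 : 0 < m := by omega
  have hm' : (0 : ℝ) < m := by exact_mod_cast hm0
  -- The smallest ρ that the tail of the output row permits. Since ρ² ≤ 1/(16L) and N = O(L), the
  -- product ρ√N stays bounded: β does not grow with the depth although K grows like √L.
  set ρ : ℝ := √(4 * p / m) with hρ
  have hρ2 : ρ ^ 2 * m = 4 * p := by
    rw [hρ, Real.sq_sqrt (by positivity)]; field_simp
  have hbad : ∀ i, ∃ Bad : Set (Weights d m H),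
      initLaw d m H Bad ≤ ENNReal.ofReal (8 * (H + 1) * Real.exp (-q)) ∧
      ∀ W ∉ Bad, RegularAt W (z i) q (2 * 3 * √(N : ℝ)) (2 * (ρ * 3) * √(N : ℝ)) (q / (7 * m)) := by
    intro i
    rcases eq_or_ne (z i) 0 with hz | hz
    · exact ⟨∅, by simp, fun W _ => Or.inl hz⟩
    · obtain ⟨Bad, h1, h2⟩ := exists_bad_set (z i) p q s N hm0 (norm_pos_iff.2 hz) c1 c2 c3 c4 c5 c6
        (t := q / (7 * m)) (ρ := ρ) (by positivity) (by field_simp; rfl) (Real.sqrt_nonneg _)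
        hρ2.ge c7
      exact ⟨Bad, h1, fun W hW => Or.inr (h2 W hW)⟩
  choose Bad hB1 hB2 using hbad
  refine ⟨q, 2 * 3 * √(N : ℝ), 2 * (ρ * 3) * √(N : ℝ), ⋃ i ∈ (Finset.univ : Finset ι), Bad i, c8,
    by positivity, ?_, by positivity, ?_, ?_, ?_⟩
  · rw [mul_pow, Real.sq_sqrt (Nat.cast_nonneg _)]
    have : (0 : ℝ) ≤ H := Nat.cast_nonneg H
    linarith
  · refine abs_le_of_sq_le_sq' ?_ (by norm_num) |>.2
    rw [mul_pow, Real.sq_sqrt (Nat.cast_nonneg _)]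
    have hL : (0 : ℝ) < (H : ℝ) + 2 := by positivity
    have h1 : 64 * ((H : ℝ) + 2) * p ≤ m := by exact_mod_cast c1
    have h2 : (ρ ^ 2 * (16 * ((H : ℝ) + 2))) * m ≤ 1 * m := by nlinarith
    have h3 := le_of_mul_le_mul_right h2 hm'
    have h4 : ρ ^ 2 * N ≤ ρ ^ 2 * (2 ^ 15 * (H + 2)) := by gcongr
    nlinarith
  · refine (measure_biUnion_le_card _ _ _ fun i _ => hB1 i).trans_eq ?_
    rw [Finset.card_univ, ENNReal.ofReal_mul (Nat.cast_nonneg _), ENNReal.ofReal_natCast]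
  · intro W hW i
    refine hB2 i W fun h => hW ?_
    exact Set.mem_biUnion (Finset.mem_univ i) h

/-- The radius reached by the training is small. -/
lemma smallRadius_of_le {m H q : ℕ} {K β ω ℓ : ℝ} (hm : 0 < m) (hℓ : 1 ≤ ℓ) (hK : 0 ≤ K)
    (hK2 : K ^ 2 ≤ 2 ^ 21 * (H + 2)) (hβ : 0 ≤ β)
    (hq : (m : ℝ) ≤ 2 ^ 15 * (H + 2) ^ 2 * ℓ * q) (hω : 0 ≤ ω)
    (hωL : 2 ^ 54 * ((H : ℝ) + 2) ^ 6 * ℓ ^ 3 * ω ≤ 1) :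
    SmallRadius m H q K β (q / (7 * m)) ω := by
  have hm' : (0 : ℝ) < m := by exact_mod_cast hm
  have hH : (0 : ℝ) ≤ H := Nat.cast_nonneg H
  set L : ℝ := (H : ℝ) + 2 with hL
  have hL2 : 2 ≤ L := by linarith
  have hq0 : (0 : ℝ) < q := by
    by_contra hneg
    have : (q : ℝ) = 0 := le_antisymm (not_lt.1 hneg) (Nat.cast_nonneg q)
    rw [this, mul_zero] at hq
    linarith
  have hx : 0 ≤ L ^ 6 * ℓ ^ 3 * ω := by positivity
  have hKL : K ≤ 2 ^ 11 * L := by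
    refine abs_le_of_sq_le_sq' ?_ (by positivity) |>.2
    nlinarith
  have hK2H : K * (H * K) + 1 ≤ 2 ^ 22 * L ^ 2 := by
    have : K ^ 2 * H ≤ 2 ^ 21 * L * L := mul_le_mul hK2 (by linarith) hH (by positivity)
    nlinarith
  refine ⟨hm, hK, hβ, by positivity, hω, ?_, ?_⟩
  · have h1 : 2 * H * K * ω ≤ 2 * L * (2 ^ 11 * L) * ω := by gcongr; linarith
    have h2 : L ^ 2 * 1 ≤ L ^ 6 * ℓ ^ 3 :=
      mul_le_mul (pow_le_pow_right₀ (by linarith) (by norm_num)) (one_le_pow₀ hℓ) (by norm_num)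
        (by positivity)
    have h3 := mul_le_mul_of_nonneg_right h2 hω
    nlinarith
  · have e1 : (K * (H * K * ω * 18) + ω * 18) ^ 2 * (4 * m) ≤ (2 ^ 27 * L ^ 2 * ω) ^ 2 * (4 * m) := by
      have : K * (H * K * ω * 18) + ω * 18 ≤ 2 ^ 27 * L ^ 2 * ω := by
        have := mul_le_mul_of_nonneg_right hK2H (show 0 ≤ 18 * ω by positivity)
        have h4 : 0 ≤ L ^ 2 * ω := by positivity
        nlinarith
      gcongr
    refine e1.trans ?_
    -- With t = q/(7m), the condition on flips is of the form L⁴ω²m³ ≲ q³. The lower bound on q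
    -- turns it into L¹⁰ℓ³ω² ≲ 1, which the hypothesis on ω implies with room to spare.
    have e2 : (q : ℝ) * (q / (7 * m)) ^ 2 = q ^ 3 / (49 * m ^ 2) := by
      field_simp; norm_num
    rw [e2, le_div_iff₀ (by positivity)]
    have e3 : (m : ℝ) ^ 3 ≤ (2 ^ 15 * L ^ 2 * ℓ * q) ^ 3 := by gcongr
    have e4 : (2 ^ 54 * L ^ 6 * ℓ ^ 3 * ω) ^ 2 ≤ 1 := pow_le_one₀ (by positivity) hωL
    have e5 : L ^ 10 * ℓ ^ 3 ≤ L ^ 12 * ℓ ^ 6 :=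
      mul_le_mul (pow_le_pow_right₀ (by linarith) (by norm_num))
        (pow_le_pow_right₀ hℓ (by norm_num)) (by positivity) (by positivity)
    calc (2 ^ 27 * L ^ 2 * ω) ^ 2 * (4 * m) * (49 * m ^ 2) =
          2 ^ 56 * 49 * L ^ 4 * ω ^ 2 * m ^ 3 := by ring
      _ ≤ 2 ^ 56 * 49 * L ^ 4 * ω ^ 2 * (2 ^ 15 * L ^ 2 * ℓ * q) ^ 3 := by gcongr
      _ = 2 ^ 101 * 49 * (L ^ 10 * ℓ ^ 3) * ω ^ 2 * q ^ 3 := by ring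
      _ ≤ 2 ^ 101 * 49 * (L ^ 12 * ℓ ^ 6) * ω ^ 2 * q ^ 3 := by gcongr
      _ = 49 * 2⁻¹ ^ 7 * (2 ^ 54 * L ^ 6 * ℓ ^ 3 * ω) ^ 2 * q ^ 3 := by ring
      _ ≤ 1 * 1 * (q : ℝ) ^ 3 := by
          refine mul_le_mul_of_nonneg_right ?_ (by positivity)
          exact mul_le_mul (by norm_num) e4 (by positivity) (by norm_num)
      _ = q ^ 3 := by ring

/-! ## The error bound -/

instance (d m H : ℕ) : IsProbabilityMeasure (initLaw d m H) := by
  unfold initLaw; infer_instance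

instance (d m H n B C : ℕ) : IsProbabilityMeasure (trainLaw d m H n B C) := by
  unfold trainLaw; infer_instance

/-- An event that holds for all replay schedules outside a bad set of initializations. -/
lemma le_trainLaw_of_bad {d m H n B C : ℕ} {s : Set (Weights d m H × Schedule n B)}
    {Bad : Set (Weights d m H)} {δ : ℝ} (hδ : 0 ≤ δ) (hBad : initLaw d m H Bad ≤ ENNReal.ofReal δ)
    (h : ∀ W ∉ Bad, ∀ S, (W, S) ∈ s) : ENNReal.ofReal (1 - δ) ≤ trainLaw d m H n B C s := by
  have hcover : (Set.univ : Set (Weights d m H × Schedule n B)) ⊆ s ∪ Prod.fst ⁻¹' Bad := by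
    rintro ⟨W, S⟩ -
    by_cases hW : W ∈ Bad
    · exact Or.inr hW
    · exact Or.inl (h W hW S)
  rw [ENNReal.ofReal_sub _ hδ, ENNReal.ofReal_one, tsub_le_iff_right,
    ← measure_univ (μ := trainLaw d m H n B C)]
  exact (measure_mono hcover).trans ((measure_union_le _ _).trans
    (add_le_add le_rfl (measure_prod_le_of_fst.trans hBad)))

/-- The number of inputs is at most m² and 8(H + 1) ≤ m, so the prefactor is at most m³ = e^{3ℓ}. As
q is at least of order m/(L²ℓ), hence of order nBL⁴ℓ², it exceeds n/2 + 3ℓ. -/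
lemma failure_le {m H n B q : ℕ} {ℓ : ℝ} (hm : 2 ≤ m) (hn : 1 ≤ n) (hℓ : ℓ = Real.log m)
    (hℓ1 : 1 ≤ ℓ) (hq : (m : ℝ) ≤ 2 ^ 15 * (H + 2) ^ 2 * ℓ * q)
    (hN : 2 ^ 80 * (n * B * ((H : ℝ) + 2) ^ 6 * ℓ ^ 3) ≤ m) (hB : 1 ≤ B) :
    ((n + n * (B * n) : ℕ) : ℝ) * (8 * (H + 1) * Real.exp (-q)) ≤ Real.exp (-(n / 2)) := by
  have hm' : (2 : ℝ) ≤ m := by exact_mod_cast hm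
  have hn' : (1 : ℝ) ≤ n := by exact_mod_cast hn
  have hB' : (1 : ℝ) ≤ B := by exact_mod_cast hB
  have hH : (0 : ℝ) ≤ H := Nat.cast_nonneg H
  set L : ℝ := (H : ℝ) + 2 with hL
  have hL1 : 1 ≤ L := by linarith
  have hexp : Real.exp ℓ = m := by rw [hℓ]; exact Real.exp_log (by linarith)
  have hnB : (1 : ℝ) ≤ n * B := one_le_mul_of_one_le_of_one_le hn' hB'
  have hLℓ : 1 ≤ L ^ 6 * ℓ ^ 3 :=
    one_le_mul_of_one_le_of_one_le (one_le_pow₀ hL1) (one_le_pow₀ hℓ1)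
  have b1 : 2 ^ 80 * ((n : ℝ) * B) ≤ m := by
    refine le_trans ?_ hN
    have : (n : ℝ) * B * 1 ≤ n * B * (L ^ 6 * ℓ ^ 3) := by gcongr
    linarith
  have b2 : 2 ^ 80 * L ≤ m := by
    refine le_trans ?_ hN
    have h1 : L ^ 1 * 1 ≤ L ^ 6 * ℓ ^ 3 :=
      mul_le_mul (pow_le_pow_right₀ hL1 (by norm_num)) (one_le_pow₀ hℓ1) (by norm_num)
        (by positivity)
    have h2 : 1 * (L ^ 1 * 1) ≤ n * B * (L ^ 6 * ℓ ^ 3) :=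
      mul_le_mul hnB h1 (by positivity) (by positivity)
    linarith
  have b3 : (n : ℝ) ≤ n * B := le_mul_of_one_le_right (by linarith) hB'
  have c1 : ((n + n * (B * n) : ℕ) : ℝ) ≤ m ^ 2 := by
    push_cast
    have h1 : (n : ℝ) * (2 * B * n) ≤ m * m := by
      refine mul_le_mul (by linarith) (by linarith) (by positivity) (by linarith)
    nlinarith
  have c2 : 8 * ((H : ℝ) + 1) ≤ m := by linarith
  have hqbig : (n : ℝ) / 2 + 3 * ℓ ≤ q := by
    have h1 : (2 ^ 15 * L ^ 2 * ℓ) * (2 ^ 65 * (n * B * L ^ 4 * ℓ ^ 2)) ≤ (2 ^ 15 * L ^ 2 * ℓ) * q := by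
      refine le_trans (le_of_eq ?_) (hN.trans hq)
      ring
    have h2 := le_of_mul_le_mul_left h1 (by positivity)
    have h3 : (n : ℝ) * B * 1 * ℓ ≤ n * B * L ^ 4 * ℓ ^ 2 := by
      gcongr
      · exact one_le_pow₀ hL1
      · nlinarith
    have h4 : (n : ℝ) ≤ n * B * 1 * ℓ := by nlinarith
    have h5 : ℓ ≤ n * B * 1 * ℓ := by nlinarith
    linarith
  calc ((n + n * (B * n) : ℕ) : ℝ) * (8 * (H + 1) * Real.exp (-q)) ≤
        m ^ 2 * (m * Real.exp (-q)) := by gcongr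
    _ = Real.exp (3 * ℓ) * Real.exp (-q) := by
        have : Real.exp (3 * ℓ) = Real.exp ℓ ^ 3 := by rw [← Real.exp_nat_mul]; norm_num
        rw [this, hexp]; ring
    _ = Real.exp (3 * ℓ - q) := by rw [← Real.exp_add]; rfl
    _ ≤ Real.exp (-(n / 2)) := Real.exp_le_exp.2 (by linarith)

/-- The deviation of the trained network from its initialization is at most `1 / 2`. -/
lemma drift_le {M L ℓ X N₀ β κ Z H : ℝ} (hM : 0 < M) (hH0 : 0 ≤ H) (hH : H ≤ L) (hX : 0 ≤ X)
    (hβ0 : 0 ≤ β) (hβ : β ≤ 2 ^ 9) (hκ : 0 < κ) (hN : 0 ≤ N₀) (hZ0 : 0 ≤ Z) (hZ : Z ≤ 2 * X)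
    (h1 : N₀ * X ^ 2 ≤ L ^ 4 * ℓ ^ 3) (h2 : 2 ^ 80 * (1 + κ) ^ 2 * (N₀ * L ^ 6 * ℓ ^ 3) ≤ M) :
    √M * (H * (β * (2 ^ 17 * κ * N₀ / M * (18 * Z)))) ≤ 1 / 2 := by
  have hL : 0 ≤ L := hH0.trans hH
  have hD : 0 < √M := Real.sqrt_pos.2 hM
  -- Squared: κ²L²N₀²X² ≤ κ²N₀L⁶ℓ³ by `h1`, and the width hypothesis bounds this by M. The bound
  -- `h1` comes from the case of a nontrivial right-hand side.
  have key : 2 ^ 33 * κ * L * N₀ * X ≤ √M := by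
    refine Real.le_sqrt_of_sq_le (le_trans ?_ h2)
    have e : (2 ^ 33 * κ * L * N₀ * X) ^ 2 = 2 ^ 66 * κ ^ 2 * (N₀ * L ^ 2 * (N₀ * X ^ 2)) := by ring
    rw [e]
    have h3 : N₀ * L ^ 2 * (N₀ * X ^ 2) ≤ N₀ * L ^ 2 * (L ^ 4 * ℓ ^ 3) :=
      mul_le_mul_of_nonneg_left h1 (by positivity)
    have h4 : N₀ * L ^ 2 * (L ^ 4 * ℓ ^ 3) = N₀ * L ^ 6 * ℓ ^ 3 := by ring
    have h5 : 0 ≤ N₀ * L ^ 2 * (N₀ * X ^ 2) := by positivity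
    refine mul_le_mul ?_ (h3.trans_eq h4) h5 (by positivity)
    have : κ ^ 2 ≤ (1 + κ) ^ 2 := by gcongr; linarith
    linarith [sq_nonneg κ, sq_nonneg (1 + κ)]
  calc √M * (H * (β * (2 ^ 17 * κ * N₀ / M * (18 * Z)))) ≤
        √M * (L * (2 ^ 9 * (2 ^ 17 * κ * N₀ / M * (18 * (2 * X))))) := by gcongr
    _ = (36 * 2 ^ 26 * κ * L * N₀ * X) * (√M / M) := by ring
    _ ≤ (√M / 2) * (√M / M) := by
        refine mul_le_mul_of_nonneg_right ?_ (by positivity)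
        have : 0 ≤ κ * L * N₀ * X := by positivity
        linarith
    _ = 1 / 2 := by
        rw [div_mul_div_comm, Real.mul_self_sqrt hM.le, mul_comm, div_mul_cancel_left₀ hM.ne', one_div]

/-- The linear part of a random feature function is at most `1 / 2`. -/
lemma feature_le {M L ℓ X N₀ β κ Z H R : ℝ} (hM : 0 < M) (hH0 : 0 ≤ H) (hH : H + 2 = L)
    (hX : 0 ≤ X) (hβ : β ≤ 2 ^ 9) (hκ : 0 < κ) (hZ : Z ≤ 2 * X) (hβ0 : 0 ≤ β) (hR : 0 ≤ R)
    (h1 : R ^ 2 * X ^ 2 ≤ N₀ * (L ^ 4 * ℓ ^ 3))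
    (h2 : 2 ^ 80 * (1 + κ) ^ 2 * (N₀ * L ^ 6 * ℓ ^ 3) ≤ M) :
    R / M * √M * Z * (36 * β * (H + 1) + 18) ≤ 1 / 2 := by
  have hD : 0 < √M := Real.sqrt_pos.2 hM
  have hL : 0 ≤ L := by linarith
  -- Squared: L²R²X² ≤ N₀L⁶ℓ³ by `h1`, which the width hypothesis bounds by M.
  have key : 2 ^ 17 * R * X * L ≤ √M := by
    refine Real.le_sqrt_of_sq_le (le_trans ?_ h2)
    have e : (2 ^ 17 * R * X * L) ^ 2 = 2 ^ 34 * (L ^ 2 * (R ^ 2 * X ^ 2)) := by ring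
    rw [e]
    have h3 : L ^ 2 * (R ^ 2 * X ^ 2) ≤ L ^ 2 * (N₀ * (L ^ 4 * ℓ ^ 3)) :=
      mul_le_mul_of_nonneg_left h1 (by positivity)
    have h4 : L ^ 2 * (N₀ * (L ^ 4 * ℓ ^ 3)) = N₀ * L ^ 6 * ℓ ^ 3 := by ring
    refine mul_le_mul ?_ (h3.trans_eq h4) (by positivity) (by positivity)
    nlinarith
  have hb : 36 * β * (H + 1) + 18 ≤ 2 ^ 15 * L := by nlinarith
  calc R / M * √M * Z * (36 * β * (H + 1) + 18) ≤ R / M * √M * (2 * X) * (2 ^ 15 * L) := by gcongr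
    _ = (2 ^ 16 * R * X * L) * (√M / M) := by ring
    _ ≤ (√M / 2) * (√M / M) := by
        refine mul_le_mul_of_nonneg_right ?_ (by positivity)
        linarith
    _ = 1 / 2 := by
        rw [div_mul_div_comm, Real.mul_self_sqrt hM.le, mul_comm, div_mul_cancel_left₀ hM.ne', one_div]

/-- The step size turns the factor √M of the gradient into κ/M, so n steps with at most B + 1 ≤ 2B
gradients each travel a distance of order κnBX/M. -/
lemma step_sum_le {M X β κ η n B Z : ℝ} (hM : 0 < M) (hκ : 0 < κ) (hη : η ≤ κ * M ^ (-(3 / 2) : ℝ))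
    (hn : 0 ≤ n) (hB : 1 ≤ B) (hβ0 : 0 ≤ β) (hβ : β ≤ 2 ^ 9) (hX : 0 ≤ X) (hZ : Z = 2 * X) :
    n * (η * ((B + 1) * (√M * (2 * β * (18 * Z))))) ≤ 2 ^ 17 * κ * (n * B * X) / M := by
  have e : M ^ (-(3 / 2) : ℝ) * √M = M⁻¹ := by
    rw [Real.sqrt_eq_rpow, ← Real.rpow_add hM, ← Real.rpow_neg_one]
    norm_num
  have h1 : η * √M ≤ κ * M⁻¹ := by
    rw [← e, ← mul_assoc]
    exact mul_le_mul_of_nonneg_right hη (Real.sqrt_nonneg _)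
  have h0 : 0 ≤ κ * M⁻¹ := by positivity
  calc n * (η * ((B + 1) * (√M * (2 * β * (18 * Z))))) =
        (η * √M) * (n * ((B + 1) * (2 * β * (18 * (2 * X))))) := by rw [hZ]; ring
    _ ≤ (κ * M⁻¹) * (n * ((2 * B) * (2 * 2 ^ 9 * (18 * (2 * X))))) := by
        gcongr
        linarith
    _ = 73728 * (κ * M⁻¹ * (n * B * X)) := by ring
    _ ≤ 2 ^ 17 * (κ * M⁻¹ * (n * B * X)) :=
        mul_le_mul_of_nonneg_right (by norm_num) (by positivity)
    _ = 2 ^ 17 * κ * (n * B * X) / M := by ring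

/-- What the bound says when its right-hand side is below one. -/
lemma moment_bounds {Ξ L ℓ n B R : ℝ} (hΞ : 0 ≤ Ξ) (hn : 1 ≤ n) (hB : 1 ≤ B) (hL : 0 < L)
    (hℓ : 0 < ℓ) (h : ((1 + Ξ) ^ (3 / 4 : ℝ) * √B * n + R ^ 2) / (L ^ 2 * ℓ ^ (3 / 2 : ℝ)) < 1) :
    n * B * √(1 + Ξ) * √(1 + Ξ) ^ 2 ≤ L ^ 4 * ℓ ^ 3 ∧
      R ^ 2 * √(1 + Ξ) ^ 2 ≤ n * B * √(1 + Ξ) * (L ^ 4 * ℓ ^ 3) := by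
  rw [div_lt_one (by positivity)] at h
  set X := √(1 + Ξ) with hX
  set G := (1 + Ξ) ^ (3 / 4 : ℝ) with hG
  set T := L ^ 2 * ℓ ^ (3 / 2 : ℝ) with hT
  have hX1 : 1 ≤ X := Real.one_le_sqrt.2 (by linarith)
  -- This fits the exponents 3/4 and 3/2: squaring the first summand gives X³Bn² ≤ L⁴ℓ³, and n · B ·
  -- X · X² is at most X³Bn².
  have hG2 : G ^ 2 = X ^ 3 := by
    rw [hG, hX, Real.sqrt_eq_rpow, ← Real.rpow_natCast, ← Real.rpow_natCast,
      ← Real.rpow_mul (by linarith), ← Real.rpow_mul (by linarith)]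
    norm_num
  have hT2 : T ^ 2 = L ^ 4 * ℓ ^ 3 := by
    have : (ℓ ^ (3 / 2 : ℝ)) ^ 2 = ℓ ^ 3 := by
      rw [← Real.rpow_natCast, ← Real.rpow_natCast, ← Real.rpow_mul hℓ.le]
      norm_num
    rw [hT, mul_pow, this]; ring
  have hG0 : 0 ≤ G := Real.rpow_nonneg (by linarith) _
  have hXG : X ≤ G := by
    refine le_of_sq_le_sq ?_ hG0
    rw [hG2]; exact pow_le_pow_right₀ hX1 (by norm_num)
  have hsB : 1 ≤ √B := Real.one_le_sqrt.2 hB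
  have hT0 : 0 ≤ T := by positivity
  have a1 : G * √B * n ≤ T := by linarith [sq_nonneg R]
  have a2 : R ^ 2 ≤ T := by linarith [show 0 ≤ G * √B * n by positivity]
  have a3 : X ≤ T := by
    refine le_trans ?_ a1
    calc X ≤ G * 1 * 1 := by linarith
      _ ≤ G * √B * n := by gcongr
  rw [← hT2]
  constructor
  · have b1 : (G * √B * n) ^ 2 ≤ T ^ 2 := by gcongr
    have b2 : (G * √B * n) ^ 2 = X ^ 3 * B * n ^ 2 := by
      rw [mul_pow, mul_pow, hG2, Real.sq_sqrt (by linarith)]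
    have b3 : X ^ 3 * B * n ≤ X ^ 3 * B * n ^ 2 := by
      refine mul_le_mul_of_nonneg_left ?_ (by positivity)
      nlinarith
    linarith
  · have b1 : X ≤ n * B * X :=
      le_mul_of_one_le_left (by linarith) (one_le_mul_of_one_le_of_one_le hn hB)
    calc R ^ 2 * X ^ 2 = R ^ 2 * (X * X) := by ring
      _ ≤ T * (n * B * X * T) := by gcongr
      _ = n * B * X * T ^ 2 := by ring

end StreamNet

end

/-! ### Assembly of the theorem -/

open StreamNet in
theorem theorem1 :
    ∀ κ : ℝ, 0 < κ → ∃ C₁ : ℝ, 0 < C₁ ∧ ∃ C₂ : ℝ, 0 < C₂ ∧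
      ∀ (d m L n B C : ℕ), 2 ≤ m → 2 ≤ L → 1 ≤ n → 1 ≤ B →
      ∀ (x : Fin n → EuclideanSpace ℝ (Fin d)) (y : Fin n → ℝ) (lam : ℝ),
        (∀ t, y t = 1 ∨ y t = -1) →
        (∀ t, ‖x t‖ = 1) →
        0 < lam → (∀ i j, i ≠ j → lam ≤ ‖x i - x j‖) →
      ∀ (ξ : Fin n → EuclideanSpace ℝ (Fin d))
        (ξrep : Fin n → Fin B → Fin n → EuclideanSpace ℝ (Fin d)) (Ξ : ℝ),
        Ξ = supPert ξ ξrep →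
        C₁ * (n * B * √(1 + Ξ) * (L : ℝ) ^ 6 * Real.log m ^ 3) ≤ m →
      ∀ (η : ℝ), 0 < η → η ≤ κ * (m : ℝ) ^ (-(3 / 2) : ℝ) →
      ∀ (R : ℝ), 0 < R → ∀ (δ : ℝ), 0 < δ → δ < 1 →
        ENNReal.ofReal (1 - δ) ≤
          trainLaw d m (L - 2) n B C
            {p | expectedError x y ξ ξrep η p.1 p.2 ≤
              sInf ((fun f => 4 / (n : ℝ) * ∑ t, loss (y t * f (x t + ξ t))) '' ntrf p.1 (R / m))
              + √(2 * Real.log (1 / δ) / n)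
              + C₂ * (((1 + Ξ) ^ (3 / 4 : ℝ) * √(B : ℝ) * n + R ^ 2) /
                  ((L : ℝ) ^ 2 * Real.log m ^ (3 / 2 : ℝ)))} := by
  intro κ hκ
  -- C₁ is quadratic in κ because the output drift, of order κ/√m, must be at most 1/2. C₂ = 1
  -- suffices since the last term only separates the trivial from the nontrivial case.
  refine ⟨2 ^ 80 * (1 + κ) ^ 2, by positivity, 1, one_pos, ?_⟩
  intro d m L n B C hm hL hn hB x y lam hy hx _ _ ξ ξrep Ξ hΞ hm1 η hη hηκ R hR δ hδ hδ1
  obtain ⟨H, rfl⟩ : ∃ H, L = H + 2 := ⟨L - 2, by omega⟩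
  rw [Nat.add_sub_cancel]
  have hLcast : ((H + 2 : ℕ) : ℝ) = (H : ℝ) + 2 := by push_cast; rfl
  simp only [hLcast] at hm1 ⊢
  have hm0 : 0 < m := by omega
  have hm' : (0 : ℝ) < m := by exact_mod_cast hm0
  have hn' : (1 : ℝ) ≤ n := by exact_mod_cast hn
  have hB' : (1 : ℝ) ≤ B := by exact_mod_cast hB
  have hH : (0 : ℝ) ≤ H := Nat.cast_nonneg H
  have hΞ0 : 0 ≤ Ξ := hΞ ▸ (sq_nonneg _).trans (norm_sq_le_supPert (⟨0, hn⟩ : Fin n))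
  have hX1 : 1 ≤ √(1 + Ξ) := Real.one_le_sqrt.2 (by linarith)
  set E₁ := √(2 * Real.log (1 / δ) / n) with hE₁
  set E₂ := ((1 + Ξ) ^ (3 / 4 : ℝ) * √(B : ℝ) * n + R ^ 2) /
    (((H : ℝ) + 2) ^ 2 * Real.log m ^ (3 / 2 : ℝ)) with hE₂
  have hℓ0 : 0 < Real.log m := Real.log_pos (by exact_mod_cast hm)
  have hE₁0 : 0 ≤ E₁ := Real.sqrt_nonneg _
  have hE₂0 : 0 ≤ E₂ := by
    have : 0 ≤ (1 + Ξ) ^ (3 / 4 : ℝ) := Real.rpow_nonneg (by linarith) _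
    positivity
  -- If the two error terms already sum to 1, the bound holds for every initialization and schedule.
  rcases le_or_gt 1 (E₁ + E₂) with htriv | hlt
  · refine le_trainLaw_of_bad (Bad := ∅) hδ.le (by simp) fun W _ S => ?_
    change expectedError x y ξ ξrep η W S ≤ _
    have h1 := expectedError_le_one (x := x) (y := y) (ξ := ξ) (ξrep := ξrep) (η := η) (W := W) S
    have h2 := sInf_loss_nonneg (x := x) (y := y) (ξ := ξ) W (R / m)
    linarith
  have hnBX : (1 : ℝ) ≤ n * B := one_le_mul_of_one_le_of_one_le hn' hB'
  have hκ1 : (1 : ℝ) ≤ (1 + κ) ^ 2 := one_le_pow₀ (by linarith)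
  have hbase : 2 ^ 80 * (n * B * ((H : ℝ) + 2) ^ 6 * Real.log m ^ 3) ≤ m := by
    refine le_trans ?_ hm1
    have h1 : n * B * 1 * ((H : ℝ) + 2) ^ 6 * Real.log m ^ 3 ≤
      n * B * √(1 + Ξ) * ((H : ℝ) + 2) ^ 6 * Real.log m ^ 3 := by gcongr
    rw [mul_one] at h1
    exact mul_le_mul (by linarith) h1 (by positivity) (by positivity)
  have hbase' : 2 ^ 80 * ((H : ℝ) + 2) ^ 6 * Real.log m ^ 3 ≤ m := by
    refine le_trans ?_ hbase
    have h1 : 1 * (((H : ℝ) + 2) ^ 6 * Real.log m ^ 3) ≤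
      n * B * (((H : ℝ) + 2) ^ 6 * Real.log m ^ 3) := by gcongr
    linarith
  have hbase40 : 2 ^ 40 * ((H : ℝ) + 2) ^ 6 * Real.log m ^ 3 ≤ m := by
    refine le_trans ?_ hbase'
    gcongr
    · norm_num
    · norm_num
  have hℓ1 : 1 ≤ Real.log m := one_le_log_of_le hm (by linarith) (by norm_num) hbase'
  obtain ⟨hmom1, hmom2⟩ := moment_bounds (R := R) hΞ0 hn' hB' (by positivity : 0 < (H : ℝ) + 2) hℓ0
    (show E₂ < 1 by linarith)
  -- E₁ < 1 says 2 log(1/δ) < n, so δ dominates the failure probability e^{-n/2} of regularity.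
  have hδn : Real.exp (-(n / 2)) ≤ δ := by
    have h1 : 2 * Real.log (1 / δ) / n < 1 := by
      by_contra h
      exact absurd (Real.one_le_sqrt.2 (not_lt.1 h)) (by linarith)
    rw [div_lt_one (by linarith), one_div, Real.log_inv] at h1
    rw [← Real.exp_log hδ]
    exact Real.exp_le_exp.2 (by linarith)
  -- The family contains every input that training can meet under any schedule, replayed ones with
  -- their own perturbations, so the replay randomness plays no further role.
  obtain ⟨q, K, β, Bad, hq, hK, hK2, hβ0, hβ, hBad, hreg⟩ :=
    exists_bad_set_of_family (m := m) (H := H)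
      (Sum.elim (fun i : Fin n => x i + ξ i)
        fun a : Fin n × Fin B × Fin n => x a.2.2 + ξrep a.1 a.2.1 a.2.2) hm hbase40
  set N₀ : ℝ := n * B * √(1 + Ξ) with hN₀
  have hN₀0 : 0 ≤ N₀ := by positivity
  -- The total length of the training path, by `step_sum_le`.
  set ω : ℝ := 2 ^ 17 * κ * N₀ / m with hω
  have hsmall : SmallRadius m H q K β (q / (7 * m)) ω := by
    refine smallRadius_of_le hm0 hℓ1 hK hK2 hβ0 hq (by positivity) ?_
    rw [hω, mul_div_assoc', div_le_one hm']
    refine le_trans ?_ hm1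
    have h1 : 2 ^ 71 * κ ≤ 2 ^ 80 * (1 + κ) ^ 2 := by nlinarith
    have h2 := mul_le_mul_of_nonneg_right h1
      (show 0 ≤ N₀ * ((H : ℝ) + 2) ^ 6 * Real.log m ^ 3 by positivity)
    linarith
  refine le_trainLaw_of_bad hδ.le (hBad.trans (ENNReal.ofReal_le_ofReal (le_trans ?_ hδn)))
    fun W hW S => ?_
  · simp only [Fintype.card_sum, Fintype.card_prod, Fintype.card_fin]
    exact failure_le hm hn rfl hℓ1 hq hbase hB
  have hZ : ∀ i, ‖x i + ξ i‖ ≤ 2 * √(1 + Ξ) := fun i =>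
    norm_add_le_of_supPert (hx i) (hΞ ▸ norm_sq_le_supPert i)
  have hZ' : ∀ i j k, ‖x k + ξrep i j k‖ ≤ 2 * √(1 + Ξ) := fun i j k =>
    norm_add_le_of_supPert (hx k) (hΞ ▸ norm_sq_rep_le_supPert i j k)
  have hclose := hiddenClose_iterate (x := x) (y := y) (ξ := ξ) (ξrep := ξrep) hsmall hη.le
    (by positivity : 0 ≤ 2 * √(1 + Ξ)) hy (fun i => hreg W hW (Sum.inl i)) hZ
    (fun i j k => hreg W hW (Sum.inr (i, j, k))) hZ'
    (step_sum_le hm' hκ hηκ (by linarith) hB' hβ0 hβ (by positivity) rfl) S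
  -- The drift of the iterates and the linear part of the feature functions each use 1/2 of the
  -- margin 1.
  have hmain := expectedError_le_sInf (x := x) (y := y) (ξ := ξ) (ξrep := ξrep) (η := η) (W := W)
    hn hy S (show 0 ≤ R / m by positivity)
    (fun i s => (abs_net_sub_le hsmall (hreg W hW (Sum.inl s)) (hclose i)).trans
      (drift_le hm' hH (by linarith) (by positivity) hβ0 hβ hκ hN₀0 (norm_nonneg _) (hZ s) hmom1 hm1))
    (fun U hU s => (abs_innerW_gradNet_le hsmall (hreg W hW (Sum.inl s)) hU (by positivity)).trans
      (feature_le hm' hH rfl (by positivity) hβ hκ (hZ s) hβ0 hR.le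
        hmom2 hm1))
  change expectedError x y ξ ξrep η W S ≤ _
  linarith
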